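/- All spaces are vector spaces over $\mathbb C$ and coalgebras are coassociative and counital; Sweedler notation is used: $\Delta(k)=k^{(1)}\otimes k^{(2)}$, left coactions $x\mapsto x_{(-1)}\otimes x_{(0)}$, right coactions $x\mapsto x_{(0)}\otimes x_{(1)}$. For a right $C$-comodule $X$ and a left $C$-comodule $Y$, $X\square_C Y=\{x\otimes y:\ x_{(0)}\otimes x_{(1)}\otimes y=x\otimes y_{(-1)}\otimes y_{(0)}\}\subseteq X\otimes Y$ (sums suppressed). **Left $\times_S$-Hopf coalgebras.** A left bicoalgebroid over a coalgebra $S$ is a coalgebra $\mathcal K$ with coalgebra maps $\alpha:\mathcal K\to S$, $\beta:\mathcal K\to S_{\rm cop}$ such that $\alpha(k^{(1)})\otimes\beta(k^{(2)})=\alpha(k^{(2)})\otimes\beta(k^{(1)})$, together with $S$-bicomodule maps $\mu:\mathcal K\square_S\mathcal K\to\mathcal K$ (written $g\otimes h\mapsto gh$) and $\eta:S\to\mathcal K$, where $\mathcal K$ is an $S$-bicomodule by $k\mapsto\alpha(k^{(1)})\otimes k^{(2)}$ and $k\mapsto k^{(2)}\otimes\beta(k^{(1)})$, such that $\mu$ is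 associative and - $gh^{(1)}\otimes\alpha(h^{(2)})=g^{(1)}h\otimes\beta(g^{(2)})$, $\ \Delta(gh)=g^{(1)}h^{(1)}\otimes g^{(2)}h^{(2)}$, $\ \varepsilon(gh)=\varepsilon(g)\varepsilon(h)$ for $g\otimes h\in\mathcal K\square_S\mathcal K$; - $\eta(\alpha(k^{(1)}))k^{(2)}=k=k^{(2)}\eta(\beta(k^{(1)}))$ for $k\in\mathcal K$; - $\Delta(\eta(c))=\eta(c)^{(1)}\otimes\eta(\alpha(\eta(c)^{(2)}))=\eta(c)^{(1)}\otimes\eta(\beta(\eta(c)^{(2)}))$ and $\varepsilon(\eta(c))=\varepsilon(c)$ for $c\in S$. It is a left $\times_S$-Hopf coalgebra if $\nu:k\otimes k'\mapsto kk'^{(1)}\otimes k'^{(2)}$ is a bijection from $\mathcal K\square_S\mathcal K$ onto $\mathcal K\square_{S_{\rm cop}}\mathcal K$, the latter for the coactions $k\mapsto k^{(1)}\otimes\beta(k^{(2)})$ and $k\mapsto\beta(k^{(1)})\otimes k^{(2)}$. Write $\nu^{-1}(k\otimes k')=\nu^-(k,k')\otimes\nu^+(k,k')$. **Left-right SAYD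 modules.** A left $\mathcal K$-module is a left $S$-comodule $M$ with an associative and unital left $S$-colinear action $\triangleright:\mathcal K\square_S M\to M$ (unitality: $\eta(m_{(-1)})\triangleright m_{(0)}=m$; colinearity: $k\triangleright m\mapsto\alpha(k^{(1)})\otimes k^{(2)}\triangleright m$); it has the canonical right $S$-coaction $m\mapsto\eta(m_{(-1)})^{(1)}\triangleright m_{(0)}\otimes\alpha(\eta(m_{(-1)})^{(2)})$. A left-right SAYD module over $\mathcal K$ is a left $\mathcal K$-module $M$ which is also a right comodule $m\mapsto m_{(0)}\otimes m_{(1)}$ over the coalgebra $\mathcal K$, such that the two $S$-bicomodule structures of $M$ coincide, i.e. the left $S$-coaction is $m\mapsto\beta(m_{(1)})\otimes m_{(0)}$ and the canonical right $S$-coaction is $m\mapsto m_{(0)}\otimes\alpha(m_{(1)})$, such that for all $k\otimes m\in\mathcal K\square_S M$ $$(k\triangleright m)_{(0)}\otimes(k\triangleright m)_{(1)}=\nu^+(m_{(1)},k^{(1)})\triangleright m_{(0)}\otimes k^{(2)}\,\nu^-(m_{(1)},k^{(1)}),$$ and such that $m_{(1)}\triangleright m_{(0)}=m$ for all $m\in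 M$. **Left comodule coalgebras.** A left $\mathcal K$-comodule coalgebra is a coalgebra $T$ with a left comodule structure $t\mapsto t_{(-1)}\otimes t_{(0)}$ over the coalgebra $\mathcal K$ such that $t_{(-1)}\varepsilon(t_{(0)})=\eta(\alpha(t_{(-1)}))\varepsilon(t_{(0)})$, $\ t_{(-1)}\otimes t_{(0)}{}^{(1)}\otimes t_{(0)}{}^{(2)}=t^{(1)}{}_{(-1)}t^{(2)}{}_{(-1)}\otimes t^{(1)}{}_{(0)}\otimes t^{(2)}{}_{(0)}$ and $\ \beta(t^{(1)}{}_{(-1)})\otimes t^{(1)}{}_{(0)}\otimes t^{(2)}=\alpha(t^{(2)}{}_{(-1)})\otimes t^{(1)}\otimes t^{(2)}{}_{(0)}$. It is an $S$-bicomodule by $t\mapsto\alpha(t_{(-1)})\otimes t_{(0)}$ and $t\mapsto t_{(0)}\otimes\beta(t_{(-1)})$, and $T^{\square_S(n+1)}$ is a left $\mathcal K$-comodule by $t_0\otimes\cdots\otimes t_n\mapsto t_{0(-1)}\cdots t_{n(-1)}\otimes t_{0(0)}\otimes\cdots\otimes t_{n(0)}$. **Proposition.** Let $\mathcal K$ be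 a left $\times_S$-Hopf coalgebra, $T$ a left $\mathcal K$-comodule coalgebra and $M$ a left-right SAYD module over $\mathcal K$. For $n\ge 0$ put ${}^{\mathcal K}C^n(T,M)=M\square_{\mathcal K}T^{\square_S(n+1)}$. The following operators are well defined between these spaces, where $m\otimes t_0\otimes\cdots\otimes t_n$ stands for an element of ${}^{\mathcal K}C^n(T,M)$: - $d_i:{}^{\mathcal K}C^n\to{}^{\mathcal K}C^{n+1}$, $\ d_i(m\otimes t_0\otimes\cdots\otimes t_n)=m\otimes t_0\otimes\cdots\otimes\Delta(t_i)\otimes\cdots\otimes t_n$ for $0\le i\le n$; - $d_{n+1}:{}^{\mathcal K}C^n\to{}^{\mathcal K}C^{n+1}$, $\ d_{n+1}(m\otimes t_0\otimes\cdots\otimes t_n)=t_0{}^{(2)}{}_{(-1)}t_{1(-1)}\cdots t_{n(-1)}\triangleright m\otimes t_0{}^{(2)}{}_{(0)}\otimes t_{1(0)}\otimes\cdots\otimes t_{n(0)}\otimes t_0{}^{(1)}$; - $s_i:{}^{\mathcal K}C^{n}\to{}^{\mathcal K}C^{n-1}$ ($n\ge 1$), $\ s_i(m\otimes t_0\otimes\cdots\otimes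 t_n)=m\otimes t_0\otimes\cdots\otimes\varepsilon(t_{i+1})\otimes\cdots\otimes t_n$ for $0\le i\le n-1$; - $\mathfrak t_n:{}^{\mathcal K}C^n\to{}^{\mathcal K}C^n$, $\ \mathfrak t_n(m\otimes t_0\otimes\cdots\otimes t_n)=t_{1(-1)}\cdots t_{n(-1)}\triangleright m\otimes t_{1(0)}\otimes\cdots\otimes t_{n(0)}\otimes t_0$ for $n\ge1$, and $\mathfrak t_0=\mathrm{id}$. With them ${}^{\mathcal K}C^\bullet(T,M)$ is a cocyclic module: the cosimplicial identities hold, as do $\mathfrak t_{n+1}d_{i}=d_{i-1}\mathfrak t_{n}$ ($1\le i\le n+1$) and $\mathfrak t_{n+1}d_0=d_{n+1}$ on ${}^{\mathcal K}C^n$, $\ \mathfrak t_ns_i=s_{i-1}\mathfrak t_{n+1}$ ($1\le i\le n$) and $\mathfrak t_ns_0=s_n\mathfrak t_{n+1}^2$ on ${}^{\mathcal K}C^{n+1}$, and $\mathfrak t_n^{\,n+1}=\mathrm{id}$. Consequently the cyclic cochains $\{x\in{}^{\mathcal K}C^n:\mathfrak t_nx=(-1)^nx\}$ form a complex under $b=\sum_{i=0}^{n+1}(-1)^id_i$,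 whose cohomology is the Hopf cyclic cohomology ${}^{\mathcal K}HC^*(T,M)$. -/

import Mathlib

open scoped TensorProduct

noncomputable section

namespace TimesHopf

section General

variable {C X Y E V : Type*}
  [AddCommGroup C] [Module ℂ C] [AddCommGroup X] [Module ℂ X] [AddCommGroup Y] [Module ℂ Y]
  [AddCommGroup E] [Module ℂ E] [AddCommGroup V] [Module ℂ V]

/-- A coassociative and counital left coaction of the coalgebra `C` on `X`. -/
structure IsLeftCoaction [Coalgebra ℂ C] (l : X →ₗ[ℂ] C ⊗[ℂ] X) : Prop where
  coassoc : ∀ x, TensorProduct.assoc ℂ C C X ((Coalgebra.comul (R := ℂ) (A := C)).rTensor X (l x))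
    = l.lTensor C (l x)
  counit : ∀ x, TensorProduct.lid ℂ X ((Coalgebra.counit (R := ℂ) (A := C)).rTensor X (l x)) = x

/-- A coassociative and counital right coaction of the coalgebra `C` on `X`. -/
structure IsRightCoaction [Coalgebra ℂ C] (r : X →ₗ[ℂ] X ⊗[ℂ] C) : Prop where
  coassoc : ∀ x, TensorProduct.assoc ℂ X C C (r.rTensor C (r x))
    = (Coalgebra.comul (R := ℂ) (A := C)).lTensor X (r x)
  counit : ∀ x, TensorProduct.rid ℂ X ((Coalgebra.counit (R := ℂ) (A := C)).lTensor X (r x)) = x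

/-- The cotensor product `X □_C Y` of a right coaction `r` and a left coaction `l`: the subspace of
`X ⊗ Y` on which `x₀ ⊗ x₁ ⊗ y = x ⊗ y₋₁ ⊗ y₀`. -/
def cotensor (r : X →ₗ[ℂ] X ⊗[ℂ] C) (l : Y →ₗ[ℂ] C ⊗[ℂ] Y) : Submodule ℂ (X ⊗[ℂ] Y) :=
  LinearMap.eqLocus ((TensorProduct.assoc ℂ X C Y).toLinearMap ∘ₗ r.rTensor Y) (l.lTensor X)

/-- Some linear extension to the whole space of a linear map defined on a subspace.
It serves to write formulas such as `μ(g₁ ⊗ h) ⊗ β(g₂)`, in which a map given only on a cotensor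
product is applied to some legs of a tensor whose legs together lie in that cotensor product. By
`extend_rTensor` below, the values do not depend on the extension. -/
def extend (p : Submodule ℂ E) (f : p →ₗ[ℂ] V) : E →ₗ[ℂ] V :=
  Classical.choose (LinearMap.exists_extend f)

theorem extend_apply (p : Submodule ℂ E) (f : p →ₗ[ℂ] V) (x : p) : extend p f x = f x :=
  LinearMap.congr_fun (Classical.choose_spec (LinearMap.exists_extend f)) x

theorem extend_rTensor (p : Submodule ℂ E) (f : p →ₗ[ℂ] V) (z : p ⊗[ℂ] Y) :
    (extend p f).rTensor Y (p.subtype.rTensor Y z) = f.rTensor Y z := by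
  rw [← LinearMap.rTensor_comp_apply]
  congr 2
  ext x
  exact extend_apply p f x

end General

section Bicoalgebroid

variable (C K : Type*) [AddCommGroup C] [Module ℂ C] [Coalgebra ℂ C]
  [AddCommGroup K] [Module ℂ K] [Coalgebra ℂ K]

/-- The source and target maps of a bicoalgebroid: a coalgebra map `α : K → C` and a coalgebra map
`β : K → C_cop` with cocommuting images. -/
structure SourceTarget where
  α : K →ₗc[ℂ] C
  β : K →ₗ[ℂ] C
  comul_β : ∀ k, Coalgebra.comul (R := ℂ) (β k)
    = TensorProduct.comm ℂ C C (TensorProduct.map β β (Coalgebra.comul (R := ℂ) k))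
  counit_β : ∀ k, Coalgebra.counit (R := ℂ) (β k) = Coalgebra.counit (R := ℂ) k
  cocommute : ∀ k, TensorProduct.map (α : K →ₗ[ℂ] C) β (Coalgebra.comul (R := ℂ) k)
    = TensorProduct.map (α : K →ₗ[ℂ] C) β
        (TensorProduct.comm ℂ K K (Coalgebra.comul (R := ℂ) k))

variable {C K}

/-- The left coaction `k ↦ α(k₁) ⊗ k₂` of `C` on `K`. -/
def SourceTarget.leftC (B : SourceTarget C K) : K →ₗ[ℂ] C ⊗[ℂ] K :=
  (B.α : K →ₗ[ℂ] C).rTensor K ∘ₗ Coalgebra.comul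

/-- The right coaction `k ↦ k₂ ⊗ β(k₁)` of `C` on `K`. -/
def SourceTarget.rightC (B : SourceTarget C K) : K →ₗ[ℂ] K ⊗[ℂ] C :=
  B.β.lTensor K ∘ₗ (TensorProduct.comm ℂ K K).toLinearMap ∘ₗ Coalgebra.comul

/-- `K □_C K`. -/
def SourceTarget.KK (B : SourceTarget C K) : Submodule ℂ (K ⊗[ℂ] K) := cotensor B.rightC B.leftC

/-- `K □_{C_cop} K`, for the coactions `k ↦ k₁ ⊗ β(k₂)` and `k ↦ β(k₁) ⊗ k₂`. -/
def SourceTarget.KKcop (B : SourceTarget C K) : Submodule ℂ (K ⊗[ℂ] K) :=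
  cotensor (B.β.lTensor K ∘ₗ Coalgebra.comul) (B.β.rTensor K ∘ₗ Coalgebra.comul)

/-- `K □_C K □_C Y` inside `K ⊗ (K ⊗ Y)`, for a left coaction `l` of `C` on `Y`. -/
def SourceTarget.triple (B : SourceTarget C K) {Y : Type*} [AddCommGroup Y] [Module ℂ Y]
    (l : Y →ₗ[ℂ] C ⊗[ℂ] Y) : Submodule ℂ (K ⊗[ℂ] (K ⊗[ℂ] Y)) :=
  LinearMap.range ((cotensor B.rightC l).subtype.lTensor K) ⊓
    (LinearMap.range (B.KK.subtype.rTensor Y)).comap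
      (TensorProduct.assoc ℂ K K Y).symm.toLinearMap

variable (C K)

/-- The data of a bicoalgebroid: source, target, multiplication on `K □_C K`, and unit. -/
structure BicoalgebroidData extends SourceTarget C K where
  mul : toSourceTarget.KK →ₗ[ℂ] K
  η : C →ₗ[ℂ] K

variable {C K}

/-- The multiplication, extended from `K □_C K` to `K ⊗ K`. -/
def BicoalgebroidData.mulExt (B : BicoalgebroidData C K) : K ⊗[ℂ] K →ₗ[ℂ] K := extend B.KK B.mul

variable (C K)

/-- A left bicoalgebroid `K` over the coalgebra `C`. -/
structure LeftBicoalgebroid extends BicoalgebroidData C K where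
  /-- `α((gh)₁) ⊗ (gh)₂ = α(g₁) ⊗ g₂h` -/
  mul_leftC : ∀ x : toBicoalgebroidData.KK, toBicoalgebroidData.leftC (mul x)
    = toBicoalgebroidData.mulExt.lTensor C
        (TensorProduct.assoc ℂ C K K (toBicoalgebroidData.leftC.rTensor K x))
  /-- `(gh)₂ ⊗ β((gh)₁) = gh₂ ⊗ β(h₁)` -/
  mul_rightC : ∀ x : toBicoalgebroidData.KK, toBicoalgebroidData.rightC (mul x)
    = toBicoalgebroidData.mulExt.rTensor C
        ((TensorProduct.assoc ℂ K K C).symm (toBicoalgebroidData.rightC.lTensor K x))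
  /-- `α(η(c)₁) ⊗ η(c)₂ = c₁ ⊗ η(c₂)` -/
  η_leftC : ∀ c, toBicoalgebroidData.leftC (η c) = η.lTensor C (Coalgebra.comul c)
  /-- `η(c)₂ ⊗ β(η(c)₁) = η(c₁) ⊗ c₂` -/
  η_rightC : ∀ c, toBicoalgebroidData.rightC (η c) = η.rTensor C (Coalgebra.comul c)
  /-- `g(hk) = (gh)k` on `K □_C K □_C K` -/
  mul_assoc : ∀ z ∈ toBicoalgebroidData.triple toBicoalgebroidData.leftC,
    toBicoalgebroidData.mulExt (toBicoalgebroidData.mulExt.lTensor K z)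
      = toBicoalgebroidData.mulExt
          (toBicoalgebroidData.mulExt.rTensor K ((TensorProduct.assoc ℂ K K K).symm z))
  /-- `gh₁ ⊗ α(h₂) = g₁h ⊗ β(g₂)` -/
  takeuchi : ∀ x : toBicoalgebroidData.KK,
    toBicoalgebroidData.mulExt.rTensor C ((TensorProduct.assoc ℂ K K C).symm
        (((α : K →ₗ[ℂ] C).lTensor K ∘ₗ Coalgebra.comul).lTensor K x))
      = toBicoalgebroidData.mulExt.rTensor C (TensorProduct.rightComm ℂ K C K
        ((β.lTensor K ∘ₗ Coalgebra.comul).rTensor K x))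
  /-- `(gh)₁ ⊗ (gh)₂ = g₁h₁ ⊗ g₂h₂` -/
  comul_mul : ∀ x : toBicoalgebroidData.KK, Coalgebra.comul (R := ℂ) (mul x)
    = TensorProduct.map toBicoalgebroidData.mulExt toBicoalgebroidData.mulExt
        (TensorProduct.tensorTensorTensorComm ℂ K K K K
          (TensorProduct.map Coalgebra.comul Coalgebra.comul (x : K ⊗[ℂ] K)))
  /-- `ε(gh) = ε(g)ε(h)` -/
  counit_mul : ∀ x : toBicoalgebroidData.KK, Coalgebra.counit (R := ℂ) (mul x)
    = TensorProduct.lid ℂ ℂ (TensorProduct.map Coalgebra.counit Coalgebra.counit (x : K ⊗[ℂ] K))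
  /-- `η(α(k₁))k₂ = k` -/
  one_mul : ∀ k, toBicoalgebroidData.mulExt (η.rTensor K (toBicoalgebroidData.leftC k)) = k
  /-- `k₂η(β(k₁)) = k` -/
  mul_one : ∀ k, toBicoalgebroidData.mulExt (η.lTensor K (toBicoalgebroidData.rightC k)) = k
  /-- `η(c)₁ ⊗ η(c)₂ = η(c)₁ ⊗ η(α(η(c)₂))` -/
  comul_η_α : ∀ c, Coalgebra.comul (R := ℂ) (η c)
    = (η ∘ₗ (α : K →ₗ[ℂ] C)).lTensor K (Coalgebra.comul (η c))
  /-- `η(c)₁ ⊗ η(c)₂ = η(c)₁ ⊗ η(β(η(c)₂))` -/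
  comul_η_β : ∀ c, Coalgebra.comul (R := ℂ) (η c)
    = (η ∘ₗ β).lTensor K (Coalgebra.comul (η c))
  counit_η : ∀ c, Coalgebra.counit (R := ℂ) (η c) = Coalgebra.counit (R := ℂ) c

variable {C K}

/-- The Galois map `ν : k ⊗ k' ↦ kk'₁ ⊗ k'₂` (meaningful on `K □_C K`). -/
def LeftBicoalgebroid.galois (B : LeftBicoalgebroid C K) : K ⊗[ℂ] K →ₗ[ℂ] K ⊗[ℂ] K :=
  B.mulExt.rTensor K ∘ₗ (TensorProduct.assoc ℂ K K K).symm.toLinearMap ∘ₗ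
    (Coalgebra.comul (R := ℂ) (A := K)).lTensor K

variable (C K)

/-- A left `×_C`-Hopf coalgebra: a left bicoalgebroid whose Galois map is a bijection from
`K □_C K` to `K □_{C_cop} K`. -/
structure LeftHopfCoalgebra extends LeftBicoalgebroid C K where
  galois_bijOn : Set.BijOn toLeftBicoalgebroid.galois toLeftBicoalgebroid.KK
    toLeftBicoalgebroid.KKcop

variable {C K}

/-- The Galois map as a linear equivalence `K □_C K ≃ K □_{C_cop} K`. -/
def LeftHopfCoalgebra.galoisEquiv (H : LeftHopfCoalgebra C K) : H.KK ≃ₗ[ℂ] H.KKcop :=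
  LinearEquiv.ofBijective
    (H.galois.restrict (p := H.KK) (q := H.KKcop) fun _ hx => H.galois_bijOn.mapsTo hx)
    ⟨fun x y h => Subtype.ext (H.galois_bijOn.injOn x.2 y.2 (congrArg Subtype.val h)),
      fun y => by
        obtain ⟨x, hx, hxy⟩ := H.galois_bijOn.surjOn y.2
        exact ⟨⟨x, hx⟩, Subtype.ext hxy⟩⟩

/-- The inverse `ν⁻¹ : k ⊗ k' ↦ ν⁻(k, k') ⊗ ν⁺(k, k')` of the Galois map, extended from
`K □_{C_cop} K` to `K ⊗ K`. -/
def LeftHopfCoalgebra.galoisInvExt (H : LeftHopfCoalgebra C K) : K ⊗[ℂ] K →ₗ[ℂ] K ⊗[ℂ] K :=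
  extend H.KKcop (H.KK.subtype ∘ₗ H.galoisEquiv.symm.toLinearMap)

end Bicoalgebroid

section Modules

variable {C K : Type*} [AddCommGroup C] [Module ℂ C] [Coalgebra ℂ C]
  [AddCommGroup K] [Module ℂ K] [Coalgebra ℂ K]

/-- The data of a left `K`-module: a left coaction of `C` and an action `K □_C M → M`. -/
structure ModuleData (B : LeftBicoalgebroid C K) (M : Type*) [AddCommGroup M] [Module ℂ M] where
  coactC : M →ₗ[ℂ] C ⊗[ℂ] M
  act : cotensor B.rightC coactC →ₗ[ℂ] M

/-- The action, extended from `K □_C M` to `K ⊗ M`. -/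
def ModuleData.actExt {B : LeftBicoalgebroid C K} {M : Type*} [AddCommGroup M] [Module ℂ M]
    (N : ModuleData B M) : K ⊗[ℂ] M →ₗ[ℂ] M :=
  extend (cotensor B.rightC N.coactC) N.act

/-- A left module over a left bicoalgebroid. -/
structure LeftModule (B : LeftBicoalgebroid C K) (M : Type*) [AddCommGroup M] [Module ℂ M] extends
    ModuleData B M where
  coactC_isLeftCoaction : IsLeftCoaction coactC
  /-- `(k▷m)₋₁ ⊗ (k▷m)₀ = α(k₁) ⊗ k₂▷m` -/
  act_coactC : ∀ x : cotensor B.rightC coactC, coactC (act x)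
    = toModuleData.actExt.lTensor C (TensorProduct.assoc ℂ C K M (B.leftC.rTensor M x))
  /-- `k▷(k'▷m) = (kk')▷m` on `K □_C K □_C M` -/
  mul_act : ∀ z ∈ B.triple coactC,
    toModuleData.actExt (toModuleData.actExt.lTensor K z)
      = toModuleData.actExt (B.mulExt.rTensor M ((TensorProduct.assoc ℂ K K M).symm z))
  /-- `η(m₋₁)▷m₀ = m` -/
  one_act : ∀ m, toModuleData.actExt (B.η.rTensor M (coactC m)) = m

/-- The canonical right coaction `m ↦ η(m₋₁)₁▷m₀ ⊗ α(η(m₋₁)₂)` of `C` on a left `K`-module. -/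
def LeftModule.canonicalRightC {B : LeftBicoalgebroid C K} {M : Type*}
    [AddCommGroup M] [Module ℂ M] (N : LeftModule B M) : M →ₗ[ℂ] M ⊗[ℂ] C :=
  TensorProduct.map N.actExt (B.α : K →ₗ[ℂ] C) ∘ₗ
    (TensorProduct.rightComm ℂ K K M).toLinearMap ∘ₗ
    (Coalgebra.comul ∘ₗ B.η).rTensor M ∘ₗ N.coactC

/-- The rearrangement `(k₁ ⊗ k₂) ⊗ (m₀ ⊗ m₁) ↦ (m₁ ⊗ k₁) ⊗ (m₀ ⊗ k₂)`. -/
def aydShuffle₁ (K M : Type*) [AddCommGroup K] [Module ℂ K] [AddCommGroup M] [Module ℂ M] :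
    (K ⊗[ℂ] K) ⊗[ℂ] (M ⊗[ℂ] K) ≃ₗ[ℂ] (K ⊗[ℂ] K) ⊗[ℂ] (M ⊗[ℂ] K) :=
  TensorProduct.congr (LinearEquiv.refl ℂ _) (TensorProduct.comm ℂ M K) ≪≫ₗ
    TensorProduct.tensorTensorTensorComm ℂ K K K M ≪≫ₗ
    TensorProduct.congr (TensorProduct.comm ℂ K K) (TensorProduct.comm ℂ K M)

theorem aydShuffle₁_tmul {K M : Type*} [AddCommGroup K] [Module ℂ K] [AddCommGroup M] [Module ℂ M]
    (k₁ k₂ m₁ : K) (m₀ : M) :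
    aydShuffle₁ K M ((k₁ ⊗ₜ k₂) ⊗ₜ (m₀ ⊗ₜ m₁)) = (m₁ ⊗ₜ k₁) ⊗ₜ (m₀ ⊗ₜ k₂) := by
  simp [aydShuffle₁]

/-- The rearrangement `(a ⊗ b) ⊗ (m ⊗ k) ↦ (b ⊗ m) ⊗ (k ⊗ a)`. -/
def aydShuffle₂ (K M : Type*) [AddCommGroup K] [Module ℂ K] [AddCommGroup M] [Module ℂ M] :
    (K ⊗[ℂ] K) ⊗[ℂ] (M ⊗[ℂ] K) ≃ₗ[ℂ] (K ⊗[ℂ] M) ⊗[ℂ] (K ⊗[ℂ] K) :=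
  TensorProduct.congr (TensorProduct.comm ℂ K K) (LinearEquiv.refl ℂ _) ≪≫ₗ
    TensorProduct.tensorTensorTensorComm ℂ K K M K ≪≫ₗ
    TensorProduct.congr (LinearEquiv.refl ℂ _) (TensorProduct.comm ℂ K K)

theorem aydShuffle₂_tmul {K M : Type*} [AddCommGroup K] [Module ℂ K] [AddCommGroup M] [Module ℂ M]
    (a b k : K) (m : M) :
    aydShuffle₂ K M ((a ⊗ₜ b) ⊗ₜ (m ⊗ₜ k)) = (b ⊗ₜ m) ⊗ₜ (k ⊗ₜ a) := by
  simp [aydShuffle₂]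

/-- A left-right stable anti-Yetter-Drinfeld module over a left `×_C`-Hopf coalgebra: a left
`K`-module and right `K`-comodule, whose `C`-bicomodule structures coming from the module and from
the comodule structure coincide, with the anti-Yetter-Drinfeld condition and stability. -/
structure LeftRightSAYD (H : LeftHopfCoalgebra C K) (M : Type*) [AddCommGroup M] [Module ℂ M]
    extends LeftModule H.toLeftBicoalgebroid M where
  coact : M →ₗ[ℂ] M ⊗[ℂ] K
  coact_isRightCoaction : IsRightCoaction coact
  /-- The left coaction of `C` is `m ↦ β(m₁) ⊗ m₀`. -/
  leftC_eq : ∀ m, coactC m = H.β.rTensor M (TensorProduct.comm ℂ M K (coact m))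
  /-- `m₀ ⊗ α(m₁)` is the canonical right coaction of `C`. -/
  rightC_eq : ∀ m, (H.α : K →ₗ[ℂ] C).lTensor M (coact m) = toLeftModule.canonicalRightC m
  /-- `(k▷m)₀ ⊗ (k▷m)₁ = ν⁺(m₁, k₁)▷m₀ ⊗ k₂ν⁻(m₁, k₁)` on `K □_C M` -/
  ayd : ∀ x : cotensor H.rightC coactC, coact (act x)
    = TensorProduct.map toLeftModule.actExt H.mulExt (aydShuffle₂ K M
        (H.galoisInvExt.rTensor (M ⊗[ℂ] K) (aydShuffle₁ K M
          (TensorProduct.map Coalgebra.comul coact (x : K ⊗[ℂ] M)))))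
  /-- `m₁▷m₀ = m` -/
  stable : ∀ m, toLeftModule.actExt (TensorProduct.comm ℂ M K (coact m)) = m

/-- A left `K`-comodule coalgebra `T`. -/
structure LeftComoduleCoalgebra (H : LeftHopfCoalgebra C K) (T : Type*)
    [AddCommGroup T] [Module ℂ T] [Coalgebra ℂ T] where
  coact : T →ₗ[ℂ] K ⊗[ℂ] T
  coact_isLeftCoaction : IsLeftCoaction coact
  /-- `t₋₁ε(t₀) = η(α(t₋₁))ε(t₀)` -/
  counit_coact : ∀ t, TensorProduct.rid ℂ K (Coalgebra.counit.lTensor K (coact t))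
    = H.η (H.α (TensorProduct.rid ℂ K (Coalgebra.counit.lTensor K (coact t))))
  /-- `t₋₁ ⊗ t₀₁ ⊗ t₀₂ = t₁₋₁t₂₋₁ ⊗ t₁₀ ⊗ t₂₀` -/
  comul_coact : ∀ t, Coalgebra.comul.lTensor K (coact t)
    = H.mulExt.rTensor (T ⊗[ℂ] T) (TensorProduct.tensorTensorTensorComm ℂ K T K T
        (TensorProduct.map coact coact (Coalgebra.comul (R := ℂ) t)))
  /-- `t₁₀ ⊗ β(t₁₋₁) ⊗ t₂ = t₁ ⊗ α(t₂₋₁) ⊗ t₂₀` -/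
  cobalanced : ∀ t, Coalgebra.comul (R := ℂ) t ∈
    cotensor (H.β.lTensor T ∘ₗ (TensorProduct.comm ℂ K T).toLinearMap ∘ₗ coact)
      ((H.α : K →ₗ[ℂ] C).rTensor T ∘ₗ coact)

/-- The left coaction `t ↦ α(t₋₁) ⊗ t₀` of `C` on `T`. -/
def LeftComoduleCoalgebra.leftC {H : LeftHopfCoalgebra C K} {T : Type*}
    [AddCommGroup T] [Module ℂ T] [Coalgebra ℂ T] (L : LeftComoduleCoalgebra H T) :
    T →ₗ[ℂ] C ⊗[ℂ] T :=
  (H.α : K →ₗ[ℂ] C).rTensor T ∘ₗ L.coact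

/-- The right coaction `t ↦ t₀ ⊗ β(t₋₁)` of `C` on `T`. -/
def LeftComoduleCoalgebra.rightC {H : LeftHopfCoalgebra C K} {T : Type*}
    [AddCommGroup T] [Module ℂ T] [Coalgebra ℂ T] (L : LeftComoduleCoalgebra H T) :
    T →ₗ[ℂ] T ⊗[ℂ] C :=
  H.β.lTensor T ∘ₗ (TensorProduct.comm ℂ K T).toLinearMap ∘ₗ L.coact

end Modules

section TensorPowers

variable (T : Type*) [AddCommGroup T] [Module ℂ T]

/-- `Tpow T n = T^{⊗(n+1)}`, in the form `T ⊗ (T ⊗ (⋯ ⊗ T))`. -/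
def Tpow : ℕ → ModuleCat ℂ
  | 0 => ModuleCat.of ℂ T
  | n + 1 => ModuleCat.of ℂ (T ⊗[ℂ] Tpow n)

/-- `T^{⊗1} = T`. -/
def Tpow.one : T ≃ₗ[ℂ] Tpow T 0 := LinearEquiv.refl ℂ T

/-- `T ⊗ T^{⊗(n+1)} = T^{⊗(n+2)}`. -/
def Tpow.cons (n : ℕ) : T ⊗[ℂ] Tpow T n ≃ₗ[ℂ] Tpow T (n + 1) :=
  LinearEquiv.refl ℂ (T ⊗[ℂ] Tpow T n)

/-- `t ⊗ (t₀ ⊗ ⋯ ⊗ tₙ) ↦ t₀ ⊗ ⋯ ⊗ tₙ ⊗ t`. -/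
def Tpow.snoc : (n : ℕ) → T ⊗[ℂ] Tpow T n →ₗ[ℂ] Tpow T (n + 1)
  | 0 => (Tpow.cons T 0).toLinearMap ∘ₗ
      (TensorProduct.congr (LinearEquiv.refl ℂ T) (Tpow.one T)).toLinearMap ∘ₗ
      (TensorProduct.comm ℂ T T).toLinearMap ∘ₗ
      (TensorProduct.congr (LinearEquiv.refl ℂ T) (Tpow.one T).symm).toLinearMap
  | n + 1 => (Tpow.cons T (n + 1)).toLinearMap ∘ₗ (Tpow.snoc n).lTensor T ∘ₗ
      (TensorProduct.leftComm ℂ T T (Tpow T n)).toLinearMap ∘ₗ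
      (Tpow.cons T n).symm.toLinearMap.lTensor T

variable [Coalgebra ℂ T]

/-- `t₀ ⊗ ⋯ ⊗ tₙ ↦ t₀ ⊗ ⋯ ⊗ Δ(tᵢ) ⊗ ⋯ ⊗ tₙ`, for `0 ≤ i ≤ n`. -/
def Tpow.comulAt : (n : ℕ) → Fin (n + 1) → (Tpow T n →ₗ[ℂ] Tpow T (n + 1))
  | 0, _ => (Tpow.cons T 0).toLinearMap ∘ₗ (Tpow.one T).toLinearMap.lTensor T ∘ₗ
      Coalgebra.comul ∘ₗ (Tpow.one T).symm.toLinearMap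
  | n + 1, i => Fin.cases
      ((Tpow.cons T (n + 1)).toLinearMap ∘ₗ (Tpow.cons T n).toLinearMap.lTensor T ∘ₗ
        (TensorProduct.assoc ℂ T T (Tpow T n)).toLinearMap ∘ₗ
        (Coalgebra.comul (R := ℂ) (A := T)).rTensor (Tpow T n) ∘ₗ
        (Tpow.cons T n).symm.toLinearMap)
      (fun j => (Tpow.cons T (n + 1)).toLinearMap ∘ₗ (Tpow.comulAt n j).lTensor T ∘ₗ
        (Tpow.cons T n).symm.toLinearMap) i

/-- `t₀ ⊗ ⋯ ⊗ tₙ₊₁ ↦ t₀ ⊗ ⋯ ⊗ ε(tᵢ₊₁) ⊗ ⋯ ⊗ tₙ₊₁`, for `0 ≤ i ≤ n`. -/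
def Tpow.counitAt : (n : ℕ) → Fin (n + 1) → (Tpow T (n + 1) →ₗ[ℂ] Tpow T n)
  | 0, _ => (Tpow.one T).toLinearMap ∘ₗ (TensorProduct.rid ℂ T).toLinearMap ∘ₗ
      (Coalgebra.counit ∘ₗ (Tpow.one T).symm.toLinearMap).lTensor T ∘ₗ
      (Tpow.cons T 0).symm.toLinearMap
  | n + 1, i => Fin.cases
      ((Tpow.cons T n).toLinearMap ∘ₗ
        ((TensorProduct.lid ℂ (Tpow T n)).toLinearMap ∘ₗ
          (Coalgebra.counit (R := ℂ) (A := T)).rTensor (Tpow T n) ∘ₗ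
          (Tpow.cons T n).symm.toLinearMap).lTensor T ∘ₗ
        (Tpow.cons T (n + 1)).symm.toLinearMap)
      (fun j => (Tpow.cons T n).toLinearMap ∘ₗ (Tpow.counitAt n j).lTensor T ∘ₗ
        (Tpow.cons T (n + 1)).symm.toLinearMap) i

end TensorPowers

section Cochains

variable {C K T M : Type*} [AddCommGroup C] [Module ℂ C] [Coalgebra ℂ C]
  [AddCommGroup K] [Module ℂ K] [Coalgebra ℂ K]
  [AddCommGroup T] [Module ℂ T] [Coalgebra ℂ T] [AddCommGroup M] [Module ℂ M]
  {H : LeftHopfCoalgebra C K}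

/-- The left coaction of `C` on `T^{⊗(n+1)}` by the first tensor factor. -/
def LeftComoduleCoalgebra.headC (L : LeftComoduleCoalgebra H T) :
    (n : ℕ) → Tpow T n →ₗ[ℂ] C ⊗[ℂ] Tpow T n
  | 0 => (Tpow.one T).toLinearMap.lTensor C ∘ₗ L.leftC ∘ₗ (Tpow.one T).symm.toLinearMap
  | n + 1 => (Tpow.cons T n).toLinearMap.lTensor C ∘ₗ
      (TensorProduct.assoc ℂ C T (Tpow T n)).toLinearMap ∘ₗ L.leftC.rTensor (Tpow T n) ∘ₗ
      (Tpow.cons T n).symm.toLinearMap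

/-- `T^{□_C (n+1)}` as a subspace of `T^{⊗(n+1)}`, through
`T^{□_C (n+2)} = T □_C T^{□_C (n+1)}`. -/
def LeftComoduleCoalgebra.cotensorPower (L : LeftComoduleCoalgebra H T) :
    (n : ℕ) → Submodule ℂ (Tpow T n)
  | 0 => ⊤
  | n + 1 => (cotensor L.rightC (L.headC n) ⊓
      LinearMap.range ((L.cotensorPower n).subtype.lTensor T)).map (Tpow.cons T n).toLinearMap

/-- `t₀ ⊗ ⋯ ⊗ tₙ ↦ t₀₋₁⋯tₙ₋₁ ⊗ t₀₀ ⊗ ⋯ ⊗ tₙ₀`, where the products are taken with an extension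
`mul'` of the multiplication of `K`. On `T^{□_C (n+1)}` this is the left coaction of `K`. -/
def LeftComoduleCoalgebra.diagCoact (L : LeftComoduleCoalgebra H T)
    (mul' : K ⊗[ℂ] K →ₗ[ℂ] K) : (n : ℕ) → Tpow T n →ₗ[ℂ] K ⊗[ℂ] Tpow T n
  | 0 => (Tpow.one T).toLinearMap.lTensor K ∘ₗ L.coact ∘ₗ (Tpow.one T).symm.toLinearMap
  | n + 1 => TensorProduct.map mul' (Tpow.cons T n).toLinearMap ∘ₗ
      (TensorProduct.tensorTensorTensorComm ℂ K T K (Tpow T n)).toLinearMap ∘ₗ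
      TensorProduct.map L.coact (L.diagCoact mul' n) ∘ₗ (Tpow.cons T n).symm.toLinearMap

/-- `M □_K T^{□_C (n+1)}` as a subspace of `M ⊗ T^{⊗(n+1)}`, with the diagonal coaction computed by
an extension `mul'` of the multiplication of `K`. -/
def cochainsWith (L : LeftComoduleCoalgebra H T) (N : LeftRightSAYD H M)
    (mul' : K ⊗[ℂ] K →ₗ[ℂ] K) (n : ℕ) : Submodule ℂ (M ⊗[ℂ] Tpow T n) :=
  LinearMap.range ((L.cotensorPower n).subtype.lTensor M) ⊓
    cotensor N.coact (L.diagCoact mul' n)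

/-- The space `M □_K T^{□_C (n+1)}` of Hopf cyclic `n`-cochains. -/
def cochains (L : LeftComoduleCoalgebra H T) (N : LeftRightSAYD H M) (n : ℕ) :
    Submodule ℂ (M ⊗[ℂ] Tpow T n) :=
  cochainsWith L N H.mulExt n

/-- `m ⊗ t₀ ⊗ t₁ ⊗ ⋯ ⊗ tₙ₊₁ ↦ t₁₋₁⋯tₙ₊₁₋₁▷m ⊗ t₁₀ ⊗ ⋯ ⊗ tₙ₊₁₀ ⊗ t₀`, computed with extensions
`mul'`, `act'` of the multiplication of `K` and of its action on `M`. -/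
def rotate (L : LeftComoduleCoalgebra H T) (mul' : K ⊗[ℂ] K →ₗ[ℂ] K)
    (act' : K ⊗[ℂ] M →ₗ[ℂ] M) (n : ℕ) :
    M ⊗[ℂ] Tpow T (n + 1) →ₗ[ℂ] M ⊗[ℂ] Tpow T (n + 1) :=
  TensorProduct.map act' (Tpow.snoc T n) ∘ₗ
    (TensorProduct.comm ℂ M K).toLinearMap.rTensor (T ⊗[ℂ] Tpow T n) ∘ₗ
    (TensorProduct.assoc ℂ M K (T ⊗[ℂ] Tpow T n)).symm.toLinearMap ∘ₗ
    ((TensorProduct.leftComm ℂ T K (Tpow T n)).toLinearMap ∘ₗ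
      (L.diagCoact mul' n).lTensor T ∘ₗ (Tpow.cons T n).symm.toLinearMap).lTensor M

/-- The cyclic operator; it is the identity in degree `0`. -/
def cyclicOp (L : LeftComoduleCoalgebra H T) (mul' : K ⊗[ℂ] K →ₗ[ℂ] K)
    (act' : K ⊗[ℂ] M →ₗ[ℂ] M) : (n : ℕ) → M ⊗[ℂ] Tpow T n →ₗ[ℂ] M ⊗[ℂ] Tpow T n
  | 0 => LinearMap.id
  | n + 1 => rotate L mul' act' n

/-- The last coface: `m ⊗ t₀ ⊗ ⋯ ⊗ tₙ` is first sent to `m ⊗ t₀₁ ⊗ t₀₂ ⊗ t₁ ⊗ ⋯ ⊗ tₙ` and then to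
`t₀₂₋₁t₁₋₁⋯tₙ₋₁▷m ⊗ t₀₂₀ ⊗ t₁₀ ⊗ ⋯ ⊗ tₙ₀ ⊗ t₀₁`. -/
def lastCoface (L : LeftComoduleCoalgebra H T) (mul' : K ⊗[ℂ] K →ₗ[ℂ] K)
    (act' : K ⊗[ℂ] M →ₗ[ℂ] M) (n : ℕ) : M ⊗[ℂ] Tpow T n →ₗ[ℂ] M ⊗[ℂ] Tpow T (n + 1) :=
  rotate L mul' act' n ∘ₗ (Tpow.comulAt T n 0).lTensor M

end Cochains

section Cocyclic

/-- A cocyclic structure on a sequence of complex vector spaces: cofaces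
`δ n i : V n → V (n+1)` (`0 ≤ i ≤ n+1`), codegeneracies `σ n i : V (n+1) → V n` (`0 ≤ i ≤ n`) and
cyclic operators `τ n : V n → V n`, with the relations of the cyclic category. -/
structure CocyclicModule (V : ℕ → Type*) [∀ n, AddCommGroup (V n)] [∀ n, Module ℂ (V n)] where
  δ : ∀ n, Fin (n + 2) → (V n →ₗ[ℂ] V (n + 1))
  σ : ∀ n, Fin (n + 1) → (V (n + 1) →ₗ[ℂ] V n)
  τ : ∀ n, V n →ₗ[ℂ] V n
  δ_δ : ∀ n (i j : Fin (n + 2)), i ≤ j →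
    δ (n + 1) j.succ ∘ₗ δ n i = δ (n + 1) i.castSucc ∘ₗ δ n j
  σ_σ : ∀ n (i j : Fin (n + 1)), i ≤ j →
    σ n j ∘ₗ σ (n + 1) i.castSucc = σ n i ∘ₗ σ (n + 1) j.succ
  σ_δ_of_le : ∀ n (i : Fin (n + 2)) (j : Fin (n + 1)), i ≤ j.castSucc →
    σ (n + 1) j.succ ∘ₗ δ (n + 1) i.castSucc = δ n i ∘ₗ σ n j
  σ_δ_self : ∀ n (i : Fin (n + 1)), σ n i ∘ₗ δ n i.castSucc = LinearMap.id
  σ_δ_succ : ∀ n (i : Fin (n + 1)), σ n i ∘ₗ δ n i.succ = LinearMap.id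
  σ_δ_of_gt : ∀ n (i : Fin (n + 2)) (j : Fin (n + 1)), j.castSucc < i →
    σ (n + 1) j.castSucc ∘ₗ δ (n + 1) i.succ = δ n i ∘ₗ σ n j
  τ_δ_succ : ∀ n (i : Fin (n + 1)), τ (n + 1) ∘ₗ δ n i.succ = δ n i.castSucc ∘ₗ τ n
  τ_δ_zero : ∀ n, τ (n + 1) ∘ₗ δ n 0 = δ n (Fin.last (n + 1))
  τ_σ_succ : ∀ n (i : Fin n), τ n ∘ₗ σ n i.succ = σ n i.castSucc ∘ₗ τ (n + 1)
  τ_σ_zero : ∀ n, τ n ∘ₗ σ n 0 = σ n (Fin.last n) ∘ₗ τ (n + 1) ∘ₗ τ (n + 1)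
  τ_pow : ∀ n, τ n ^ (n + 1) = 1

variable {V : ℕ → Type*} [∀ n, AddCommGroup (V n)] [∀ n, Module ℂ (V n)]

namespace CocyclicModule

/-- The Hochschild coboundary `b = ∑ᵢ (-1)ⁱ δᵢ`. -/
def b (D : CocyclicModule V) (n : ℕ) : V n →ₗ[ℂ] V (n + 1) :=
  ∑ i : Fin (n + 2), (-1 : ℂ) ^ (i : ℕ) • D.δ n i

/-- The cyclic cochains: `τ x = (-1)ⁿ x`. -/
def cyclicCochains (D : CocyclicModule V) (n : ℕ) : Submodule ℂ (V n) :=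
  LinearMap.eqLocus (D.τ n) ((-1 : ℂ) ^ n • LinearMap.id)

/-- The cyclic cocycles. -/
def cyclicCocycles (D : CocyclicModule V) (n : ℕ) : Submodule ℂ (V n) :=
  D.cyclicCochains n ⊓ LinearMap.ker (D.b n)

/-- The cyclic coboundaries: the images under `b` of the cyclic cochains. -/
def cyclicCoboundaries (D : CocyclicModule V) : (n : ℕ) → Submodule ℂ (V n)
  | 0 => ⊥
  | n + 1 => (D.cyclicCochains n).map (D.b n)

/-- The cyclic cohomology `HCⁿ`, i.e. the cohomology of the complex of cyclic cochains. -/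
abbrev HC (D : CocyclicModule V) (n : ℕ) : Type _ :=
  D.cyclicCocycles n ⧸ (D.cyclicCoboundaries n).submoduleOf (D.cyclicCocycles n)

end CocyclicModule

end Cocyclic

end TimesHopf

end

/-! The proof reduces the cyclic structure to one operation on two blocks. For left `K`-comodules A
and B let `rot` send m ⊗ a ⊗ b to b₋₁▷m ⊗ b₀ ⊗ a, from M □_K (A □_C B) to M □_K (B □_C A). Three
facts about it carry the theorem.

It lands in B □_C A: the axiom gh₁ ⊗ α(h₂) = g₁h ⊗ β(g₂), transferred from products to actions in
`act_takeuchi`, matches the right coaction of b₀ with the left coaction of a (`rot_mem_box`). It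
lands in the cotensor product over `K`: for a cochain m₁ = a₋₁b₋₁, so, writing b₋₃ ⊗ b₋₂ ⊗ b₋₁ ⊗ b₀
for the iterated coaction, the arguments of ν⁻¹ in the anti-Yetter-Drinfeld formula are a₋₁b₋₃ ⊗
b₋₂, which is ν of a₋₁ ⊗ b₋₂ with the Δ of the second leg absorbed. Hence ν⁻¹ cancels and the
formula becomes b₋₂▷m ⊗ b₋₁a₋₁, which is what the product coaction on B □_C A asks for
(`rot_coact`). It is involutive: a₋₁▷(b₋₁▷m) = (a₋₁b₋₁)▷m = m₁▷m₀ = m by stability (`rot_rot`).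

In positive degree the cyclic operator is `rot` for the blocks T | T^{□n}. By `rotate_pow` its power
p + 1 is `rot` for blocks T^{□(p+1)} | T^{□(q+1)}. Rotating the blocks T | T^{□n} and then T^{□n} |
T is thus 𝔱ⁿ⁺¹ on the one hand and two block rotations, hence the identity, on the other.

The cofaces except the last and the codegeneracies are M ⊗ F for maps F that are `K`-colinear on
cotensor powers, so they preserve cochains; naturality of the rotation gives their commutation with
𝔱, and the identities among them hold already on tensor powers of T. Every remaining cocyclic
identity follows formally from these and from 𝔱ⁿ⁺¹ = id (`CocyclicCore`).

Products and actions exist only on cotensor products and are used through arbitrary linear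
extensions. What makes this harmless is linear algebra over a field: a tensor belongs to P ⊗ V as
soon as all its contractions against functionals on V belong to P, and two maps that agree on P then
agree on it (`exists_of_rslice`, `rTensor_eqOn`). Each appeal to an axiom is therefore accompanied
by a check that the relevant legs are balanced. -/

noncomputable section

namespace TimesHopf

open TensorProduct (add_tmul tmul_add AlgebraTensorModule.curry_apply curry_apply)

/-! ### Contractions of tensors against functionals, and maps known only on a subspace. -/

section Slices

variable {E F V W X Y Z : Type*} [AddCommGroup E] [Module ℂ E] [AddCommGroup F] [Module ℂ F]
  [AddCommGroup V] [Module ℂ V] [AddCommGroup W] [Module ℂ W] [AddCommGroup X] [Module ℂ X]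
  [AddCommGroup Y] [Module ℂ Y] [AddCommGroup Z] [Module ℂ Z]

/-- Contraction of the right tensor factor with a functional. -/
def rslice (φ : V →ₗ[ℂ] ℂ) : E ⊗[ℂ] V →ₗ[ℂ] E :=
  (TensorProduct.rid ℂ E).toLinearMap ∘ₗ φ.lTensor E

/-- Contraction of the left tensor factor with a functional. -/
def lslice (φ : V →ₗ[ℂ] ℂ) : V ⊗[ℂ] E →ₗ[ℂ] E :=
  (TensorProduct.lid ℂ E).toLinearMap ∘ₗ φ.rTensor E

@[simp] theorem rslice_tmul (φ : V →ₗ[ℂ] ℂ) (e : E) (v : V) : rslice φ (e ⊗ₜ[ℂ] v) = φ v • e := by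
  simp [rslice]

@[simp] theorem lslice_tmul (φ : V →ₗ[ℂ] ℂ) (e : E) (v : V) : lslice φ (v ⊗ₜ[ℂ] e) = φ v • e := by
  simp [lslice]

theorem rslice_rTensor (φ : V →ₗ[ℂ] ℂ) (f : E →ₗ[ℂ] F) (x : E ⊗[ℂ] V) :
    rslice φ (f.rTensor V x) = f (rslice φ x) := by
  induction x using TensorProduct.induction_on with
  | zero => simp
  | tmul => simp
  | add x y hx hy => simp only [map_add, hx, hy]

theorem lslice_lTensor (φ : V →ₗ[ℂ] ℂ) (f : E →ₗ[ℂ] F) (x : V ⊗[ℂ] E) :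
    lslice φ (f.lTensor V x) = f (lslice φ x) := by
  induction x using TensorProduct.induction_on with
  | zero => simp
  | tmul => simp
  | add x y hx hy => simp only [map_add, hx, hy]

theorem rslice_lTensor (φ : W →ₗ[ℂ] ℂ) (f : V →ₗ[ℂ] W) (x : E ⊗[ℂ] V) :
    rslice φ (f.lTensor E x) = rslice (φ ∘ₗ f) x := by
  induction x using TensorProduct.induction_on with
  | zero => simp
  | tmul => simp
  | add x y hx hy => simp only [map_add, hx, hy]

theorem lslice_rTensor (φ : W →ₗ[ℂ] ℂ) (f : V →ₗ[ℂ] W) (x : V ⊗[ℂ] E) :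
    lslice φ (f.rTensor E x) = lslice (φ ∘ₗ f) x := by
  induction x using TensorProduct.induction_on with
  | zero => simp
  | tmul => simp
  | add x y hx hy => simp only [map_add, hx, hy]

theorem lslice_comm (φ : V →ₗ[ℂ] ℂ) (x : E ⊗[ℂ] V) :
    lslice φ (TensorProduct.comm ℂ E V x) = rslice φ x := by
  induction x using TensorProduct.induction_on with
  | zero => simp
  | tmul => simp
  | add x y hx hy => simp only [map_add, hx, hy]

theorem rslice_comm (φ : V →ₗ[ℂ] ℂ) (x : V ⊗[ℂ] E) :
    rslice φ (TensorProduct.comm ℂ V E x) = lslice φ x := by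
  induction x using TensorProduct.induction_on with
  | zero => simp
  | tmul => simp
  | add x y hx hy => simp only [map_add, hx, hy]

theorem comm_lTensor (f : E →ₗ[ℂ] F) (x : V ⊗[ℂ] E) :
    TensorProduct.comm ℂ V F (f.lTensor V x) = f.rTensor V (TensorProduct.comm ℂ V E x) := by
  induction x using TensorProduct.induction_on with
  | zero => simp
  | tmul => simp
  | add x y hx hy => simp only [map_add, hx, hy]

theorem lTensor_rTensor_apply (f : E →ₗ[ℂ] F) (g : V →ₗ[ℂ] W) (x : V ⊗[ℂ] E) :
    f.lTensor W (g.rTensor E x) = g.rTensor F (f.lTensor V x) := by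
  rw [← LinearMap.comp_apply, LinearMap.lTensor_comp_rTensor, ← LinearMap.rTensor_comp_lTensor,
    LinearMap.comp_apply]

/-- A tensor all of whose right slices lie in `P` comes from `P ⊗ V`. -/
theorem exists_of_rslice (P : Submodule ℂ E) (x : E ⊗[ℂ] V)
    (h : ∀ φ : V →ₗ[ℂ] ℂ, rslice φ x ∈ P) : ∃ z : P ⊗[ℂ] V, P.subtype.rTensor V z = x := by
  classical
  -- The coefficients of x in a basis of V are its slices by the coordinate functionals, so only
  -- those φ are needed.
  let b := Module.Basis.ofVectorSpace ℂ V
  have key : ∀ i, TensorProduct.equivFinsuppOfBasisRight (M := E) b x i ∈ P := fun i => by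
    rw [TensorProduct.equivFinsuppOfBasisRight_apply]
    exact h (b.coord i)
  obtain ⟨f, rfl⟩ := (TensorProduct.equivFinsuppOfBasisRight (M := E) b).symm.surjective x
  simp only [LinearEquiv.apply_symm_apply] at key
  refine ⟨f.sum fun i e => ⟨f i, key i⟩ ⊗ₜ b i, ?_⟩
  rw [TensorProduct.equivFinsuppOfBasisRight_symm_apply]
  simp [Finsupp.sum, map_sum]

theorem rslice_mem_of_range (P : Submodule ℂ E) (z : P ⊗[ℂ] V) (φ : V →ₗ[ℂ] ℂ) :
    rslice φ (P.subtype.rTensor V z) ∈ P := by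
  rw [rslice_rTensor]; exact (rslice φ z).2

theorem mem_range_rTensor_iff (P : Submodule ℂ E) (x : E ⊗[ℂ] V) :
    x ∈ LinearMap.range (P.subtype.rTensor V) ↔ ∀ φ : V →ₗ[ℂ] ℂ, rslice φ x ∈ P :=
  ⟨by rintro ⟨z, rfl⟩ φ; exact rslice_mem_of_range P z φ, fun h => exists_of_rslice P x h⟩

theorem mem_range_lTensor_iff (P : Submodule ℂ E) (x : V ⊗[ℂ] E) :
    x ∈ LinearMap.range (P.subtype.lTensor V) ↔ ∀ φ : V →ₗ[ℂ] ℂ, lslice φ x ∈ P := by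
  constructor
  · rintro ⟨z, rfl⟩ φ
    rw [lslice_lTensor]; exact (lslice φ z).2
  · intro h
    obtain ⟨z, hz⟩ := exists_of_rslice P (TensorProduct.comm ℂ V E x)
      (fun φ => by rw [rslice_comm]; exact h φ)
    refine ⟨TensorProduct.comm ℂ P V z, ?_⟩
    apply (TensorProduct.comm ℂ V E).injective
    rw [← hz, comm_lTensor]
    simp

/-- The difference has all its slices in the zero subspace, so it comes from 0 ⊗ V. -/
theorem rslice_ext {x y : E ⊗[ℂ] V} (h : ∀ φ : V →ₗ[ℂ] ℂ, rslice φ x = rslice φ y) : x = y := by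
  obtain ⟨z, hz⟩ := exists_of_rslice (⊥ : Submodule ℂ E) (x - y) (fun φ => by simp [h φ])
  have : (⊥ : Submodule ℂ E).subtype = 0 := by ext ⟨e, he⟩; simpa using he
  rw [this] at hz
  simpa [sub_eq_zero, eq_comm] using hz

theorem lslice_ext {x y : V ⊗[ℂ] E} (h : ∀ φ : V →ₗ[ℂ] ℂ, lslice φ x = lslice φ y) : x = y :=
  (TensorProduct.comm ℂ V E).injective (rslice_ext fun φ => by simpa only [rslice_comm] using h φ)

/-- This is how an axiom that holds only on a cotensor product is applied to some legs of a larger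
tensor: slicing the spectator factor commutes with f and g, and slices separate tensors. -/
theorem rTensor_eqOn {P : Submodule ℂ E} {f g : E →ₗ[ℂ] F} (hfg : ∀ e ∈ P, f e = g e)
    {x : E ⊗[ℂ] V} (hx : ∀ φ : V →ₗ[ℂ] ℂ, rslice φ x ∈ P) : f.rTensor V x = g.rTensor V x :=
  rslice_ext fun φ => by rw [rslice_rTensor, rslice_rTensor, hfg _ (hx φ)]

theorem lTensor_eqOn {P : Submodule ℂ E} {f g : E →ₗ[ℂ] F} (hfg : ∀ e ∈ P, f e = g e)
    {x : V ⊗[ℂ] E} (hx : ∀ φ : V →ₗ[ℂ] ℂ, lslice φ x ∈ P) : f.lTensor V x = g.lTensor V x :=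
  lslice_ext fun φ => by rw [lslice_lTensor, lslice_lTensor, hfg _ (hx φ)]

/-- Cotensor products are equalizers, so one identity between tensors yields the membership of all
slices that `rTensor_eqOn` requires. -/
theorem rslice_mem_eqLocus {f g : E →ₗ[ℂ] F} {x : E ⊗[ℂ] V}
    (h : f.rTensor V x = g.rTensor V x) (φ : V →ₗ[ℂ] ℂ) : rslice φ x ∈ LinearMap.eqLocus f g := by
  rw [LinearMap.mem_eqLocus, ← rslice_rTensor, h, rslice_rTensor]

theorem lslice_mem_eqLocus {f g : E →ₗ[ℂ] F} {x : V ⊗[ℂ] E}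
    (h : f.lTensor V x = g.lTensor V x) (φ : V →ₗ[ℂ] ℂ) : lslice φ x ∈ LinearMap.eqLocus f g := by
  rw [LinearMap.mem_eqLocus, ← lslice_lTensor, h, lslice_lTensor]

/-- The factorization of a linear map through an injective one whose range contains its range. -/
def liftInj (j : Y →ₗ[ℂ] Z) (hj : Function.Injective j) (f : X →ₗ[ℂ] Z)
    (h : ∀ x, f x ∈ LinearMap.range j) : X →ₗ[ℂ] Y :=
  (LinearEquiv.ofInjective j hj).symm.toLinearMap ∘ₗ f.codRestrict (LinearMap.range j) h

theorem liftInj_apply (j : Y →ₗ[ℂ] Z) (hj : Function.Injective j) (f : X →ₗ[ℂ] Z)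
    (h : ∀ x, f x ∈ LinearMap.range j) (x : X) : j (liftInj j hj f h x) = f x := by
  have := (LinearEquiv.ofInjective j hj).apply_symm_apply (f.codRestrict (LinearMap.range j) h x)
  exact congrArg Subtype.val this

theorem rTensor_injective {j : Y →ₗ[ℂ] Z} (hj : Function.Injective j) (V : Type*)
    [AddCommGroup V] [Module ℂ V] : Function.Injective (j.rTensor V) :=
  Module.Flat.rTensor_preserves_injective_linearMap j hj

theorem lTensor_injective {j : Y →ₗ[ℂ] Z} (hj : Function.Injective j) (V : Type*)
    [AddCommGroup V] [Module ℂ V] : Function.Injective (j.lTensor V) :=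
  Module.Flat.lTensor_preserves_injective_linearMap j hj

end Slices

/-! ### Coactions on two tensor factors and the balancing of their `K`-legs. -/

section Bicoaction

variable {K A B : Type*} [AddCommGroup K] [Module ℂ K]
  [AddCommGroup A] [Module ℂ A] [AddCommGroup B] [Module ℂ B]

/-- `a ⊗ b ↦ (a₋₁ ⊗ b₋₁) ⊗ (a₀ ⊗ b₀)`. -/
def bicoact (ρA : A →ₗ[ℂ] K ⊗[ℂ] A) (ρB : B →ₗ[ℂ] K ⊗[ℂ] B) :
    A ⊗[ℂ] B →ₗ[ℂ] (K ⊗[ℂ] K) ⊗[ℂ] (A ⊗[ℂ] B) :=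
  (TensorProduct.tensorTensorTensorComm ℂ K A K B).toLinearMap ∘ₗ TensorProduct.map ρA ρB

end Bicoaction

section Coactions

variable {C K A B : Type*} [AddCommGroup C] [Module ℂ C] [Coalgebra ℂ C]
  [AddCommGroup K] [Module ℂ K] [Coalgebra ℂ K]
  [AddCommGroup A] [Module ℂ A] [AddCommGroup B] [Module ℂ B]

/-- The left coaction `a ↦ α(a₋₁) ⊗ a₀` of `C` on a left `K`-comodule. -/
def SourceTarget.lC (S : SourceTarget C K) (ρ : A →ₗ[ℂ] K ⊗[ℂ] A) : A →ₗ[ℂ] C ⊗[ℂ] A :=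
  (S.α : K →ₗ[ℂ] C).rTensor A ∘ₗ ρ

/-- The right coaction `a ↦ a₀ ⊗ β(a₋₁)` of `C` on a left `K`-comodule. -/
def SourceTarget.rC (S : SourceTarget C K) (ρ : A →ₗ[ℂ] K ⊗[ℂ] A) : A →ₗ[ℂ] A ⊗[ℂ] C :=
  S.β.lTensor A ∘ₗ (TensorProduct.comm ℂ K A).toLinearMap ∘ₗ ρ

/-- `A □_C B` for left `K`-comodules `A` and `B`. -/
def SourceTarget.box (S : SourceTarget C K) (ρA : A →ₗ[ℂ] K ⊗[ℂ] A) (ρB : B →ₗ[ℂ] K ⊗[ℂ] B) :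
    Submodule ℂ (A ⊗[ℂ] B) := cotensor (S.rC ρA) (S.lC ρB)

variable (S : SourceTarget C K) {ρA : A →ₗ[ℂ] K ⊗[ℂ] A} {ρB : B →ₗ[ℂ] K ⊗[ℂ] B}

/-- Coassociativity of ρA with α applied to the outermost leg; only linearity of α matters. -/
theorem SourceTarget.lC_coassoc (hA : IsLeftCoaction ρA) (a : A) :
    ρA.lTensor C (S.lC ρA a) = TensorProduct.assoc ℂ C K A (S.leftC.rTensor A (ρA a)) := by
  have h := congrArg ((S.α : K →ₗ[ℂ] C).rTensor (K ⊗[ℂ] A)) (hA.coassoc a)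
  have h1 : ∀ u : K ⊗[ℂ] A, (S.α : K →ₗ[ℂ] C).rTensor (K ⊗[ℂ] A) (ρA.lTensor K u) =
      ρA.lTensor C ((S.α : K →ₗ[ℂ] C).rTensor A u) := fun u => by
    induction u using TensorProduct.induction_on with
    | zero => simp
    | tmul k a => simp
    | add x y hx hy => simp only [map_add, hx, hy]
  have h2 : ∀ u : K ⊗[ℂ] A, (S.α : K →ₗ[ℂ] C).rTensor (K ⊗[ℂ] A)
      (TensorProduct.assoc ℂ K K A ((Coalgebra.comul (R := ℂ) (A := K)).rTensor A u)) =
      TensorProduct.assoc ℂ C K A (S.leftC.rTensor A u) := fun u => by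
    induction u using TensorProduct.induction_on with
    | zero => simp
    | tmul k a =>
      simp only [LinearMap.rTensor_tmul, SourceTarget.leftC, LinearMap.comp_apply]
      induction Coalgebra.comul (R := ℂ) k using TensorProduct.induction_on with
      | zero => simp
      | tmul k a => simp
      | add x y hx hy => simp only [map_add, TensorProduct.add_tmul, hx, hy]
    | add x y hx hy => simp only [map_add, hx, hy]
  rw [h1, h2] at h
  exact h.symm

theorem SourceTarget.rC_coassoc (hA : IsLeftCoaction ρA) (a : A) :
    ρA.rTensor C (S.rC ρA a) = TensorProduct.rightComm ℂ K C A (S.rightC.rTensor A (ρA a)) := by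
  have h := congrArg (S.β.lTensor (K ⊗[ℂ] A) ∘ₗ (TensorProduct.comm ℂ K (K ⊗[ℂ] A)).toLinearMap)
    (hA.coassoc a)
  have h1 : ∀ u : K ⊗[ℂ] A, S.β.lTensor (K ⊗[ℂ] A) (TensorProduct.comm ℂ K (K ⊗[ℂ] A)
      (ρA.lTensor K u)) =
      ρA.rTensor C (S.β.lTensor A (TensorProduct.comm ℂ K A u)) := fun u => by
    induction u using TensorProduct.induction_on with
    | zero => simp
    | tmul k a => simp
    | add x y hx hy => simp only [map_add, hx, hy]
  have h2 : ∀ u : K ⊗[ℂ] A, S.β.lTensor (K ⊗[ℂ] A) (TensorProduct.comm ℂ K (K ⊗[ℂ] A)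
      (TensorProduct.assoc ℂ K K A ((Coalgebra.comul (R := ℂ) (A := K)).rTensor A u))) =
      TensorProduct.rightComm ℂ K C A (S.rightC.rTensor A u) := fun u => by
    induction u using TensorProduct.induction_on with
    | zero => simp
    | tmul k a =>
      simp only [LinearMap.rTensor_tmul, SourceTarget.rightC, LinearMap.comp_apply,
        LinearEquiv.coe_coe]
      induction Coalgebra.comul (R := ℂ) k using TensorProduct.induction_on with
      | zero => simp
      | tmul k a => simp
      | add x y hx hy => simp only [map_add, TensorProduct.add_tmul, hx, hy]
    | add x y hx hy => simp only [map_add, hx, hy]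
  simp only [LinearMap.comp_apply, LinearEquiv.coe_coe] at h
  rw [h1, h2] at h
  exact h.symm

/-- By `rC_coassoc` the right coaction on a₋₁ is that of a, and by `lC_coassoc` the left coaction on
b₋₁ is that of b. So balancedness of a ⊗ b passes to a₋₁ ⊗ b₋₁; Ψ coacts on both factors around the
inserted leg in C. This is what gives the products a₋₁b₋₁ a meaning. -/
theorem SourceTarget.bicoact_balanced (hA : IsLeftCoaction ρA) (hB : IsLeftCoaction ρB)
    {x : A ⊗[ℂ] B} (hx : x ∈ S.box ρA ρB) :
    ((TensorProduct.assoc ℂ K C K).toLinearMap ∘ₗ S.rightC.rTensor K).rTensor (A ⊗[ℂ] B)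
      (bicoact ρA ρB x) = (S.leftC.lTensor K).rTensor (A ⊗[ℂ] B) (bicoact ρA ρB x) := by
  let Ψ : A ⊗[ℂ] (C ⊗[ℂ] B) →ₗ[ℂ] (K ⊗[ℂ] (C ⊗[ℂ] K)) ⊗[ℂ] (A ⊗[ℂ] B) :=
    (TensorProduct.tensorTensorTensorComm ℂ K A (C ⊗[ℂ] K) B).toLinearMap ∘ₗ
      TensorProduct.map ρA ((TensorProduct.assoc ℂ C K B).symm.toLinearMap ∘ₗ ρB.lTensor C)
  have h1 : ((TensorProduct.assoc ℂ K C K).toLinearMap ∘ₗ S.rightC.rTensor K).rTensor (A ⊗[ℂ] B) ∘ₗ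
      bicoact ρA ρB = Ψ ∘ₗ (TensorProduct.assoc ℂ A C B).toLinearMap ∘ₗ (S.rC ρA).rTensor B := by
    ext a b
    have h3 : ∀ (r : A ⊗[ℂ] C) (b : B), Ψ (TensorProduct.assoc ℂ A C B (r ⊗ₜ b)) =
      (TensorProduct.assoc ℂ K C K).toLinearMap.rTensor (A ⊗[ℂ] B)
      (TensorProduct.tensorTensorTensorComm ℂ (K ⊗[ℂ] C) A K B
        ((TensorProduct.rightComm ℂ K C A).symm (ρA.rTensor C r) ⊗ₜ ρB b)) := fun r b => by
      refine TensorProduct.induction_on r (by simp) (fun a c => ?_)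
        (fun x y hx hy => by simp only [map_add, add_tmul, hx, hy])
      simp only [Ψ, TensorProduct.assoc_tmul, LinearMap.comp_apply, TensorProduct.map_tmul,
        LinearMap.lTensor_tmul, LinearMap.rTensor_tmul, LinearEquiv.coe_coe]
      refine TensorProduct.induction_on (ρB b) (by simp) (fun h b => ?_)
        (fun x y hx hy => by simp only [map_add, tmul_add, hx, hy])
      refine TensorProduct.induction_on (ρA a) (by simp) (fun g a => by simp)
        (fun x y hx hy => by simp only [map_add, add_tmul, hx, hy])
    simp only [AlgebraTensorModule.curry_apply, curry_apply,
      LinearMap.coe_restrictScalars, LinearMap.comp_apply, LinearEquiv.coe_coe, bicoact,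
      LinearMap.rTensor_tmul, TensorProduct.map_tmul]
    rw [h3, S.rC_coassoc hA, LinearEquiv.symm_apply_apply]
    refine TensorProduct.induction_on (ρB b) (by simp) (fun h b => ?_)
      (fun x y hx hy => by simp only [map_add, tmul_add, hx, hy])
    refine TensorProduct.induction_on (ρA a) (by simp) (fun g a => by simp)
      (fun x y hx hy => by simp only [map_add, add_tmul, hx, hy])
  have h2 : (S.leftC.lTensor K).rTensor (A ⊗[ℂ] B) ∘ₗ bicoact ρA ρB = Ψ ∘ₗ (S.lC ρB).lTensor A := by
    ext a b
    simp only [AlgebraTensorModule.curry_apply, curry_apply,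
      LinearMap.coe_restrictScalars, LinearMap.comp_apply, LinearEquiv.coe_coe, bicoact, Ψ,
      LinearMap.lTensor_tmul, TensorProduct.map_tmul]
    rw [S.lC_coassoc hB, LinearEquiv.symm_apply_apply]
    refine TensorProduct.induction_on (ρB b) (by simp) (fun h b => ?_)
      (fun x y hx hy => by simp only [map_add, tmul_add, hx, hy])
    refine TensorProduct.induction_on (ρA a) (by simp) (fun g a => by simp)
      (fun x y hx hy => by simp only [map_add, add_tmul, hx, hy])
  have h1x := LinearMap.congr_fun h1 x
  have h2x := LinearMap.congr_fun h2 x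
  have hx' : TensorProduct.assoc ℂ A C B ((S.rC ρA).rTensor B x) = (S.lC ρB).lTensor A x := hx
  simp only [LinearMap.comp_apply, LinearEquiv.coe_coe] at h1x h2x
  rw [h1x, h2x, hx']

theorem SourceTarget.rslice_bicoact_mem (hA : IsLeftCoaction ρA) (hB : IsLeftCoaction ρB)
    {x : A ⊗[ℂ] B} (hx : x ∈ S.box ρA ρB) (φ : A ⊗[ℂ] B →ₗ[ℂ] ℂ) :
    rslice φ (bicoact ρA ρB x) ∈ S.KK :=
  rslice_mem_eqLocus (S.bicoact_balanced hA hB hx) φ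

/-- A sufficient condition for the slices of a tensor to lie in `K □_C K □_C Y`. -/
theorem SourceTarget.rslice_mem_triple {Y V : Type*} [AddCommGroup Y] [Module ℂ Y]
    [AddCommGroup V] [Module ℂ V] {l : Y →ₗ[ℂ] C ⊗[ℂ] Y} {t : (K ⊗[ℂ] (K ⊗[ℂ] Y)) ⊗[ℂ] V}
    (h1 : (((TensorProduct.assoc ℂ K C Y).toLinearMap ∘ₗ S.rightC.rTensor Y).lTensor K).rTensor V t =
      ((l.lTensor K).lTensor K).rTensor V t)
    (h2 : (((TensorProduct.assoc ℂ K C K).toLinearMap ∘ₗ S.rightC.rTensor K).rTensor Y ∘ₗ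
        (TensorProduct.assoc ℂ K K Y).symm.toLinearMap).rTensor V t =
      ((S.leftC.lTensor K).rTensor Y ∘ₗ
        (TensorProduct.assoc ℂ K K Y).symm.toLinearMap).rTensor V t) (φ : V →ₗ[ℂ] ℂ) :
    rslice φ t ∈ S.triple l := by
  refine ⟨(mem_range_lTensor_iff _ _).2 (lslice_mem_eqLocus ?_),
    (mem_range_rTensor_iff _ _).2 (rslice_mem_eqLocus ?_)⟩
  · rw [← rslice_rTensor, h1, rslice_rTensor]
  · have := congrArg (rslice φ) h2
    rwa [rslice_rTensor, rslice_rTensor] at this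

end Coactions

/-! ### Source and target of a product. -/

section Multiplication

variable {C K : Type*} [AddCommGroup C] [Module ℂ C] [Coalgebra ℂ C]
  [AddCommGroup K] [Module ℂ K] [Coalgebra ℂ K]

/-- The two coactions of `C` on `K` commute. -/
theorem SourceTarget.leftC_rightC (S : SourceTarget C K) (k : K) :
    S.rightC.lTensor C (S.leftC k) = TensorProduct.assoc ℂ C K C (S.leftC.rTensor C (S.rightC k)) := by
  let F : K ⊗[ℂ] (K ⊗[ℂ] K) →ₗ[ℂ] C ⊗[ℂ] (K ⊗[ℂ] C) :=
    TensorProduct.map (S.α : K →ₗ[ℂ] C) (S.β.lTensor K ∘ₗ (TensorProduct.comm ℂ K K).toLinearMap)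
  let G : K ⊗[ℂ] (K ⊗[ℂ] K) →ₗ[ℂ] C ⊗[ℂ] (K ⊗[ℂ] C) :=
    (TensorProduct.assoc ℂ C K C).toLinearMap ∘ₗ (TensorProduct.comm ℂ C (C ⊗[ℂ] K)).toLinearMap ∘ₗ
    TensorProduct.map S.β ((S.α : K →ₗ[ℂ] C).rTensor K)
  have hco := Coalgebra.coassoc_apply (R := ℂ) k
  have h1 : S.rightC.lTensor C (S.leftC k) =
      F ((Coalgebra.comul (R := ℂ) (A := K)).lTensor K (Coalgebra.comul k)) := by
    simp only [SourceTarget.leftC, LinearMap.comp_apply]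
    refine TensorProduct.induction_on (Coalgebra.comul (R := ℂ) k) (by simp)
      (fun x y => by simp [F, SourceTarget.rightC])
      (fun x y hx hy => by simp only [map_add, hx, hy])
  have h2 : TensorProduct.assoc ℂ C K C (S.leftC.rTensor C (S.rightC k)) =
      G ((Coalgebra.comul (R := ℂ) (A := K)).lTensor K (Coalgebra.comul k)) := by
    simp only [SourceTarget.rightC, LinearMap.comp_apply, LinearEquiv.coe_coe]
    refine TensorProduct.induction_on (Coalgebra.comul (R := ℂ) k) (by simp)
      (fun x y => by simp [G, SourceTarget.leftC])
      (fun x y hx hy => by simp only [map_add, hx, hy])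
  -- On k₁ ⊗ k₂ ⊗ k₃ the map F gives α(k₁) ⊗ k₃ ⊗ β(k₂) and G gives α(k₂) ⊗ k₃ ⊗ β(k₁); they agree
  -- by the cocommutation of α and β on k₁ ⊗ k₂.
  have h3 : ∀ g h : K,
      F (TensorProduct.assoc ℂ K K K (Coalgebra.comul g ⊗ₜ h)) =
      G (TensorProduct.assoc ℂ K K K (Coalgebra.comul g ⊗ₜ h)) := fun g h => by
    have hF : ∀ u : K ⊗[ℂ] K, F (TensorProduct.assoc ℂ K K K (u ⊗ₜ h)) =
        TensorProduct.leftComm ℂ K C C (h ⊗ₜ TensorProduct.map (S.α : K →ₗ[ℂ] C) S.β u) := fun u =>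
      TensorProduct.induction_on u (by simp) (fun x y => by simp [F])
        (fun x y hx hy => by simp only [map_add, add_tmul, tmul_add, hx, hy])
    have hG : ∀ u : K ⊗[ℂ] K, G (TensorProduct.assoc ℂ K K K (u ⊗ₜ h)) =
        TensorProduct.leftComm ℂ K C C (h ⊗ₜ TensorProduct.map (S.α : K →ₗ[ℂ] C) S.β
          (TensorProduct.comm ℂ K K u)) := fun u =>
      TensorProduct.induction_on u (by simp) (fun x y => by simp [G])
        (fun x y hx hy => by simp only [map_add, add_tmul, tmul_add, hx, hy])
    rw [hF, hG, ← S.cocommute]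
  rw [h1, h2, ← hco]
  refine TensorProduct.induction_on (Coalgebra.comul (R := ℂ) k) (by simp)
    (fun g h => by simpa using h3 g h) (fun x y hx hy => by simp only [map_add, hx, hy])

variable (H : LeftBicoalgebroid C K)

theorem LeftBicoalgebroid.mulExt_eq {x : K ⊗[ℂ] K} (hx : x ∈ H.KK) :
    H.mulExt x = H.mul ⟨x, hx⟩ := extend_apply H.KK H.mul ⟨x, hx⟩

theorem LeftBicoalgebroid.counit_mulExt {x : K ⊗[ℂ] K} (hx : x ∈ H.KK) :
    Coalgebra.counit (R := ℂ) (H.mulExt x) =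
      TensorProduct.lid ℂ ℂ (TensorProduct.map Coalgebra.counit Coalgebra.counit x) := by
  rw [H.mulExt_eq hx, H.counit_mul]

theorem SourceTarget.counit_leftC (S : SourceTarget C K) (k : K) : TensorProduct.rid ℂ C
    ((Coalgebra.counit (R := ℂ) (A := K)).lTensor C (S.leftC k)) = S.α k := by
  have h : ∀ u : K ⊗[ℂ] K, TensorProduct.rid ℂ C ((Coalgebra.counit (R := ℂ) (A := K)).lTensor C
      ((S.α : K →ₗ[ℂ] C).rTensor K u)) =
      S.α (TensorProduct.rid ℂ K ((Coalgebra.counit (R := ℂ) (A := K)).lTensor K u)) := fun u =>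
    TensorProduct.induction_on u (by simp) (fun x y => by simp)
      (fun x y hx hy => by simp only [map_add, hx, hy])
  rw [SourceTarget.leftC, LinearMap.comp_apply, h, Coalgebra.lTensor_counit_comul]
  simp

theorem SourceTarget.counit_rightC (S : SourceTarget C K) (k : K) : TensorProduct.lid ℂ C
    ((Coalgebra.counit (R := ℂ) (A := K)).rTensor C (S.rightC k)) = S.β k := by
  have h : ∀ u : K ⊗[ℂ] K, TensorProduct.lid ℂ C ((Coalgebra.counit (R := ℂ) (A := K)).rTensor C
      (S.β.lTensor K (TensorProduct.comm ℂ K K u))) =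
      S.β (TensorProduct.rid ℂ K ((Coalgebra.counit (R := ℂ) (A := K)).lTensor K u)) := fun u =>
    TensorProduct.induction_on u (by simp) (fun x y => by simp)
      (fun x y hx hy => by simp only [map_add, hx, hy])
  simp only [SourceTarget.rightC, LinearMap.comp_apply, LinearEquiv.coe_coe]
  rw [h, Coalgebra.lTensor_counit_comul]
  simp

/-- `α(gh) = α(g)ε(h)`. -/
theorem LeftBicoalgebroid.α_mulExt {x : K ⊗[ℂ] K} (hx : x ∈ H.KK) :
    H.α (H.mulExt x) = TensorProduct.rid ℂ C
      (TensorProduct.map (H.α : K →ₗ[ℂ] C) Coalgebra.counit x) := by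
  have hx' : TensorProduct.assoc ℂ K C K (H.rightC.rTensor K x) = H.leftC.lTensor K x := hx
  -- Left colinearity of the product, with the counit applied to the leg in `K`.
  have h := congrArg (fun y => TensorProduct.rid ℂ C ((Coalgebra.counit (R := ℂ) (A := K)).lTensor C y))
    (H.mul_leftC ⟨x, hx⟩)
  simp only at h
  rw [H.counit_leftC, ← LinearMap.lTensor_comp_apply, ← H.mulExt_eq hx] at h
  rw [h]
  -- To use ε(g₂h) = ε(g₂)ε(h) one needs α(g₁) ⊗ g₂ ⊗ h in C ⊗ (K □_C K); this holds because the two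
  -- coactions of C on `K` commute.
  have hmem : ∀ φ : C →ₗ[ℂ] ℂ,
      lslice φ (TensorProduct.assoc ℂ C K K (H.leftC.rTensor K x)) ∈ H.KK := by
    refine lslice_mem_eqLocus ?_
    have hL : ∀ x : K ⊗[ℂ] K, ((TensorProduct.assoc ℂ K C K).toLinearMap ∘ₗ H.rightC.rTensor K).lTensor C
        (TensorProduct.assoc ℂ C K K (H.leftC.rTensor K x)) =
        TensorProduct.assoc ℂ C K (C ⊗[ℂ] K) (H.leftC.rTensor (C ⊗[ℂ] K)
          (TensorProduct.assoc ℂ K C K (H.rightC.rTensor K x))) := fun x => by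
      refine TensorProduct.induction_on x (by simp) (fun g h => ?_)
        (fun x y hx hy => by simp only [map_add, hx, hy])
      have h1 : ∀ u : C ⊗[ℂ] K, ((TensorProduct.assoc ℂ K C K).toLinearMap ∘ₗ H.rightC.rTensor K).lTensor C
          (TensorProduct.assoc ℂ C K K (u ⊗ₜ h)) = (TensorProduct.assoc ℂ K C K).toLinearMap.lTensor C
          (TensorProduct.assoc ℂ C (K ⊗[ℂ] C) K (H.rightC.lTensor C u ⊗ₜ h)) := fun u =>
        TensorProduct.induction_on u (by simp) (fun x y => by simp)
          (fun x y hx hy => by simp only [map_add, add_tmul, hx, hy])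
      have h2 : ∀ u : K ⊗[ℂ] C, TensorProduct.assoc ℂ C K (C ⊗[ℂ] K) (H.leftC.rTensor (C ⊗[ℂ] K)
          (TensorProduct.assoc ℂ K C K (u ⊗ₜ h))) = (TensorProduct.assoc ℂ K C K).toLinearMap.lTensor C
          (TensorProduct.assoc ℂ C (K ⊗[ℂ] C) K
            (TensorProduct.assoc ℂ C K C (H.leftC.rTensor C u) ⊗ₜ h)) := fun u => by
        refine TensorProduct.induction_on u (by simp) (fun g c => ?_)
          (fun x y hx hy => by simp only [map_add, add_tmul, hx, hy])
        simp only [LinearMap.rTensor_tmul, TensorProduct.assoc_tmul]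
        exact TensorProduct.induction_on (H.leftC g) (by simp) (fun x y => by simp)
          (fun x y hx hy => by simp only [map_add, add_tmul, hx, hy])
      rw [LinearMap.rTensor_tmul, LinearMap.rTensor_tmul, h1, h2, H.leftC_rightC]
    have hR : ∀ x : K ⊗[ℂ] K, (H.leftC.lTensor K).lTensor C
        (TensorProduct.assoc ℂ C K K (H.leftC.rTensor K x)) =
        TensorProduct.assoc ℂ C K (C ⊗[ℂ] K) (H.leftC.rTensor (C ⊗[ℂ] K)
          (H.leftC.lTensor K x)) := fun x => by
      refine TensorProduct.induction_on x (by simp) (fun g h => ?_)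
        (fun x y hx hy => by simp only [map_add, hx, hy])
      simp only [LinearMap.rTensor_tmul, LinearMap.lTensor_tmul]
      exact TensorProduct.induction_on (H.leftC g) (by simp) (fun x y => by simp)
        (fun x y hx hy => by simp only [map_add, add_tmul, hx, hy])
    rw [hL, hR, hx']
  rw [lTensor_eqOn (P := H.KK) (g := (TensorProduct.lid ℂ ℂ).toLinearMap ∘ₗ
    TensorProduct.map Coalgebra.counit Coalgebra.counit) (fun e he => H.counit_mulExt he) hmem]
  refine TensorProduct.induction_on x (by simp) (fun g h => ?_)
    (fun x y hx hy => by simp only [map_add, hx, hy])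
  rw [LinearMap.rTensor_tmul, TensorProduct.map_tmul, TensorProduct.rid_tmul]
  change _ = Coalgebra.counit (R := ℂ) h • H.α g
  rw [← H.counit_leftC]
  refine TensorProduct.induction_on (H.leftC g) (by simp) (fun x y => ?_)
    (fun x y hx hy => by simp only [map_add, add_tmul, smul_add, hx, hy])
  simp [mul_comm, mul_smul]

/-- `β(gh) = ε(g)β(h)`. -/
theorem LeftBicoalgebroid.β_mulExt {x : K ⊗[ℂ] K} (hx : x ∈ H.KK) :
    H.β (H.mulExt x) = TensorProduct.lid ℂ C (TensorProduct.map Coalgebra.counit H.β x) := by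
  have hx' : TensorProduct.assoc ℂ K C K (H.rightC.rTensor K x) = H.leftC.lTensor K x := hx
  have h := congrArg (fun y => TensorProduct.lid ℂ C ((Coalgebra.counit (R := ℂ) (A := K)).rTensor C y))
    (H.mul_rightC ⟨x, hx⟩)
  simp only at h
  rw [H.counit_rightC, ← LinearMap.rTensor_comp_apply, ← H.mulExt_eq hx] at h
  rw [h]
  have hmem : ∀ φ : C →ₗ[ℂ] ℂ,
      rslice φ ((TensorProduct.assoc ℂ K K C).symm (H.rightC.lTensor K x)) ∈ H.KK := by
    refine rslice_mem_eqLocus ?_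
    have hL : ∀ x : K ⊗[ℂ] K, ((TensorProduct.assoc ℂ K C K).toLinearMap ∘ₗ H.rightC.rTensor K).rTensor C
        ((TensorProduct.assoc ℂ K K C).symm (H.rightC.lTensor K x)) =
        (TensorProduct.assoc ℂ K (C ⊗[ℂ] K) C).symm ((TensorProduct.assoc ℂ C K C).symm.toLinearMap.lTensor K
          ((H.rightC.lTensor C).lTensor K
          (TensorProduct.assoc ℂ K C K (H.rightC.rTensor K x)))) := fun x => by
      refine TensorProduct.induction_on x (by simp) (fun g h => ?_)
        (fun x y hx hy => by simp only [map_add, hx, hy])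
      simp only [LinearMap.rTensor_tmul, LinearMap.lTensor_tmul]
      have h2 : ∀ u : K ⊗[ℂ] C, (H.rightC.lTensor C).lTensor K (TensorProduct.assoc ℂ K C K (u ⊗ₜ h)) =
          TensorProduct.assoc ℂ K C (K ⊗[ℂ] C) (u ⊗ₜ H.rightC h) := fun u =>
        TensorProduct.induction_on u (by simp) (fun x y => by simp)
          (fun x y hx hy => by simp only [map_add, add_tmul, hx, hy])
      rw [h2]
      refine TensorProduct.induction_on (H.rightC h) (by simp) (fun h c => ?_)
        (fun x y hx hy => by simp only [map_add, tmul_add, hx, hy])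
      simp only [TensorProduct.assoc_symm_tmul, LinearMap.rTensor_tmul, LinearMap.comp_apply]
      exact TensorProduct.induction_on (H.rightC g) (by simp) (fun x y => by simp)
        (fun x y hx hy => by simp only [map_add, add_tmul, hx, hy])
    have hR : ∀ x : K ⊗[ℂ] K, (H.leftC.lTensor K).rTensor C
        ((TensorProduct.assoc ℂ K K C).symm (H.rightC.lTensor K x)) =
        (TensorProduct.assoc ℂ K (C ⊗[ℂ] K) C).symm ((TensorProduct.assoc ℂ C K C).symm.toLinearMap.lTensor K
          ((H.rightC.lTensor C).lTensor K (H.leftC.lTensor K x))) := fun x => by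
      refine TensorProduct.induction_on x (by simp) (fun g h => ?_)
        (fun x y hx hy => by simp only [map_add, hx, hy])
      simp only [LinearMap.lTensor_tmul, H.leftC_rightC]
      rw [LinearEquiv.coe_coe, LinearEquiv.symm_apply_apply]
      refine TensorProduct.induction_on (H.rightC h) (by simp) (fun x y => ?_)
        (fun x y hx hy => by simp only [map_add, tmul_add, hx, hy])
      simp
    rw [hL, hR, hx']
  rw [rTensor_eqOn (P := H.KK) (g := (TensorProduct.lid ℂ ℂ).toLinearMap ∘ₗ
    TensorProduct.map Coalgebra.counit Coalgebra.counit) (fun e he => H.counit_mulExt he) hmem]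
  refine TensorProduct.induction_on x (by simp) (fun g h => ?_)
    (fun x y hx hy => by simp only [map_add, hx, hy])
  rw [LinearMap.lTensor_tmul, TensorProduct.map_tmul, TensorProduct.lid_tmul]
  rw [← H.counit_rightC]
  refine TensorProduct.induction_on (H.rightC h) (by simp) (fun x y => ?_)
    (fun x y hx hy => by simp only [map_add, tmul_add, smul_add, hx, hy])
  simp [mul_smul]

end Multiplication

/-! ### The comodule structure of A □_C B. -/

section ProductCoaction

variable {C K A B : Type*} [AddCommGroup C] [Module ℂ C] [Coalgebra ℂ C]
  [AddCommGroup K] [Module ℂ K] [Coalgebra ℂ K]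
  [AddCommGroup A] [Module ℂ A] [AddCommGroup B] [Module ℂ B]
  (H : LeftBicoalgebroid C K) {ρA : A →ₗ[ℂ] K ⊗[ℂ] A} {ρB : B →ₗ[ℂ] K ⊗[ℂ] B}

/-- `a ⊗ b ↦ a₋₁b₋₁ ⊗ (a₀ ⊗ b₀)`. -/
def LeftBicoalgebroid.prodCoact (ρA : A →ₗ[ℂ] K ⊗[ℂ] A) (ρB : B →ₗ[ℂ] K ⊗[ℂ] B) :
    A ⊗[ℂ] B →ₗ[ℂ] K ⊗[ℂ] (A ⊗[ℂ] B) :=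
  H.mulExt.rTensor (A ⊗[ℂ] B) ∘ₗ bicoact ρA ρB

theorem IsLeftCoaction.coassoc_map {E : Type*} [AddCommGroup E] [Module ℂ E]
    (hA : IsLeftCoaction ρA) (f : K →ₗ[ℂ] E) (a : A) :
    (f.rTensor A ∘ₗ ρA).lTensor K (ρA a) = TensorProduct.assoc ℂ K E A
      ((f.lTensor K ∘ₗ Coalgebra.comul).rTensor A (ρA a)) := by
  have h := congrArg ((f.rTensor A).lTensor K) (hA.coassoc a)
  rw [← LinearMap.lTensor_comp_apply] at h
  rw [← h]
  refine TensorProduct.induction_on (ρA a) (by simp) (fun k a => ?_)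
    (fun x y hx hy => by simp only [map_add, hx, hy])
  simp only [LinearMap.rTensor_tmul, LinearMap.comp_apply]
  exact TensorProduct.induction_on (Coalgebra.comul (R := ℂ) k) (by simp) (fun x y => by simp)
    (fun x y hx hy => by simp only [map_add, add_tmul, hx, hy])

/-- `β(b₋₁) ⊗ b₀`. -/
def SourceTarget.leftβ (S : SourceTarget C K) (ρ : A →ₗ[ℂ] K ⊗[ℂ] A) : A →ₗ[ℂ] C ⊗[ℂ] A :=
  S.β.rTensor A ∘ₗ ρ

theorem SourceTarget.comm_leftβ (S : SourceTarget C K) (ρ : A →ₗ[ℂ] K ⊗[ℂ] A) (a : A) :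
    TensorProduct.comm ℂ C A (S.leftβ ρ a) = S.rC ρ a := by
  simp only [SourceTarget.leftβ, SourceTarget.rC, LinearMap.comp_apply, LinearEquiv.coe_coe]
  exact TensorProduct.induction_on (ρ a) (by simp) (fun x y => by simp)
    (fun x y hx hy => by simp only [map_add, hx, hy])

/-- `α(a₋₁b₋₁) ⊗ a₀ ⊗ b₀ = α(a₋₁) ⊗ a₀ ⊗ b`. -/
theorem LeftBicoalgebroid.lC_prodCoact (hA : IsLeftCoaction ρA) (hB : IsLeftCoaction ρB)
    {x : A ⊗[ℂ] B} (hx : x ∈ H.box ρA ρB) :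
    (H.α : K →ₗ[ℂ] C).rTensor (A ⊗[ℂ] B) (H.prodCoact ρA ρB x) =
      TensorProduct.assoc ℂ C A B ((H.lC ρA).rTensor B x) := by
  rw [LeftBicoalgebroid.prodCoact, LinearMap.comp_apply, ← LinearMap.rTensor_comp_apply,
    rTensor_eqOn (P := H.KK) (g := (TensorProduct.rid ℂ C).toLinearMap ∘ₗ
      TensorProduct.map (H.α : K →ₗ[ℂ] C) Coalgebra.counit) (fun e he => H.α_mulExt he)
      (H.rslice_bicoact_mem hA hB hx)]
  clear hx
  refine TensorProduct.induction_on x (by simp) (fun a b => ?_)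
    (fun x y hx hy => by simp only [map_add, hx, hy])
  have key : ∀ (u : K ⊗[ℂ] A) (v : K ⊗[ℂ] B), ((TensorProduct.rid ℂ C).toLinearMap ∘ₗ
      TensorProduct.map (H.α : K →ₗ[ℂ] C) Coalgebra.counit).rTensor (A ⊗[ℂ] B)
      (TensorProduct.tensorTensorTensorComm ℂ K A K B (u ⊗ₜ v)) =
      TensorProduct.assoc ℂ C A B ((H.α : K →ₗ[ℂ] C).rTensor A u ⊗ₜ
        TensorProduct.lid ℂ B ((Coalgebra.counit (R := ℂ) (A := K)).rTensor B v)) := fun u v => by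
    refine TensorProduct.induction_on u (by simp) (fun g a => ?_)
      (fun x y hx hy => by simp only [map_add, add_tmul, hx, hy])
    exact TensorProduct.induction_on v (by simp) (fun x y => by simp [TensorProduct.smul_tmul'])
      (fun x y hx hy => by simp only [map_add, tmul_add, hx, hy])
  rw [bicoact, LinearMap.comp_apply, TensorProduct.map_tmul, LinearEquiv.coe_coe, key, hB.counit]
  rfl

/-- `β(a₋₁b₋₁) ⊗ a₀ ⊗ b₀ = β(b₋₁) ⊗ a ⊗ b₀`. -/
theorem LeftBicoalgebroid.leftβ_prodCoact (hA : IsLeftCoaction ρA) (hB : IsLeftCoaction ρB)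
    {x : A ⊗[ℂ] B} (hx : x ∈ H.box ρA ρB) :
    H.β.rTensor (A ⊗[ℂ] B) (H.prodCoact ρA ρB x) =
      TensorProduct.leftComm ℂ A C B ((H.leftβ ρB).lTensor A x) := by
  rw [LeftBicoalgebroid.prodCoact, LinearMap.comp_apply, ← LinearMap.rTensor_comp_apply,
    rTensor_eqOn (P := H.KK) (g := (TensorProduct.lid ℂ C).toLinearMap ∘ₗ
      TensorProduct.map Coalgebra.counit H.β) (fun e he => H.β_mulExt he)
      (H.rslice_bicoact_mem hA hB hx)]
  clear hx
  refine TensorProduct.induction_on x (by simp) (fun a b => ?_)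
    (fun x y hx hy => by simp only [map_add, hx, hy])
  have key : ∀ (u : K ⊗[ℂ] A) (v : K ⊗[ℂ] B), ((TensorProduct.lid ℂ C).toLinearMap ∘ₗ
      TensorProduct.map Coalgebra.counit H.β).rTensor (A ⊗[ℂ] B)
      (TensorProduct.tensorTensorTensorComm ℂ K A K B (u ⊗ₜ v)) =
      TensorProduct.leftComm ℂ A C B (TensorProduct.lid ℂ A
        ((Coalgebra.counit (R := ℂ) (A := K)).rTensor A u) ⊗ₜ H.β.rTensor B v) := fun u v => by
    refine TensorProduct.induction_on u (by simp) (fun g a => ?_)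
      (fun x y hx hy => by simp only [map_add, add_tmul, hx, hy])
    exact TensorProduct.induction_on v (by simp) (fun x y => by simp [← TensorProduct.smul_tmul'])
      (fun x y hx hy => by simp only [map_add, tmul_add, hx, hy])
  rw [bicoact, LinearMap.comp_apply, TensorProduct.map_tmul, LinearEquiv.coe_coe, key, hA.counit]
  rfl

/-- `A □_C B` is stable under the coaction of `K`. -/
theorem LeftBicoalgebroid.lslice_prodCoact_mem (hA : IsLeftCoaction ρA) (hB : IsLeftCoaction ρB)
    {x : A ⊗[ℂ] B} (hx : x ∈ H.box ρA ρB) (φ : K →ₗ[ℂ] ℂ) :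
    lslice φ (H.prodCoact ρA ρB x) ∈ H.box ρA ρB := by
  refine lslice_mem_eqLocus ?_ φ
  let Ω : (K ⊗[ℂ] C) ⊗[ℂ] (A ⊗[ℂ] B) →ₗ[ℂ] K ⊗[ℂ] (A ⊗[ℂ] (C ⊗[ℂ] B)) :=
    (TensorProduct.leftComm ℂ C A B).toLinearMap.lTensor K ∘ₗ
      (TensorProduct.assoc ℂ K C (A ⊗[ℂ] B)).toLinearMap
  let TL : K ⊗[ℂ] K →ₗ[ℂ] K ⊗[ℂ] C := H.mulExt.rTensor C ∘ₗ
    (TensorProduct.assoc ℂ K K C).symm.toLinearMap ∘ₗ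
    ((H.α : K →ₗ[ℂ] C).lTensor K ∘ₗ Coalgebra.comul).lTensor K
  let TR : K ⊗[ℂ] K →ₗ[ℂ] K ⊗[ℂ] C := H.mulExt.rTensor C ∘ₗ
    (TensorProduct.rightComm ℂ K C K).toLinearMap ∘ₗ
    (H.β.lTensor K ∘ₗ Coalgebra.comul).rTensor K
  -- By coassociativity, coacting with C on a₀ takes β of the second leg of a₋₁, and coacting on b₀
  -- takes α of the second leg of b₋₁. The Takeuchi axiom equates the two.
  have hT : TL.rTensor (A ⊗[ℂ] B) (bicoact ρA ρB x) = TR.rTensor (A ⊗[ℂ] B) (bicoact ρA ρB x) :=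
    rTensor_eqOn (P := H.KK) (fun e he => H.takeuchi ⟨e, he⟩) (H.rslice_bicoact_mem hA hB hx)
  have hR : ∀ x : A ⊗[ℂ] B, ((H.lC ρB).lTensor A).lTensor K (H.prodCoact ρA ρB x) =
      Ω (TL.rTensor (A ⊗[ℂ] B) (bicoact ρA ρB x)) := fun x => by
    refine TensorProduct.induction_on x (by simp) (fun a b => ?_)
      (fun x y hx hy => by simp only [map_add, hx, hy])
    have h1 : ∀ (u : K ⊗[ℂ] A) (v : K ⊗[ℂ] B), ((H.lC ρB).lTensor A).lTensor K
        (H.mulExt.rTensor (A ⊗[ℂ] B) (TensorProduct.tensorTensorTensorComm ℂ K A K B (u ⊗ₜ v))) =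
        H.mulExt.rTensor _ (TensorProduct.tensorTensorTensorComm ℂ K A K (C ⊗[ℂ] B)
          (u ⊗ₜ (H.lC ρB).lTensor K v)) := fun u v => by
      refine TensorProduct.induction_on u (by simp) (fun g a => ?_)
        (fun x y hx hy => by simp only [map_add, add_tmul, hx, hy])
      exact TensorProduct.induction_on v (by simp) (fun x y => by simp)
        (fun x y hx hy => by simp only [map_add, tmul_add, hx, hy])
    have h2 : ∀ (u : K ⊗[ℂ] A) (v : K ⊗[ℂ] B), Ω (TL.rTensor (A ⊗[ℂ] B)
        (TensorProduct.tensorTensorTensorComm ℂ K A K B (u ⊗ₜ v))) =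
        H.mulExt.rTensor _ (TensorProduct.tensorTensorTensorComm ℂ K A K (C ⊗[ℂ] B)
          (u ⊗ₜ TensorProduct.assoc ℂ K C B
            (((H.α : K →ₗ[ℂ] C).lTensor K ∘ₗ Coalgebra.comul).rTensor B v))) := fun u v => by
      refine TensorProduct.induction_on u (by simp) (fun g a => ?_)
        (fun x y hx hy => by simp only [map_add, add_tmul, hx, hy])
      refine TensorProduct.induction_on v (by simp) (fun h b => ?_)
        (fun x y hx hy => by simp only [map_add, tmul_add, hx, hy])
      simp only [TL, TensorProduct.tensorTensorTensorComm_tmul, LinearMap.rTensor_tmul,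
        LinearMap.lTensor_tmul, LinearMap.comp_apply, LinearEquiv.coe_coe]
      exact TensorProduct.induction_on (Coalgebra.comul (R := ℂ) h) (by simp)
        (fun x y => by simp [Ω])
        (fun x y hx hy => by simp only [map_add, tmul_add, add_tmul, hx, hy])
    simp only [LeftBicoalgebroid.prodCoact, bicoact, LinearMap.comp_apply, TensorProduct.map_tmul,
      LinearEquiv.coe_coe]
    rw [h1, h2, ← hB.coassoc_map]
    rfl
  have hL : ∀ x : A ⊗[ℂ] B, ((TensorProduct.assoc ℂ A C B).toLinearMap ∘ₗ
      (H.rC ρA).rTensor B).lTensor K (H.prodCoact ρA ρB x) =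
      Ω (TR.rTensor (A ⊗[ℂ] B) (bicoact ρA ρB x)) := fun x => by
    refine TensorProduct.induction_on x (by simp) (fun a b => ?_)
      (fun x y hx hy => by simp only [map_add, hx, hy])
    have h1 : ∀ (u : K ⊗[ℂ] A) (v : K ⊗[ℂ] B), ((TensorProduct.assoc ℂ A C B).toLinearMap ∘ₗ
        (H.rC ρA).rTensor B).lTensor K
        (H.mulExt.rTensor (A ⊗[ℂ] B) (TensorProduct.tensorTensorTensorComm ℂ K A K B (u ⊗ₜ v))) =
        ((TensorProduct.leftComm ℂ C A B).toLinearMap ∘ₗ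
          (TensorProduct.assoc ℂ C A B).toLinearMap).lTensor K
        (H.mulExt.rTensor _ (TensorProduct.tensorTensorTensorComm ℂ K (C ⊗[ℂ] A) K B
          ((H.leftβ ρA).lTensor K u ⊗ₜ v))) := fun u v => by
      refine TensorProduct.induction_on u (by simp) (fun g a => ?_)
        (fun x y hx hy => by simp only [map_add, add_tmul, hx, hy])
      refine TensorProduct.induction_on v (by simp) (fun h b => ?_)
        (fun x y hx hy => by simp only [map_add, tmul_add, hx, hy])
      simp only [TensorProduct.tensorTensorTensorComm_tmul, LinearMap.rTensor_tmul,
        LinearMap.lTensor_tmul, LinearMap.comp_apply, LinearEquiv.coe_coe, ← H.comm_leftβ]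
      exact TensorProduct.induction_on (H.leftβ ρA a) (by simp) (fun x y => by simp)
        (fun x y hx hy => by simp only [map_add, tmul_add, add_tmul, hx, hy])
    have h2 : ∀ (u : K ⊗[ℂ] A) (v : K ⊗[ℂ] B), Ω (TR.rTensor (A ⊗[ℂ] B)
        (TensorProduct.tensorTensorTensorComm ℂ K A K B (u ⊗ₜ v))) =
        ((TensorProduct.leftComm ℂ C A B).toLinearMap ∘ₗ
          (TensorProduct.assoc ℂ C A B).toLinearMap).lTensor K
        (H.mulExt.rTensor _ (TensorProduct.tensorTensorTensorComm ℂ K (C ⊗[ℂ] A) K B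
          (TensorProduct.assoc ℂ K C A ((H.β.lTensor K ∘ₗ Coalgebra.comul).rTensor A u) ⊗ₜ
            v))) := fun u v => by
      refine TensorProduct.induction_on v (by simp) (fun h b => ?_)
        (fun x y hx hy => by simp only [map_add, tmul_add, hx, hy])
      refine TensorProduct.induction_on u (by simp) (fun g a => ?_)
        (fun x y hx hy => by simp only [map_add, add_tmul, hx, hy])
      simp only [TR, TensorProduct.tensorTensorTensorComm_tmul, LinearMap.rTensor_tmul,
        LinearMap.comp_apply, LinearEquiv.coe_coe]
      exact TensorProduct.induction_on (Coalgebra.comul (R := ℂ) g) (by simp)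
        (fun x y => by simp [Ω])
        (fun x y hx hy => by simp only [map_add, add_tmul, hx, hy])
    simp only [LeftBicoalgebroid.prodCoact, bicoact, LinearMap.comp_apply, TensorProduct.map_tmul,
      LinearEquiv.coe_coe]
    rw [h1, h2, ← hA.coassoc_map]
    rfl
  rw [hR, hL, hT]

/-- Multiplicativity of Δ on K □_C K reduces this to coassociativity in A and in B. It holds only on
A □_C B, since elsewhere the formula depends on the chosen extension of the product. -/
theorem LeftBicoalgebroid.prodCoact_coassoc (hA : IsLeftCoaction ρA) (hB : IsLeftCoaction ρB)
    {x : A ⊗[ℂ] B} (hx : x ∈ H.box ρA ρB) :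
    TensorProduct.assoc ℂ K K (A ⊗[ℂ] B) ((Coalgebra.comul (R := ℂ) (A := K)).rTensor (A ⊗[ℂ] B)
      (H.prodCoact ρA ρB x)) = (H.prodCoact ρA ρB).lTensor K (H.prodCoact ρA ρB x) := by
  let P : (K ⊗[ℂ] (K ⊗[ℂ] A)) ⊗[ℂ] (K ⊗[ℂ] (K ⊗[ℂ] B)) →ₗ[ℂ] K ⊗[ℂ] (K ⊗[ℂ] (A ⊗[ℂ] B)) :=
    TensorProduct.map H.mulExt (H.mulExt.rTensor (A ⊗[ℂ] B) ∘ₗ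
      (TensorProduct.tensorTensorTensorComm ℂ K A K B).toLinearMap) ∘ₗ
    (TensorProduct.tensorTensorTensorComm ℂ K (K ⊗[ℂ] A) K (K ⊗[ℂ] B)).toLinearMap
  conv_lhs => rw [LeftBicoalgebroid.prodCoact, LinearMap.comp_apply, ← LinearMap.rTensor_comp_apply,
    rTensor_eqOn (P := H.KK) (g := TensorProduct.map H.mulExt H.mulExt ∘ₗ
      (TensorProduct.tensorTensorTensorComm ℂ K K K K).toLinearMap ∘ₗ
      TensorProduct.map Coalgebra.comul Coalgebra.comul)
      (fun e he => by rw [LinearMap.comp_apply, H.mulExt_eq he]; exact H.comul_mul ⟨e, he⟩)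
      (H.rslice_bicoact_mem hA hB hx)]
  clear hx
  refine TensorProduct.induction_on x (by simp) (fun a b => ?_)
    (fun x y hx hy => by simp only [map_add, hx, hy])
  simp only [LeftBicoalgebroid.prodCoact, bicoact, LinearMap.comp_apply, TensorProduct.map_tmul,
      LinearEquiv.coe_coe]
  have h1 : ∀ (u : K ⊗[ℂ] A) (v : K ⊗[ℂ] B), (H.prodCoact ρA ρB).lTensor K
      (H.mulExt.rTensor (A ⊗[ℂ] B) (TensorProduct.tensorTensorTensorComm ℂ K A K B (u ⊗ₜ v))) =
      P (ρA.lTensor K u ⊗ₜ ρB.lTensor K v) := fun u v => by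
    refine TensorProduct.induction_on u (by simp) (fun g a => ?_)
      (fun x y hx hy => by simp only [map_add, add_tmul, hx, hy])
    exact TensorProduct.induction_on v (by simp)
      (fun x y => by simp [LeftBicoalgebroid.prodCoact, bicoact, P])
      (fun x y hx hy => by simp only [map_add, tmul_add, hx, hy])
  have h2 : ∀ (u : K ⊗[ℂ] A) (v : K ⊗[ℂ] B), TensorProduct.assoc ℂ K K (A ⊗[ℂ] B)
      ((TensorProduct.map H.mulExt H.mulExt ∘ₗ
        (TensorProduct.tensorTensorTensorComm ℂ K K K K).toLinearMap ∘ₗ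
        TensorProduct.map Coalgebra.comul Coalgebra.comul).rTensor (A ⊗[ℂ] B)
        (TensorProduct.tensorTensorTensorComm ℂ K A K B (u ⊗ₜ v))) =
      P (TensorProduct.assoc ℂ K K A ((Coalgebra.comul (R := ℂ) (A := K)).rTensor A u) ⊗ₜ
        TensorProduct.assoc ℂ K K B ((Coalgebra.comul (R := ℂ) (A := K)).rTensor B v)) :=
      fun u v => by
    refine TensorProduct.induction_on u (by simp) (fun g a => ?_)
      (fun x y hx hy => by simp only [map_add, add_tmul, hx, hy])
    refine TensorProduct.induction_on v (by simp) (fun h b => ?_)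
      (fun x y hx hy => by simp only [map_add, tmul_add, hx, hy])
    simp only [TensorProduct.tensorTensorTensorComm_tmul, LinearMap.rTensor_tmul,
      LinearMap.comp_apply, TensorProduct.map_tmul, LinearEquiv.coe_coe]
    refine TensorProduct.induction_on (Coalgebra.comul (R := ℂ) g) (by simp) (fun g g' => ?_)
      (fun x y hx hy => by simp only [map_add, add_tmul, hx, hy])
    exact TensorProduct.induction_on (Coalgebra.comul (R := ℂ) h) (by simp)
      (fun x y => by simp [P]) (fun x y hx hy => by simp only [map_add, tmul_add, add_tmul, hx, hy])
  rw [h2, hA.coassoc, hB.coassoc, ← h1]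
  rfl

theorem LeftBicoalgebroid.prodCoact_counit (hA : IsLeftCoaction ρA) (hB : IsLeftCoaction ρB)
    {x : A ⊗[ℂ] B} (hx : x ∈ H.box ρA ρB) :
    TensorProduct.lid ℂ (A ⊗[ℂ] B) ((Coalgebra.counit (R := ℂ) (A := K)).rTensor (A ⊗[ℂ] B)
      (H.prodCoact ρA ρB x)) = x := by
  rw [LeftBicoalgebroid.prodCoact, LinearMap.comp_apply, ← LinearMap.rTensor_comp_apply,
    rTensor_eqOn (P := H.KK) (g := (TensorProduct.lid ℂ ℂ).toLinearMap ∘ₗ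
      TensorProduct.map Coalgebra.counit Coalgebra.counit) (fun e he => H.counit_mulExt he)
      (H.rslice_bicoact_mem hA hB hx)]
  clear hx
  refine TensorProduct.induction_on x (by simp) (fun a b => ?_)
    (fun x y hx hy => by simp only [map_add, hx, hy])
  have key : ∀ (u : K ⊗[ℂ] A) (v : K ⊗[ℂ] B), TensorProduct.lid ℂ (A ⊗[ℂ] B)
      (((TensorProduct.lid ℂ ℂ).toLinearMap ∘ₗ
      TensorProduct.map Coalgebra.counit Coalgebra.counit).rTensor (A ⊗[ℂ] B)
      (TensorProduct.tensorTensorTensorComm ℂ K A K B (u ⊗ₜ v))) =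
      TensorProduct.lid ℂ A ((Coalgebra.counit (R := ℂ) (A := K)).rTensor A u) ⊗ₜ
        TensorProduct.lid ℂ B ((Coalgebra.counit (R := ℂ) (A := K)).rTensor B v) := fun u v => by
    refine TensorProduct.induction_on u (by simp) (fun g a => ?_)
      (fun x y hx hy => by simp only [map_add, add_tmul, hx, hy])
    exact TensorProduct.induction_on v (by simp)
      (fun x y => by simp [← TensorProduct.smul_tmul', smul_smul, mul_comm])
      (fun x y hx hy => by simp only [map_add, tmul_add, hx, hy])
  rw [bicoact, LinearMap.comp_apply, TensorProduct.map_tmul, LinearEquiv.coe_coe, key, hA.counit,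
    hB.counit]

end ProductCoaction

/-! ### Associativity of the product coaction. -/

section Tricoaction

variable {K A B D : Type*} [AddCommGroup K] [Module ℂ K]
  [AddCommGroup A] [Module ℂ A] [AddCommGroup B] [Module ℂ B] [AddCommGroup D] [Module ℂ D]
  {ρA : A →ₗ[ℂ] K ⊗[ℂ] A} {ρB : B →ₗ[ℂ] K ⊗[ℂ] B} {ρD : D →ₗ[ℂ] K ⊗[ℂ] D}

/-- `a ⊗ b ⊗ d ↦ (a₋₁ ⊗ b₋₁ ⊗ d₋₁) ⊗ (a₀ ⊗ b₀ ⊗ d₀)`. -/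
def tricoact (ρA : A →ₗ[ℂ] K ⊗[ℂ] A) (ρB : B →ₗ[ℂ] K ⊗[ℂ] B) (ρD : D →ₗ[ℂ] K ⊗[ℂ] D) :
    A ⊗[ℂ] (B ⊗[ℂ] D) →ₗ[ℂ] (K ⊗[ℂ] (K ⊗[ℂ] K)) ⊗[ℂ] (A ⊗[ℂ] (B ⊗[ℂ] D)) :=
  (TensorProduct.tensorTensorTensorComm ℂ K A (K ⊗[ℂ] K) (B ⊗[ℂ] D)).toLinearMap ∘ₗ
    TensorProduct.map ρA (bicoact ρB ρD)

/-- G is left arbitrary because it is needed both for the product and for the two maps whose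
equalizer is K □_C K, the latter to verify that the legs are balanced. The same holds for
`rTensor_tricoact`. -/
theorem lTensor_tricoact {E : Type*} [AddCommGroup E] [Module ℂ E] (G : K ⊗[ℂ] K →ₗ[ℂ] E)
    (x : A ⊗[ℂ] (B ⊗[ℂ] D)) :
    (G.lTensor K).rTensor (A ⊗[ℂ] (B ⊗[ℂ] D)) (tricoact ρA ρB ρD x) =
      TensorProduct.tensorTensorTensorComm ℂ K A E (B ⊗[ℂ] D)
        (TensorProduct.map ρA (G.rTensor (B ⊗[ℂ] D) ∘ₗ bicoact ρB ρD) x) := by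
  refine TensorProduct.induction_on x (by simp) (fun a q => ?_)
    (fun x y hx hy => by simp only [map_add, hx, hy])
  simp only [tricoact, LinearMap.comp_apply, LinearEquiv.coe_coe, TensorProduct.map_tmul]
  refine TensorProduct.induction_on (ρA a) (by simp) (fun g a => ?_)
    (fun x y hx hy => by simp only [map_add, add_tmul, hx, hy])
  exact TensorProduct.induction_on (bicoact ρB ρD q) (by simp) (fun x y => by simp)
    (fun x y hx hy => by simp only [map_add, tmul_add, hx, hy])

theorem rTensor_tricoact {E : Type*} [AddCommGroup E] [Module ℂ E] (G : K ⊗[ℂ] K →ₗ[ℂ] E)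
    (x : A ⊗[ℂ] (B ⊗[ℂ] D)) :
    (G.rTensor K ∘ₗ (TensorProduct.assoc ℂ K K K).symm.toLinearMap).rTensor (A ⊗[ℂ] (B ⊗[ℂ] D))
        (tricoact ρA ρB ρD x) =
      (TensorProduct.assoc ℂ A B D).toLinearMap.lTensor (E ⊗[ℂ] K)
        (TensorProduct.tensorTensorTensorComm ℂ E (A ⊗[ℂ] B) K D
          (TensorProduct.map (G.rTensor (A ⊗[ℂ] B) ∘ₗ bicoact ρA ρB) ρD
            ((TensorProduct.assoc ℂ A B D).symm x))) := by
  refine TensorProduct.induction_on x (by simp) (fun a q => ?_)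
    (fun x y hx hy => by simp only [map_add, hx, hy])
  refine TensorProduct.induction_on q (by simp) (fun b d => ?_)
    (fun x y hx hy => by simp only [map_add, tmul_add, hx, hy])
  simp only [tricoact, bicoact, LinearMap.comp_apply, LinearEquiv.coe_coe, TensorProduct.map_tmul,
    TensorProduct.assoc_symm_tmul]
  refine TensorProduct.induction_on (ρA a) (by simp) (fun g a => ?_)
    (fun x y hx hy => by simp only [map_add, add_tmul, hx, hy])
  refine TensorProduct.induction_on (ρB b) (by simp) (fun g a => ?_)
    (fun x y hx hy => by simp only [map_add, tmul_add, add_tmul, hx, hy])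
  exact TensorProduct.induction_on (ρD d) (by simp) (fun x y => by simp)
    (fun x y hx hy => by simp only [map_add, tmul_add, hx, hy])

end Tricoaction

section Associativity

variable {C K A B D : Type*} [AddCommGroup C] [Module ℂ C] [Coalgebra ℂ C]
  [AddCommGroup K] [Module ℂ K] [Coalgebra ℂ K]
  [AddCommGroup A] [Module ℂ A] [AddCommGroup B] [Module ℂ B] [AddCommGroup D] [Module ℂ D]
  (H : LeftBicoalgebroid C K) {ρA : A →ₗ[ℂ] K ⊗[ℂ] A} {ρB : B →ₗ[ℂ] K ⊗[ℂ] B}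
  {ρD : D →ₗ[ℂ] K ⊗[ℂ] D}

theorem map_eqOn_left {E F V W : Type*} [AddCommGroup E] [Module ℂ E] [AddCommGroup F] [Module ℂ F]
    [AddCommGroup V] [Module ℂ V] [AddCommGroup W] [Module ℂ W]
    {P : Submodule ℂ E} {f g : E →ₗ[ℂ] F} (h : V →ₗ[ℂ] W) (hfg : ∀ e ∈ P, f e = g e)
    {x : E ⊗[ℂ] V} (hx : ∀ φ : V →ₗ[ℂ] ℂ, rslice φ x ∈ P) :
    TensorProduct.map f h x = TensorProduct.map g h x := by
  rw [← LinearMap.lTensor_comp_rTensor, ← LinearMap.lTensor_comp_rTensor, LinearMap.comp_apply,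
    LinearMap.comp_apply, rTensor_eqOn hfg hx]

theorem map_eqOn_right {E F V W : Type*} [AddCommGroup E] [Module ℂ E] [AddCommGroup F] [Module ℂ F]
    [AddCommGroup V] [Module ℂ V] [AddCommGroup W] [Module ℂ W]
    {P : Submodule ℂ E} {f g : E →ₗ[ℂ] F} (h : V →ₗ[ℂ] W) (hfg : ∀ e ∈ P, f e = g e)
    {x : V ⊗[ℂ] E} (hx : ∀ φ : V →ₗ[ℂ] ℂ, lslice φ x ∈ P) :
    TensorProduct.map h f x = TensorProduct.map h g x := by
  rw [← LinearMap.rTensor_comp_lTensor, ← LinearMap.rTensor_comp_lTensor, LinearMap.comp_apply,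
    LinearMap.comp_apply, lTensor_eqOn hfg hx]

/-- `a₋₁(b₋₁d₋₁) ⊗ a₀ ⊗ b₀ ⊗ d₀ = (a₋₁b₋₁)d₋₁ ⊗ a₀ ⊗ b₀ ⊗ d₀`. -/
theorem LeftBicoalgebroid.prodCoact_assoc (hA : IsLeftCoaction ρA) (hB : IsLeftCoaction ρB)
    (hD : IsLeftCoaction ρD) {x : A ⊗[ℂ] (B ⊗[ℂ] D)}
    (h1 : ∀ φ : A →ₗ[ℂ] ℂ, lslice φ x ∈ H.box ρB ρD)
    (h2 : ∀ φ : D →ₗ[ℂ] ℂ, rslice φ ((TensorProduct.assoc ℂ A B D).symm x) ∈ H.box ρA ρB) :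
    H.prodCoact ρA (H.prodCoact ρB ρD) x =
      (TensorProduct.assoc ℂ A B D).toLinearMap.lTensor K
        (H.prodCoact (H.prodCoact ρA ρB) ρD ((TensorProduct.assoc ℂ A B D).symm x)) := by
  have hL : H.prodCoact ρA (H.prodCoact ρB ρD) x = (H.mulExt ∘ₗ H.mulExt.lTensor K).rTensor _
      (tricoact ρA ρB ρD x) := by
    rw [LinearMap.rTensor_comp_apply, lTensor_tricoact]
    rfl
  have hR : (TensorProduct.assoc ℂ A B D).toLinearMap.lTensor K
      (H.prodCoact (H.prodCoact ρA ρB) ρD ((TensorProduct.assoc ℂ A B D).symm x)) =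
      (H.mulExt ∘ₗ (H.mulExt.rTensor K ∘ₗ
        (TensorProduct.assoc ℂ K K K).symm.toLinearMap)).rTensor _ (tricoact ρA ρB ρD x) := by
    rw [LinearMap.rTensor_comp_apply, rTensor_tricoact, ← LinearMap.comp_apply
      (LinearMap.rTensor _ _), LinearMap.rTensor_comp_lTensor, ← LinearMap.lTensor_comp_rTensor]
    rfl
  rw [hL, hR]
  -- Associativity in `K` is available on K □_C K □_C K only: the first goal balances b₋₁ against
  -- d₋₁, the second a₋₁ against b₋₁.
  refine rTensor_eqOn (P := H.triple H.leftC) (fun e he => H.mul_assoc e he)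
    (H.rslice_mem_triple ?_ ?_)
  · rw [lTensor_tricoact, lTensor_tricoact]
    congr 1
    exact map_eqOn_right ρA (fun e he => H.bicoact_balanced hB hD he) h1
  · rw [rTensor_tricoact, rTensor_tricoact]
    congr 2
    exact map_eqOn_left ρD (fun e he => H.bicoact_balanced hA hB he) h2

end Associativity

/-! ### The Takeuchi identity for the action on M. -/

section CanonicalCoaction

variable {C K M : Type*} [AddCommGroup C] [Module ℂ C] [Coalgebra ℂ C]
  [AddCommGroup K] [Module ℂ K] [Coalgebra ℂ K] [AddCommGroup M] [Module ℂ M]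

theorem isLeftCoaction_comul :
    IsLeftCoaction (Coalgebra.comul (R := ℂ) (A := K)) where
  coassoc := Coalgebra.coassoc_apply
  counit k := by rw [Coalgebra.rTensor_counit_comul]; simp

/-- `k ↦ k₁ψ(k₂)`. -/
def convRight (ψ : K →ₗ[ℂ] ℂ) : K →ₗ[ℂ] K := rslice ψ ∘ₗ Coalgebra.comul

/-- The convolution consumes the last leg of an iterated coproduct and both coactions of C consume
the first one, so they commute by coassociativity. -/
theorem SourceTarget.rightC_convRight (S : SourceTarget C K) (ψ : K →ₗ[ℂ] ℂ) (k : K) :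
    S.rightC (convRight ψ k) = (convRight ψ).rTensor C (S.rightC k) := by
  have h : (Coalgebra.comul (R := ℂ) (A := K)).rTensor C (S.rightC k) = _ :=
    S.rC_coassoc isLeftCoaction_comul k
  have h2 : ∀ w : (K ⊗[ℂ] C) ⊗[ℂ] K, (rslice ψ).rTensor C (TensorProduct.rightComm ℂ K C K w) =
      rslice ψ w := fun w => by
    refine TensorProduct.induction_on w (by simp) (fun u k => ?_)
      (fun x y hx hy => by simp only [map_add, hx, hy])
    exact TensorProduct.induction_on u (by simp) (fun x y => by simp [TensorProduct.smul_tmul'])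
      (fun x y hx hy => by simp only [map_add, add_tmul, hx, hy])
  rw [convRight, LinearMap.rTensor_comp_apply, h, h2, rslice_rTensor]
  rfl

theorem SourceTarget.leftC_convRight (S : SourceTarget C K) (ψ : K →ₗ[ℂ] ℂ) (k : K) :
    S.leftC (convRight ψ k) = (convRight ψ).lTensor C (S.leftC k) := by
  have h : (Coalgebra.comul (R := ℂ) (A := K)).lTensor C (S.leftC k) = _ :=
    S.lC_coassoc isLeftCoaction_comul k
  have h2 : ∀ w : (C ⊗[ℂ] K) ⊗[ℂ] K, (rslice ψ).lTensor C (TensorProduct.assoc ℂ C K K w) =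
      rslice ψ w := fun w => by
    refine TensorProduct.induction_on w (by simp) (fun u k => ?_)
      (fun x y hx hy => by simp only [map_add, hx, hy])
    exact TensorProduct.induction_on u (by simp) (fun x y => by simp)
      (fun x y hx hy => by simp only [map_add, add_tmul, hx, hy])
  rw [convRight, LinearMap.lTensor_comp_apply, h, h2, rslice_rTensor]
  rfl

/-- `g(h₁φ(α(h₂))) = (g₁φ(β(g₂)))h` on `K □_C K`. -/
theorem LeftBicoalgebroid.mulExt_convRight (H : LeftBicoalgebroid C K) (φ : C →ₗ[ℂ] ℂ)
    {x : K ⊗[ℂ] K} (hx : x ∈ H.KK) :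
    H.mulExt ((convRight (φ ∘ₗ (H.α : K →ₗ[ℂ] C))).lTensor K x) =
      H.mulExt ((convRight (φ ∘ₗ H.β)).rTensor K x) := by
  have h := congrArg (rslice φ) (H.takeuchi ⟨x, hx⟩)
  simp only [rslice_rTensor] at h
  have h1 : ∀ y : K ⊗[ℂ] K, rslice φ ((TensorProduct.assoc ℂ K K C).symm
      (((H.α : K →ₗ[ℂ] C).lTensor K ∘ₗ Coalgebra.comul).lTensor K y)) =
      (convRight (φ ∘ₗ (H.α : K →ₗ[ℂ] C))).lTensor K y := fun y => by
    refine TensorProduct.induction_on y (by simp) (fun g h => ?_)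
      (fun x y hx hy => by simp only [map_add, hx, hy])
    simp only [LinearMap.lTensor_tmul, convRight, LinearMap.comp_apply]
    exact TensorProduct.induction_on (Coalgebra.comul (R := ℂ) h) (by simp) (fun x y => by simp)
      (fun x y hx hy => by simp only [map_add, tmul_add, hx, hy])
  have h2 : ∀ y : K ⊗[ℂ] K, rslice φ (TensorProduct.rightComm ℂ K C K
      ((H.β.lTensor K ∘ₗ Coalgebra.comul).rTensor K y)) =
      (convRight (φ ∘ₗ H.β)).rTensor K y := fun y => by
    refine TensorProduct.induction_on y (by simp) (fun g h => ?_)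
      (fun x y hx hy => by simp only [map_add, hx, hy])
    simp only [LinearMap.rTensor_tmul, convRight, LinearMap.comp_apply]
    exact TensorProduct.induction_on (Coalgebra.comul (R := ℂ) g) (by simp)
      (fun x y => by simp [TensorProduct.smul_tmul'])
      (fun x y hx hy => by simp only [map_add, add_tmul, hx, hy])
  rwa [h1, h2] at h

theorem SourceTarget.rTensor_mem_cotensor (S : SourceTarget C K) {l : M →ₗ[ℂ] C ⊗[ℂ] M}
    {p : K →ₗ[ℂ] K} (hp : ∀ k, S.rightC (p k) = p.rTensor C (S.rightC k)) {z : K ⊗[ℂ] M}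
    (hz : z ∈ cotensor S.rightC l) : p.rTensor M z ∈ cotensor S.rightC l := by
  have hz' : TensorProduct.assoc ℂ K C M (S.rightC.rTensor M z) = l.lTensor K z := hz
  have h1 : ∀ z : K ⊗[ℂ] M, TensorProduct.assoc ℂ K C M (S.rightC.rTensor M (p.rTensor M z)) =
      p.rTensor (C ⊗[ℂ] M) (TensorProduct.assoc ℂ K C M (S.rightC.rTensor M z)) := fun z => by
    refine TensorProduct.induction_on z (by simp) (fun k m => ?_)
      (fun x y hx hy => by simp only [map_add, hx, hy])
    simp only [LinearMap.rTensor_tmul, hp]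
    exact TensorProduct.induction_on (S.rightC k) (by simp) (fun x y => by simp)
      (fun x y hx hy => by simp only [map_add, add_tmul, hx, hy])
  change TensorProduct.assoc ℂ K C M (S.rightC.rTensor M (p.rTensor M z)) =
    l.lTensor K (p.rTensor M z)
  rw [h1, hz', lTensor_rTensor_apply]

theorem IsLeftCoaction.coassoc_map' {E : Type*} [AddCommGroup E] [Module ℂ E]
    {l : M →ₗ[ℂ] C ⊗[ℂ] M} (hl : IsLeftCoaction l) (f : C →ₗ[ℂ] E) (m : M) :
    l.lTensor E (f.rTensor M (l m)) = TensorProduct.assoc ℂ E C M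
      ((f.rTensor C ∘ₗ Coalgebra.comul).rTensor M (l m)) := by
  rw [lTensor_rTensor_apply, ← hl.coassoc]
  refine TensorProduct.induction_on (l m) (by simp) (fun k a => ?_)
    (fun x y hx hy => by simp only [map_add, hx, hy])
  simp only [LinearMap.rTensor_tmul, LinearMap.comp_apply]
  exact TensorProduct.induction_on (Coalgebra.comul (R := ℂ) k) (by simp) (fun x y => by simp)
    (fun x y hx hy => by simp only [map_add, add_tmul, hx, hy])

section Bicolinear

variable {S : SourceTarget C K} {l : M →ₗ[ℂ] C ⊗[ℂ] M} {f : C →ₗ[ℂ] K}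

theorem SourceTarget.coact_mem_cotensor (hl : IsLeftCoaction l)
    (hr : ∀ c, S.rightC (f c) = f.rTensor C (Coalgebra.comul c)) (m : M) :
    f.rTensor M (l m) ∈ cotensor S.rightC l := by
  change TensorProduct.assoc ℂ K C M (S.rightC.rTensor M (f.rTensor M (l m))) =
    l.lTensor K (f.rTensor M (l m))
  rw [hl.coassoc_map', ← LinearMap.rTensor_comp_apply]
  congr 3
  ext c
  exact hr c

theorem SourceTarget.rslice_coact_mem_KK (hl : IsLeftCoaction l)
    (hf : ∀ c, S.leftC (f c) = f.lTensor C (Coalgebra.comul c)) {z : K ⊗[ℂ] M}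
    (hz : z ∈ cotensor S.rightC l) (φ : M →ₗ[ℂ] ℂ) :
    rslice φ ((TensorProduct.assoc ℂ K K M).symm ((f.rTensor M ∘ₗ l).lTensor K z)) ∈ S.KK := by
  refine rslice_mem_eqLocus ?_ φ
  have hz' : TensorProduct.assoc ℂ K C M (S.rightC.rTensor M z) = l.lTensor K z := hz
  let F : K ⊗[ℂ] (C ⊗[ℂ] M) →ₗ[ℂ] (K ⊗[ℂ] (C ⊗[ℂ] K)) ⊗[ℂ] M :=
    (TensorProduct.assoc ℂ K (C ⊗[ℂ] K) M).symm.toLinearMap ∘ₗ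
      ((TensorProduct.assoc ℂ C K M).symm.toLinearMap ∘ₗ (f.rTensor M ∘ₗ l).lTensor C).lTensor K
  have h1 : ∀ z : K ⊗[ℂ] M, ((TensorProduct.assoc ℂ K C K).toLinearMap ∘ₗ
      S.rightC.rTensor K).rTensor M
      ((TensorProduct.assoc ℂ K K M).symm ((f.rTensor M ∘ₗ l).lTensor K z)) =
      F (TensorProduct.assoc ℂ K C M (S.rightC.rTensor M z)) := fun z => by
    refine TensorProduct.induction_on z (by simp) (fun k m => ?_)
      (fun x y hx hy => by simp only [map_add, hx, hy])
    simp only [LinearMap.rTensor_tmul, LinearMap.lTensor_tmul]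
    have h2 : ∀ u : K ⊗[ℂ] C, F (TensorProduct.assoc ℂ K C M (u ⊗ₜ m)) =
        (TensorProduct.assoc ℂ K C K).toLinearMap.rTensor M
          ((TensorProduct.assoc ℂ (K ⊗[ℂ] C) K M).symm (u ⊗ₜ (f.rTensor M ∘ₗ l) m)) := fun u => by
      refine TensorProduct.induction_on u (by simp) (fun k c => ?_)
        (fun x y hx hy => by simp only [map_add, add_tmul, hx, hy])
      simp only [F, LinearMap.comp_apply, TensorProduct.assoc_tmul, LinearMap.lTensor_tmul]
      exact TensorProduct.induction_on (f.rTensor M (l m)) (by simp) (fun x y => by simp)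
        (fun x y hx hy => by simp only [map_add, tmul_add, hx, hy])
    rw [h2]
    exact TensorProduct.induction_on ((f.rTensor M ∘ₗ l) m) (by simp) (fun x y => by simp)
      (fun x y hx hy => by simp only [map_add, tmul_add, hx, hy])
  have h3 : ∀ z : K ⊗[ℂ] M, (S.leftC.lTensor K).rTensor M
      ((TensorProduct.assoc ℂ K K M).symm ((f.rTensor M ∘ₗ l).lTensor K z)) =
      F (l.lTensor K z) := fun z => by
    refine TensorProduct.induction_on z (by simp) (fun k m => ?_)
      (fun x y hx hy => by simp only [map_add, hx, hy])
    simp only [F, LinearMap.lTensor_tmul, LinearMap.comp_apply, LinearEquiv.coe_coe]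
    rw [hl.coassoc_map, LinearEquiv.symm_apply_apply]
    have hfe : f.lTensor C ∘ₗ Coalgebra.comul = S.leftC ∘ₗ f := by
      ext c; exact (hf c).symm
    rw [hfe, LinearMap.rTensor_comp_apply]
    exact TensorProduct.induction_on ((f.rTensor M ∘ₗ l) m) (by simp) (fun x y => by simp)
      (fun x y hx hy => by simp only [map_add, tmul_add, hx, hy])
  rw [h1, h3, hz']

/-- Makes associativity of the action applicable to k▷(f(m₋₁)▷m₀), both for f = η and for η followed
by a convolution. -/
theorem SourceTarget.coact_mem_triple (hl : IsLeftCoaction l)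
    (hr : ∀ c, S.rightC (f c) = f.rTensor C (Coalgebra.comul c))
    (hf : ∀ c, S.leftC (f c) = f.lTensor C (Coalgebra.comul c)) {z : K ⊗[ℂ] M}
    (hz : z ∈ cotensor S.rightC l) : (f.rTensor M ∘ₗ l).lTensor K z ∈ S.triple l :=
  ⟨(mem_range_lTensor_iff _ _).2 fun φ => by
      rw [lslice_lTensor]; exact S.coact_mem_cotensor hl hr _,
    (mem_range_rTensor_iff _ _).2 (S.rslice_coact_mem_KK hl hf hz)⟩

end Bicolinear

/-- `k₁φ(β(k₂))▷m = k▷(m₀φ(m₁))` for the canonical right coaction `m ↦ m₀ ⊗ m₁` of `C` on `M`. -/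
theorem LeftModule.actExt_convRight {H : LeftBicoalgebroid C K} (N : LeftModule H M)
    (φ : C →ₗ[ℂ] ℂ) {z : K ⊗[ℂ] M} (hz : z ∈ cotensor H.rightC N.coactC) :
    N.actExt ((convRight (φ ∘ₗ H.β)).rTensor M z) =
      N.actExt ((rslice φ ∘ₗ N.canonicalRightC).lTensor K z) := by
  have hl := N.coactC_isLeftCoaction
  let a : K →ₗ[ℂ] K := convRight (φ ∘ₗ (H.α : K →ₗ[ℂ] C))
  -- The canonical coaction sliced by φ is itself an action: m ↦ a(η(m₋₁))▷m₀ with a the convolution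
  -- by φ ∘ α.
  have hcan : rslice φ ∘ₗ N.canonicalRightC = N.actExt ∘ₗ (a ∘ₗ H.η).rTensor M ∘ₗ N.coactC := by
    ext m
    simp only [LinearMap.comp_apply, LeftModule.canonicalRightC]
    refine TensorProduct.induction_on (N.coactC m) (by simp) (fun c m => ?_)
      (fun x y hx hy => by simp only [map_add, hx, hy])
    simp only [LinearMap.rTensor_tmul, LinearMap.comp_apply, a, convRight, LinearEquiv.coe_coe]
    exact TensorProduct.induction_on (Coalgebra.comul (R := ℂ) (H.η c)) (by simp)
      (fun x y => by simp [← TensorProduct.smul_tmul'])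
      (fun x y hx hy => by simp only [map_add, add_tmul, hx, hy])
  have hηr : ∀ c, H.rightC (H.η c) = H.η.rTensor C (Coalgebra.comul c) := H.η_rightC
  have hηl : ∀ c, H.leftC (H.η c) = H.η.lTensor C (Coalgebra.comul c) := H.η_leftC
  have har : ∀ c, H.rightC ((a ∘ₗ H.η) c) = (a ∘ₗ H.η).rTensor C (Coalgebra.comul c) := fun c => by
    rw [LinearMap.comp_apply, H.rightC_convRight, hηr, LinearMap.rTensor_comp_apply]
  have hal : ∀ c, H.leftC ((a ∘ₗ H.η) c) = (a ∘ₗ H.η).lTensor C (Coalgebra.comul c) := fun c => by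
    rw [LinearMap.comp_apply, H.leftC_convRight, hηl, LinearMap.lTensor_comp_apply]
  have hz2 := H.rTensor_mem_cotensor (fun k => H.rightC_convRight (φ ∘ₗ H.β) k) hz
  have hone : N.actExt ∘ₗ H.η.rTensor M ∘ₗ N.coactC = LinearMap.id := by
    ext m; exact N.one_act m
  have h1 := N.mul_act _ (H.coact_mem_triple hl har hal hz)
  have h2 := N.mul_act _ (H.coact_mem_triple hl hηr hηl hz2)
  rw [← LinearMap.lTensor_comp_apply, hone, LinearMap.lTensor_id, LinearMap.id_apply] at h2
  rw [← LinearMap.lTensor_comp_apply] at h1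
  rw [hcan, h1, h2]
  -- After unit and associativity both sides are products of k with η(m₋₁) acting on m₀. The sliced
  -- Takeuchi axiom moves the convolution from η(m₋₁), where it is by φ ∘ α, to k, where it is by φ
  -- ∘ β.
  have h3 := rTensor_eqOn (P := H.KK) (f := H.mulExt ∘ₗ a.lTensor K)
    (g := H.mulExt ∘ₗ (convRight (φ ∘ₗ H.β)).rTensor K) (fun e he => H.mulExt_convRight φ he)
    (H.rslice_coact_mem_KK hl hηl hz)
  rw [LinearMap.rTensor_comp_apply, LinearMap.rTensor_comp_apply] at h3
  have h4 : ∀ z : K ⊗[ℂ] M, (TensorProduct.assoc ℂ K K M).symm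
      (((a ∘ₗ H.η).rTensor M ∘ₗ N.coactC).lTensor K z) = (a.lTensor K).rTensor M
      ((TensorProduct.assoc ℂ K K M).symm ((H.η.rTensor M ∘ₗ N.coactC).lTensor K z)) := fun z => by
    refine TensorProduct.induction_on z (by simp) (fun k m => ?_)
      (fun x y hx hy => by simp only [map_add, hx, hy])
    simp only [LinearMap.lTensor_tmul, LinearMap.comp_apply, LinearMap.rTensor_comp_apply]
    exact TensorProduct.induction_on (H.η.rTensor M (N.coactC m)) (by simp) (fun x y => by simp)
      (fun x y hx hy => by simp only [map_add, tmul_add, hx, hy])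
  have h5 : ∀ z : K ⊗[ℂ] M, (TensorProduct.assoc ℂ K K M).symm
      ((H.η.rTensor M ∘ₗ N.coactC).lTensor K ((convRight (φ ∘ₗ H.β)).rTensor M z)) =
      ((convRight (φ ∘ₗ H.β)).rTensor K).rTensor M
      ((TensorProduct.assoc ℂ K K M).symm ((H.η.rTensor M ∘ₗ N.coactC).lTensor K z)) := fun z => by
    refine TensorProduct.induction_on z (by simp) (fun k m => ?_)
      (fun x y hx hy => by simp only [map_add, hx, hy])
    simp only [LinearMap.lTensor_tmul, LinearMap.rTensor_tmul, LinearMap.comp_apply]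
    exact TensorProduct.induction_on (H.η.rTensor M (N.coactC m)) (by simp) (fun x y => by simp)
      (fun x y hx hy => by simp only [map_add, tmul_add, hx, hy])
  rw [h4, h5, h3]

end CanonicalCoaction

/-! ### The block rotation and its well-definedness. -/

section PreRotation

variable {K A B M E F : Type*} [AddCommGroup K] [Module ℂ K]
  [AddCommGroup A] [Module ℂ A] [AddCommGroup B] [Module ℂ B] [AddCommGroup M] [Module ℂ M]
  [AddCommGroup E] [Module ℂ E] [AddCommGroup F] [Module ℂ F]

/-- `m ⊗ (a ⊗ b) ↦ (b₋₁ ⊗ m) ⊗ (b₀ ⊗ a)`. -/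
def preRot (M A : Type*) [AddCommGroup M] [Module ℂ M] [AddCommGroup A] [Module ℂ A]
    (ρB : B →ₗ[ℂ] K ⊗[ℂ] B) : M ⊗[ℂ] (A ⊗[ℂ] B) →ₗ[ℂ] (K ⊗[ℂ] M) ⊗[ℂ] (B ⊗[ℂ] A) :=
  (TensorProduct.comm ℂ M K).toLinearMap.rTensor (B ⊗[ℂ] A) ∘ₗ
    (TensorProduct.assoc ℂ M K (B ⊗[ℂ] A)).symm.toLinearMap ∘ₗ
    ((TensorProduct.assoc ℂ K B A).toLinearMap ∘ₗ ρB.rTensor A ∘ₗ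
      (TensorProduct.comm ℂ A B).toLinearMap).lTensor M

/-- `m ⊗ (a ⊗ b) ↦ b₋₁▷m ⊗ (b₀ ⊗ a)`. -/
def rot (A : Type*) [AddCommGroup A] [Module ℂ A] (act : K ⊗[ℂ] M →ₗ[ℂ] M)
    (ρB : B →ₗ[ℂ] K ⊗[ℂ] B) : M ⊗[ℂ] (A ⊗[ℂ] B) →ₗ[ℂ] M ⊗[ℂ] (B ⊗[ℂ] A) :=
  act.rTensor (B ⊗[ℂ] A) ∘ₗ preRot M A ρB

/-- `k ⊗ b ↦ (k ⊗ m) ⊗ (b ⊗ a)`. -/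
def insertMid (m : M) (a : A) : K ⊗[ℂ] B →ₗ[ℂ] (K ⊗[ℂ] M) ⊗[ℂ] (B ⊗[ℂ] A) :=
  TensorProduct.map ((TensorProduct.mk ℂ K M).flip m) ((TensorProduct.mk ℂ B A).flip a)

@[simp] theorem insertMid_tmul (m : M) (a : A) (k : K) (b : B) :
    insertMid m a (k ⊗ₜ[ℂ] b) = (k ⊗ₜ m) ⊗ₜ (b ⊗ₜ a) := rfl

theorem preRot_tmul (ρB : B →ₗ[ℂ] K ⊗[ℂ] B) (m : M) (a : A) (b : B) :
    preRot M A ρB (m ⊗ₜ (a ⊗ₜ b)) = insertMid m a (ρB b) := by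
  simp only [preRot, LinearMap.comp_apply, LinearMap.lTensor_tmul, TensorProduct.comm_tmul,
    LinearEquiv.coe_coe, LinearMap.rTensor_tmul]
  exact TensorProduct.induction_on (ρB b) (by simp) (fun x y => by simp)
    (fun x y hx hy => by simp only [map_add, add_tmul, tmul_add, hx, hy])

theorem tensor_ext₃ {f g : M ⊗[ℂ] (A ⊗[ℂ] B) →ₗ[ℂ] E}
    (h : ∀ m a b, f (m ⊗ₜ (a ⊗ₜ b)) = g (m ⊗ₜ (a ⊗ₜ b))) (x : M ⊗[ℂ] (A ⊗[ℂ] B)) : f x = g x := by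
  congr 1
  ext m a b
  exact h m a b

theorem rTensor_preRot (f : M →ₗ[ℂ] E) (ρB : B →ₗ[ℂ] K ⊗[ℂ] B) (x : M ⊗[ℂ] (A ⊗[ℂ] B)) :
    (f.lTensor K).rTensor (B ⊗[ℂ] A) (preRot M A ρB x) = preRot E A ρB (f.rTensor (A ⊗[ℂ] B) x) := by
  refine tensor_ext₃ (f := (f.lTensor K).rTensor (B ⊗[ℂ] A) ∘ₗ preRot M A ρB)
    (g := preRot E A ρB ∘ₗ f.rTensor (A ⊗[ℂ] B)) (fun m a b => ?_) x
  simp only [LinearMap.comp_apply, LinearMap.rTensor_tmul, preRot_tmul]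
  exact TensorProduct.induction_on (ρB b) (by simp) (fun x y => by simp)
    (fun x y hx hy => by simp only [map_add, hx, hy])

end PreRotation

section Cochain

variable {C K A B M : Type*} [AddCommGroup C] [Module ℂ C] [Coalgebra ℂ C]
  [AddCommGroup K] [Module ℂ K] [Coalgebra ℂ K]
  [AddCommGroup A] [Module ℂ A] [AddCommGroup B] [Module ℂ B] [AddCommGroup M] [Module ℂ M]
  {H : LeftHopfCoalgebra C K}

/-- The elements of `M □_K (A □_C B)`. -/
structure LeftRightSAYD.IsCochain (N : LeftRightSAYD H M) (ρA : A →ₗ[ℂ] K ⊗[ℂ] A)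
    (ρB : B →ₗ[ℂ] K ⊗[ℂ] B) (x : M ⊗[ℂ] (A ⊗[ℂ] B)) : Prop where
  mem_box : ∀ φ : M →ₗ[ℂ] ℂ, lslice φ x ∈ H.box ρA ρB
  coact_eq : TensorProduct.assoc ℂ M K (A ⊗[ℂ] B) (N.coact.rTensor (A ⊗[ℂ] B) x) =
    (H.prodCoact ρA ρB).lTensor M x

variable {N : LeftRightSAYD H M} {ρA : A →ₗ[ℂ] K ⊗[ℂ] A} {ρB : B →ₗ[ℂ] K ⊗[ℂ] B}
  {x : M ⊗[ℂ] (A ⊗[ℂ] B)}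

/-- `m ⊗ (a ⊗ (b ⊗ c)) ↦ (c ⊗ m) ⊗ (a ⊗ b)`. -/
def lastToFront (M A B C : Type*) [AddCommGroup M] [Module ℂ M] [AddCommGroup A] [Module ℂ A]
    [AddCommGroup B] [Module ℂ B] [AddCommGroup C] [Module ℂ C] :
    M ⊗[ℂ] (A ⊗[ℂ] (B ⊗[ℂ] C)) →ₗ[ℂ] (C ⊗[ℂ] M) ⊗[ℂ] (A ⊗[ℂ] B) :=
  (TensorProduct.comm ℂ M C).toLinearMap.rTensor (A ⊗[ℂ] B) ∘ₗ
    (TensorProduct.assoc ℂ M C (A ⊗[ℂ] B)).symm.toLinearMap ∘ₗ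
    ((TensorProduct.comm ℂ (A ⊗[ℂ] B) C).toLinearMap ∘ₗ
      (TensorProduct.assoc ℂ A B C).symm.toLinearMap).lTensor M

/-- `m₋₁ ⊗ m₀ ⊗ a ⊗ b = β(b₋₁) ⊗ m ⊗ a ⊗ b₀`. -/
theorem LeftRightSAYD.IsCochain.coactC_eq (hx : N.IsCochain ρA ρB x)
    (hA : IsLeftCoaction ρA) (hB : IsLeftCoaction ρB) :
    N.coactC.rTensor (A ⊗[ℂ] B) x =
      lastToFront M A B C (((H.rC ρB).lTensor A).lTensor M x) := by
  let P : M ⊗[ℂ] (C ⊗[ℂ] (A ⊗[ℂ] B)) →ₗ[ℂ] (C ⊗[ℂ] M) ⊗[ℂ] (A ⊗[ℂ] B) :=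
    (TensorProduct.comm ℂ M C).toLinearMap.rTensor (A ⊗[ℂ] B) ∘ₗ
    (TensorProduct.assoc ℂ M C (A ⊗[ℂ] B)).symm.toLinearMap
  have h1 : ∀ x : M ⊗[ℂ] (A ⊗[ℂ] B), N.coactC.rTensor (A ⊗[ℂ] B) x =
      P ((H.β.rTensor (A ⊗[ℂ] B)).lTensor M
        (TensorProduct.assoc ℂ M K (A ⊗[ℂ] B) (N.coact.rTensor (A ⊗[ℂ] B) x))) := fun x => by
    refine TensorProduct.induction_on x (by simp) (fun m v => ?_)
      (fun x y hx hy => by simp only [map_add, hx, hy])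
    simp only [LinearMap.rTensor_tmul, N.leftC_eq]
    exact TensorProduct.induction_on (N.coact m) (by simp) (fun x y => by simp [P])
      (fun x y hx hy => by simp only [map_add, add_tmul, hx, hy])
  -- The left coaction of C on M is β(m₁), and m₁ = a₋₁b₋₁ for a cochain; on A □_C B the map β sees
  -- only b₋₁.
  rw [h1, hx.coact_eq, ← LinearMap.lTensor_comp_apply,
    lTensor_eqOn (P := H.box ρA ρB) (g := (TensorProduct.leftComm ℂ A C B).toLinearMap ∘ₗ
      (H.leftβ ρB).lTensor A) (fun e he => H.leftβ_prodCoact hA hB he) hx.mem_box]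
  refine tensor_ext₃ (f := P ∘ₗ LinearMap.lTensor M ((TensorProduct.leftComm ℂ A C B).toLinearMap ∘ₗ
      (H.leftβ ρB).lTensor A))
    (g := lastToFront M A B C ∘ₗ ((H.rC ρB).lTensor A).lTensor M) (fun m a b => ?_) x
  simp only [LinearMap.comp_apply, LinearMap.lTensor_tmul, LinearEquiv.coe_coe, ← H.comm_leftβ]
  exact TensorProduct.induction_on (H.leftβ ρB b) (by simp) (fun x y => by simp [P, lastToFront])
    (fun x y hx hy => by simp only [map_add, tmul_add, hx, hy])

/-- `m₀ ⊗ α(m₁) ⊗ a ⊗ b = m ⊗ α(a₋₁) ⊗ a₀ ⊗ b`. -/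
theorem LeftRightSAYD.IsCochain.target_eq (hx : N.IsCochain ρA ρB x)
    (hA : IsLeftCoaction ρA) (hB : IsLeftCoaction ρB) :
    TensorProduct.assoc ℂ M C (A ⊗[ℂ] B)
      (((H.α : K →ₗ[ℂ] C).lTensor M ∘ₗ N.coact).rTensor (A ⊗[ℂ] B) x) =
      ((TensorProduct.assoc ℂ C A B).toLinearMap ∘ₗ (H.lC ρA).rTensor B).lTensor M x := by
  have h1 : ∀ x : M ⊗[ℂ] (A ⊗[ℂ] B), TensorProduct.assoc ℂ M C (A ⊗[ℂ] B)
      (((H.α : K →ₗ[ℂ] C).lTensor M ∘ₗ N.coact).rTensor (A ⊗[ℂ] B) x) =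
      ((H.α : K →ₗ[ℂ] C).rTensor (A ⊗[ℂ] B)).lTensor M
        (TensorProduct.assoc ℂ M K (A ⊗[ℂ] B) (N.coact.rTensor (A ⊗[ℂ] B) x)) := fun x => by
    refine TensorProduct.induction_on x (by simp) (fun m v => ?_)
      (fun x y hx hy => by simp only [map_add, hx, hy])
    simp only [LinearMap.rTensor_tmul, LinearMap.comp_apply]
    exact TensorProduct.induction_on (N.coact m) (by simp) (fun x y => by simp)
      (fun x y hx hy => by simp only [map_add, add_tmul, hx, hy])
  rw [h1, hx.coact_eq, ← LinearMap.lTensor_comp_apply,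
    lTensor_eqOn (P := H.box ρA ρB) (g := (TensorProduct.assoc ℂ C A B).toLinearMap ∘ₗ
      (H.lC ρA).rTensor B) (fun e he => H.lC_prodCoact hA hB he) hx.mem_box]

/-- `b₋₁ ⊗ m ⊗ b₀ ⊗ a` lies in `K □_C M ⊗ B ⊗ A`. -/
theorem LeftRightSAYD.IsCochain.preRot_balanced (hx : N.IsCochain ρA ρB x)
    (hA : IsLeftCoaction ρA) (hB : IsLeftCoaction ρB) :
    ((TensorProduct.assoc ℂ K C M).toLinearMap ∘ₗ H.rightC.rTensor M).rTensor (B ⊗[ℂ] A)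
      (preRot M A ρB x) = (N.coactC.lTensor K).rTensor (B ⊗[ℂ] A) (preRot M A ρB x) := by
  -- The coaction on m is traded for β of a leg of b, which `rC_coassoc` then identifies with the
  -- right coaction on b₋₁.
  rw [rTensor_preRot, hx.coactC_eq hA hB]
  refine tensor_ext₃ (f := ((TensorProduct.assoc ℂ K C M).toLinearMap ∘ₗ
      H.rightC.rTensor M).rTensor (B ⊗[ℂ] A) ∘ₗ preRot M A ρB)
    (g := preRot (C ⊗[ℂ] M) A ρB ∘ₗ lastToFront M A B C ∘ₗ ((H.rC ρB).lTensor A).lTensor M)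
    (fun m a b => ?_) x
  let P : (K ⊗[ℂ] B) ⊗[ℂ] C →ₗ[ℂ] (K ⊗[ℂ] (C ⊗[ℂ] M)) ⊗[ℂ] (B ⊗[ℂ] A) :=
    (TensorProduct.tensorTensorTensorComm ℂ K B (C ⊗[ℂ] M) A).toLinearMap ∘ₗ
      ((TensorProduct.mk ℂ (C ⊗[ℂ] M) A).flip a ∘ₗ (TensorProduct.mk ℂ C M).flip m).lTensor _
  have h1 : ∀ r : B ⊗[ℂ] C, preRot (C ⊗[ℂ] M) A ρB (lastToFront M A B C (m ⊗ₜ (a ⊗ₜ r))) =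
      P (ρB.rTensor C r) := fun r => by
    refine TensorProduct.induction_on r (by simp) (fun b c => ?_)
      (fun x y hx hy => by simp only [map_add, tmul_add, hx, hy])
    have h2 : lastToFront M A B C (m ⊗ₜ (a ⊗ₜ (b ⊗ₜ c))) = (c ⊗ₜ m) ⊗ₜ (a ⊗ₜ b) := by
      simp [lastToFront]
    rw [h2, preRot_tmul, LinearMap.rTensor_tmul]
    exact TensorProduct.induction_on (ρB b) (by simp) (fun x y => by simp [P])
      (fun x y hx hy => by simp only [map_add, add_tmul, hx, hy])
  simp only [LinearMap.comp_apply, LinearMap.lTensor_tmul, preRot_tmul]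
  rw [h1, H.rC_coassoc hB]
  refine TensorProduct.induction_on (ρB b) (by simp) (fun k b => ?_)
    (fun x y hx hy => by simp only [map_add, hx, hy])
  simp only [insertMid_tmul, LinearMap.rTensor_tmul, LinearMap.comp_apply]
  exact TensorProduct.induction_on (H.rightC k) (by simp) (fun x y => by simp [P])
    (fun x y hx hy => by simp only [map_add, add_tmul, hx, hy])

theorem LeftRightSAYD.IsCochain.rslice_preRot_mem (hx : N.IsCochain ρA ρB x)
    (hA : IsLeftCoaction ρA) (hB : IsLeftCoaction ρB) (φ : B ⊗[ℂ] A →ₗ[ℂ] ℂ) :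
    rslice φ (preRot M A ρB x) ∈ cotensor H.rightC N.coactC :=
  rslice_mem_eqLocus (hx.preRot_balanced hA hB) φ

end Cochain

section Rotation

variable {C K A B M : Type*} [AddCommGroup C] [Module ℂ C] [Coalgebra ℂ C]
  [AddCommGroup K] [Module ℂ K] [Coalgebra ℂ K]
  [AddCommGroup A] [Module ℂ A] [AddCommGroup B] [Module ℂ B] [AddCommGroup M] [Module ℂ M]
  {H : LeftHopfCoalgebra C K}
  {N : LeftRightSAYD H M} {ρA : A →ₗ[ℂ] K ⊗[ℂ] A} {ρB : B →ₗ[ℂ] K ⊗[ℂ] B}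
  {x : M ⊗[ℂ] (A ⊗[ℂ] B)}

/-- `k₁▷m ⊗ β(k₂) = k▷m₀ ⊗ α(m₁)` on `K □_C M`. -/
theorem LeftRightSAYD.act_takeuchi (N : LeftRightSAYD H M) {z : K ⊗[ℂ] M}
    (hz : z ∈ cotensor H.rightC N.coactC) :
    N.actExt.rTensor C (TensorProduct.rightComm ℂ K C M
      ((H.β.lTensor K ∘ₗ Coalgebra.comul).rTensor M z)) =
    N.actExt.rTensor C ((TensorProduct.assoc ℂ K M C).symm
      (((H.α : K →ₗ[ℂ] C).lTensor M ∘ₗ N.coact).lTensor K z)) := by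
  have hcan : (H.α : K →ₗ[ℂ] C).lTensor M ∘ₗ N.coact = N.canonicalRightC := by
    ext m; exact N.rightC_eq m
  rw [hcan]
  -- Sliced by φ, the identity is `actExt_convRight`; the right coaction is the canonical one by the
  -- SAYD axioms.
  refine rslice_ext fun φ => ?_
  rw [rslice_rTensor, rslice_rTensor]
  have h1 : ∀ z : K ⊗[ℂ] M, rslice φ (TensorProduct.rightComm ℂ K C M
      ((H.β.lTensor K ∘ₗ Coalgebra.comul).rTensor M z)) =
      (convRight (φ ∘ₗ H.β)).rTensor M z := fun z => by
    refine TensorProduct.induction_on z (by simp) (fun k m => ?_)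
      (fun x y hx hy => by simp only [map_add, hx, hy])
    simp only [LinearMap.rTensor_tmul, convRight, LinearMap.comp_apply]
    exact TensorProduct.induction_on (Coalgebra.comul (R := ℂ) k) (by simp)
      (fun x y => by simp [TensorProduct.smul_tmul'])
      (fun x y hx hy => by simp only [map_add, add_tmul, hx, hy])
  have h2 : ∀ z : K ⊗[ℂ] M, rslice φ ((TensorProduct.assoc ℂ K M C).symm
      (N.canonicalRightC.lTensor K z)) = (rslice φ ∘ₗ N.canonicalRightC).lTensor K z := fun z => by
    refine TensorProduct.induction_on z (by simp) (fun k m => ?_)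
      (fun x y hx hy => by simp only [map_add, hx, hy])
    simp only [LinearMap.lTensor_tmul, LinearMap.comp_apply]
    exact TensorProduct.induction_on (N.canonicalRightC m) (by simp)
      (fun x y => by simp)
      (fun x y hx hy => by simp only [map_add, tmul_add, hx, hy])
  rw [h1, h2]
  exact N.toLeftModule.actExt_convRight φ hz

/-- Both coactions of C are moved onto the module with k = b₋₁. Coassociativity turns the one on b₀
into k₁▷m ⊗ β(k₂), `target_eq` turns the one on a into k▷m₀ ⊗ α(m₁), and `act_takeuchi` identifies
them. -/
theorem LeftRightSAYD.IsCochain.rot_mem_box (hx : N.IsCochain ρA ρB x)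
    (hA : IsLeftCoaction ρA) (hB : IsLeftCoaction ρB) (φ : M →ₗ[ℂ] ℂ) :
    lslice φ (rot A N.actExt ρB x) ∈ H.box ρB ρA := by
  refine lslice_mem_eqLocus ?_ φ
  let Ω : (M ⊗[ℂ] C) ⊗[ℂ] (B ⊗[ℂ] A) →ₗ[ℂ] M ⊗[ℂ] (B ⊗[ℂ] (C ⊗[ℂ] A)) :=
    (TensorProduct.leftComm ℂ C B A).toLinearMap.lTensor M ∘ₗ
      (TensorProduct.assoc ℂ M C (B ⊗[ℂ] A)).toLinearMap
  let TR : K ⊗[ℂ] M →ₗ[ℂ] M ⊗[ℂ] C := N.actExt.rTensor C ∘ₗ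
    (TensorProduct.rightComm ℂ K C M).toLinearMap ∘ₗ
    (H.β.lTensor K ∘ₗ Coalgebra.comul).rTensor M
  let TL : K ⊗[ℂ] M →ₗ[ℂ] M ⊗[ℂ] C := N.actExt.rTensor C ∘ₗ
    (TensorProduct.assoc ℂ K M C).symm.toLinearMap ∘ₗ
    ((H.α : K →ₗ[ℂ] C).lTensor M ∘ₗ N.coact).lTensor K
  have hT : TR.rTensor (B ⊗[ℂ] A) (preRot M A ρB x) = TL.rTensor (B ⊗[ℂ] A) (preRot M A ρB x) :=
    rTensor_eqOn (P := cotensor H.rightC N.coactC) (fun e he => N.act_takeuchi he)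
      (hx.rslice_preRot_mem hA hB)
  have hL : ((TensorProduct.assoc ℂ B C A).toLinearMap ∘ₗ (H.rC ρB).rTensor A).lTensor M
      (rot A N.actExt ρB x) = Ω (TR.rTensor (B ⊗[ℂ] A) (preRot M A ρB x)) := by
    refine tensor_ext₃ (f := ((TensorProduct.assoc ℂ B C A).toLinearMap ∘ₗ
      (H.rC ρB).rTensor A).lTensor M ∘ₗ rot A N.actExt ρB)
      (g := Ω ∘ₗ TR.rTensor (B ⊗[ℂ] A) ∘ₗ preRot M A ρB) (fun m a b => ?_) x
    simp only [LinearMap.comp_apply, rot, preRot_tmul]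
    let P : K ⊗[ℂ] (C ⊗[ℂ] B) →ₗ[ℂ] M ⊗[ℂ] (B ⊗[ℂ] (C ⊗[ℂ] A)) :=
      TensorProduct.map (N.actExt ∘ₗ (TensorProduct.mk ℂ K M).flip m)
        ((TensorProduct.leftComm ℂ C B A).toLinearMap ∘ₗ (TensorProduct.assoc ℂ C B A).toLinearMap ∘ₗ
          (TensorProduct.mk ℂ (C ⊗[ℂ] B) A).flip a)
    have h1 : ∀ u : K ⊗[ℂ] B, ((TensorProduct.assoc ℂ B C A).toLinearMap ∘ₗ
        (H.rC ρB).rTensor A).lTensor M (N.actExt.rTensor (B ⊗[ℂ] A) (insertMid m a u)) =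
        P ((H.leftβ ρB).lTensor K u) := fun u => by
      refine TensorProduct.induction_on u (by simp) (fun k b => ?_)
        (fun x y hx hy => by simp only [map_add, hx, hy])
      simp only [insertMid_tmul, LinearMap.rTensor_tmul, LinearMap.lTensor_tmul,
        LinearMap.comp_apply, LinearEquiv.coe_coe, ← H.comm_leftβ]
      exact TensorProduct.induction_on (H.leftβ ρB b) (by simp) (fun x y => by simp [P])
        (fun x y hx hy => by simp only [map_add, tmul_add, add_tmul, hx, hy])
    have h2 : ∀ u : K ⊗[ℂ] B, Ω (TR.rTensor (B ⊗[ℂ] A) (insertMid m a u)) =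
        P (TensorProduct.assoc ℂ K C B ((H.β.lTensor K ∘ₗ Coalgebra.comul).rTensor B u)) :=
        fun u => by
      refine TensorProduct.induction_on u (by simp) (fun k b => ?_)
        (fun x y hx hy => by simp only [map_add, hx, hy])
      simp only [TR, insertMid_tmul, LinearMap.rTensor_tmul, LinearMap.comp_apply,
        LinearEquiv.coe_coe]
      exact TensorProduct.induction_on (Coalgebra.comul (R := ℂ) k) (by simp)
        (fun x y => by simp [P, Ω])
        (fun x y hx hy => by simp only [map_add, add_tmul, hx, hy])
    rw [h1, h2, ← hB.coassoc_map]
    rfl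
  have hR : ((H.lC ρA).lTensor B).lTensor M (rot A N.actExt ρB x) =
      Ω (TL.rTensor (B ⊗[ℂ] A) (preRot M A ρB x)) := by
    have h1 : TL.rTensor (B ⊗[ℂ] A) (preRot M A ρB x) =
        (N.actExt.rTensor C ∘ₗ (TensorProduct.assoc ℂ K M C).symm.toLinearMap).rTensor (B ⊗[ℂ] A)
        (preRot (M ⊗[ℂ] C) A ρB ((TensorProduct.assoc ℂ M C (A ⊗[ℂ] B)).symm
          (((TensorProduct.assoc ℂ C A B).toLinearMap ∘ₗ (H.lC ρA).rTensor B).lTensor M x))) := by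
      rw [← hx.target_eq hA hB, LinearEquiv.symm_apply_apply, ← rTensor_preRot,
        ← LinearMap.rTensor_comp_apply]
      rfl
    rw [h1]
    refine tensor_ext₃ (f := ((H.lC ρA).lTensor B).lTensor M ∘ₗ rot A N.actExt ρB)
      (g := Ω ∘ₗ (N.actExt.rTensor C ∘ₗ
        (TensorProduct.assoc ℂ K M C).symm.toLinearMap).rTensor (B ⊗[ℂ] A) ∘ₗ
        preRot (M ⊗[ℂ] C) A ρB ∘ₗ (TensorProduct.assoc ℂ M C (A ⊗[ℂ] B)).symm.toLinearMap ∘ₗ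
        ((TensorProduct.assoc ℂ C A B).toLinearMap ∘ₗ (H.lC ρA).rTensor B).lTensor M)
      (fun m a b => ?_) x
    simp only [LinearMap.comp_apply, rot, preRot_tmul, LinearMap.lTensor_tmul,
      LinearMap.rTensor_tmul, LinearEquiv.coe_coe]
    have h2 : ∀ r : C ⊗[ℂ] A, Ω ((N.actExt.rTensor C ∘ₗ
        (TensorProduct.assoc ℂ K M C).symm.toLinearMap).rTensor (B ⊗[ℂ] A)
        (preRot (M ⊗[ℂ] C) A ρB ((TensorProduct.assoc ℂ M C (A ⊗[ℂ] B)).symm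
          (m ⊗ₜ TensorProduct.assoc ℂ C A B (r ⊗ₜ b))))) =
        TensorProduct.map (N.actExt ∘ₗ (TensorProduct.mk ℂ K M).flip m)
          ((TensorProduct.mk ℂ B (C ⊗[ℂ] A)).flip r) (ρB b) := fun r => by
      refine TensorProduct.induction_on r (by simp) (fun c a => ?_)
        (fun x y hx hy => by
          simp only [map_add, tmul_add, add_tmul, hx, hy, TensorProduct.map_add_right,
            LinearMap.add_apply])
      simp only [TensorProduct.assoc_tmul, TensorProduct.assoc_symm_tmul, preRot_tmul]
      exact TensorProduct.induction_on (ρB b) (by simp) (fun x y => by simp [Ω])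
        (fun x y hx hy => by simp only [map_add, hx, hy])
    rw [h2]
    exact TensorProduct.induction_on (ρB b) (by simp) (fun x y => by simp)
      (fun x y hx hy => by simp only [map_add, hx, hy])
  rw [hL, hR, hT]

end Rotation

section SplitLast

variable {K A B M E F : Type*} [AddCommGroup K] [Module ℂ K]
  [AddCommGroup A] [Module ℂ A] [AddCommGroup B] [Module ℂ B] [AddCommGroup M] [Module ℂ M]
  [AddCommGroup E] [Module ℂ E] [AddCommGroup F] [Module ℂ F]

/-- `m ⊗ (e ⊗ (a ⊗ b)) ↦ (e ⊗ (m ⊗ b₋₁)) ⊗ (b₀ ⊗ a)`. -/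
def splitLast (M E A : Type*) [AddCommGroup M] [Module ℂ M] [AddCommGroup E] [Module ℂ E]
    [AddCommGroup A] [Module ℂ A] (ρB : B →ₗ[ℂ] K ⊗[ℂ] B) :
    M ⊗[ℂ] (E ⊗[ℂ] (A ⊗[ℂ] B)) →ₗ[ℂ] (E ⊗[ℂ] (M ⊗[ℂ] K)) ⊗[ℂ] (B ⊗[ℂ] A) :=
  (TensorProduct.assoc ℂ E (M ⊗[ℂ] K) (B ⊗[ℂ] A)).symm.toLinearMap ∘ₗ
    (TensorProduct.assoc ℂ M K (B ⊗[ℂ] A)).symm.toLinearMap.lTensor E ∘ₗ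
    (TensorProduct.leftComm ℂ M E (K ⊗[ℂ] (B ⊗[ℂ] A))).toLinearMap ∘ₗ
    (((TensorProduct.assoc ℂ K B A).toLinearMap ∘ₗ ρB.rTensor A ∘ₗ
      (TensorProduct.comm ℂ A B).toLinearMap).lTensor E).lTensor M

theorem splitLast_tmul (ρB : B →ₗ[ℂ] K ⊗[ℂ] B) (m : M) (e : E) (a : A) (b : B) :
    splitLast M E A ρB (m ⊗ₜ (e ⊗ₜ (a ⊗ₜ b))) =
      TensorProduct.map (TensorProduct.mk ℂ E (M ⊗[ℂ] K) e ∘ₗ TensorProduct.mk ℂ M K m)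
        ((TensorProduct.mk ℂ B A).flip a) (ρB b) := by
  simp only [splitLast, LinearMap.comp_apply, LinearMap.lTensor_tmul, TensorProduct.comm_tmul,
    LinearEquiv.coe_coe, LinearMap.rTensor_tmul]
  exact TensorProduct.induction_on (ρB b) (by simp) (fun x y => by simp)
    (fun x y hx hy => by simp only [map_add, add_tmul, tmul_add, hx, hy])

theorem rTensor_splitLast (f : E →ₗ[ℂ] F) (ρB : B →ₗ[ℂ] K ⊗[ℂ] B)
    (y : M ⊗[ℂ] (E ⊗[ℂ] (A ⊗[ℂ] B))) :
    (f.rTensor (M ⊗[ℂ] K)).rTensor (B ⊗[ℂ] A) (splitLast M E A ρB y) =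
      splitLast M F A ρB ((f.rTensor (A ⊗[ℂ] B)).lTensor M y) := by
  refine TensorProduct.induction_on y (by simp) (fun m y => ?_)
    (fun x y hx hy => by simp only [map_add, hx, hy])
  refine TensorProduct.induction_on y (by simp) (fun e v => ?_)
    (fun x y hx hy => by simp only [map_add, tmul_add, hx, hy])
  refine TensorProduct.induction_on v (by simp) (fun a b => ?_)
    (fun x y hx hy => by simp only [map_add, tmul_add, hx, hy])
  simp only [LinearMap.lTensor_tmul, LinearMap.rTensor_tmul, splitLast_tmul]
  exact TensorProduct.induction_on (ρB b) (by simp) (fun x y => by simp)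
    (fun x y hx hy => by simp only [map_add, hx, hy])

theorem rTensor_rTensor_eqOn {V W : Type*} [AddCommGroup V] [Module ℂ V]
    [AddCommGroup W] [Module ℂ W] {P : Submodule ℂ E} {f g : E →ₗ[ℂ] F}
    (hfg : ∀ e ∈ P, f e = g e) {x : (E ⊗[ℂ] V) ⊗[ℂ] W}
    (hx : ∀ (φ : W →ₗ[ℂ] ℂ) (ψ : V →ₗ[ℂ] ℂ), rslice ψ (rslice φ x) ∈ P) :
    (f.rTensor V).rTensor W x = (g.rTensor V).rTensor W x :=
  rslice_ext fun φ => by rw [rslice_rTensor, rslice_rTensor, rTensor_eqOn hfg (hx φ)]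

end SplitLast

section Rotation

variable {C K A B M : Type*} [AddCommGroup C] [Module ℂ C] [Coalgebra ℂ C]
  [AddCommGroup K] [Module ℂ K] [Coalgebra ℂ K]
  [AddCommGroup A] [Module ℂ A] [AddCommGroup B] [Module ℂ B] [AddCommGroup M] [Module ℂ M]
  {H : LeftHopfCoalgebra C K}
  {N : LeftRightSAYD H M} {ρA : A →ₗ[ℂ] K ⊗[ℂ] A} {ρB : B →ₗ[ℂ] K ⊗[ℂ] B}
  {x : M ⊗[ℂ] (A ⊗[ℂ] B)}

/-- Only this composite is needed, because the cochain condition presents the arguments of ν⁻¹ as an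
image under ν. -/
theorem LeftHopfCoalgebra.galoisInvExt_galois (H : LeftHopfCoalgebra C K) {e : K ⊗[ℂ] K}
    (he : e ∈ H.KK) : H.galoisInvExt (H.galois e) = e := by
  have h : H.galois e = (H.galoisEquiv ⟨e, he⟩ : K ⊗[ℂ] K) := rfl
  rw [LeftHopfCoalgebra.galoisInvExt, h, extend_apply]
  simp

/-- In `galois_bicoact` the grouping on the left comes from the anti-Yetter-Drinfeld formula, which
comultiplies the acting leg, and the one on the right from ν, which comultiplies the leg multiplied
with a₋₁. -/
theorem IsLeftCoaction.coassoc_twice (hB : IsLeftCoaction ρB) (b : B) :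
    ((Coalgebra.comul (R := ℂ) (A := K)).rTensor B ∘ₗ ρB).lTensor K (ρB b) =
      (TensorProduct.assoc ℂ K K B).symm.toLinearMap.lTensor K
        (TensorProduct.assoc ℂ K K (K ⊗[ℂ] B) (TensorProduct.map Coalgebra.comul ρB (ρB b))) := by
  have h1 : (Coalgebra.comul (R := ℂ) (A := K)).rTensor B ∘ₗ ρB =
      (TensorProduct.assoc ℂ K K B).symm.toLinearMap ∘ₗ ρB.lTensor K ∘ₗ ρB := by
    ext b
    simp only [LinearMap.comp_apply, LinearEquiv.coe_coe, ← hB.coassoc,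
      LinearEquiv.symm_apply_apply]
  have h2 : ∀ v : K ⊗[ℂ] B, TensorProduct.assoc ℂ K K (K ⊗[ℂ] B)
      (TensorProduct.map Coalgebra.comul ρB v) = (ρB.lTensor K).lTensor K
      (TensorProduct.assoc ℂ K K B ((Coalgebra.comul (R := ℂ) (A := K)).rTensor B v)) := fun v => by
    refine TensorProduct.induction_on v (by simp) (fun k b => ?_)
      (fun x y hx hy => by simp only [map_add, hx, hy])
    simp only [TensorProduct.map_tmul, LinearMap.rTensor_tmul]
    exact TensorProduct.induction_on (Coalgebra.comul (R := ℂ) k) (by simp) (fun x y => by simp)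
      (fun x y hx hy => by simp only [map_add, add_tmul, hx, hy])
  rw [h1, h2, hB.coassoc, LinearMap.lTensor_comp_apply, LinearMap.lTensor_comp_apply]

/-- `(m ⊗ a₋₁b₋₁) ⊗ b₀₋₁ ⊗ b₀₀` through the Galois map. -/
theorem LeftHopfCoalgebra.galois_bicoact (H : LeftHopfCoalgebra C K) (hB : IsLeftCoaction ρB)
    (x : M ⊗[ℂ] (A ⊗[ℂ] B)) :
    ((aydShuffle₁ K M).toLinearMap ∘ₗ
        (Coalgebra.comul (R := ℂ) (A := K)).rTensor (M ⊗[ℂ] K)).rTensor (B ⊗[ℂ] A)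
      (preRot (M ⊗[ℂ] K) A ρB ((TensorProduct.assoc ℂ M K (A ⊗[ℂ] B)).symm
        ((H.prodCoact ρA ρB).lTensor M x))) =
    (H.galois.rTensor (M ⊗[ℂ] K)).rTensor (B ⊗[ℂ] A)
      (splitLast M (K ⊗[ℂ] K) A ρB ((bicoact ρA ρB).lTensor M x)) := by
  refine tensor_ext₃ (E := ((K ⊗[ℂ] K) ⊗[ℂ] (M ⊗[ℂ] K)) ⊗[ℂ] (B ⊗[ℂ] A))
    (f := ((aydShuffle₁ K M).toLinearMap ∘ₗ
        (Coalgebra.comul (R := ℂ) (A := K)).rTensor (M ⊗[ℂ] K)).rTensor (B ⊗[ℂ] A) ∘ₗ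
        preRot (M ⊗[ℂ] K) A ρB ∘ₗ (TensorProduct.assoc ℂ M K (A ⊗[ℂ] B)).symm.toLinearMap ∘ₗ
        (H.prodCoact ρA ρB).lTensor M)
    (g := (H.galois.rTensor (M ⊗[ℂ] K)).rTensor (B ⊗[ℂ] A) ∘ₗ
      splitLast M (K ⊗[ℂ] K) A ρB ∘ₗ (bicoact ρA ρB).lTensor M) (fun m a b => ?_) x
  simp only [LinearMap.comp_apply, LinearMap.lTensor_tmul, LeftBicoalgebroid.prodCoact, bicoact,
    TensorProduct.map_tmul, LinearEquiv.coe_coe]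
  refine TensorProduct.induction_on (ρA a) (by simp) (fun g a => ?_)
    (fun x y hx hy => by simp only [map_add, tmul_add, add_tmul, hx, hy])
  let P : K ⊗[ℂ] ((K ⊗[ℂ] K) ⊗[ℂ] B) →ₗ[ℂ] ((K ⊗[ℂ] K) ⊗[ℂ] (M ⊗[ℂ] K)) ⊗[ℂ] (B ⊗[ℂ] A) :=
    (TensorProduct.map ((TensorProduct.tensorTensorTensorComm ℂ K M K K).toLinearMap ∘ₗ
        TensorProduct.map ((TensorProduct.mk ℂ K M).flip m ∘ₗ H.mulExt ∘ₗ TensorProduct.mk ℂ K K g)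
          LinearMap.id)
      ((TensorProduct.mk ℂ B A).flip a)) ∘ₗ (TensorProduct.assoc ℂ K (K ⊗[ℂ] K) B).symm.toLinearMap
  have h1 : ∀ v : K ⊗[ℂ] B, ((aydShuffle₁ K M).toLinearMap ∘ₗ
      (Coalgebra.comul (R := ℂ) (A := K)).rTensor (M ⊗[ℂ] K)).rTensor (B ⊗[ℂ] A)
      (preRot (M ⊗[ℂ] K) A ρB ((TensorProduct.assoc ℂ M K (A ⊗[ℂ] B)).symm (m ⊗ₜ
        H.mulExt.rTensor (A ⊗[ℂ] B)
          (TensorProduct.tensorTensorTensorComm ℂ K A K B ((g ⊗ₜ a) ⊗ₜ v))))) =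
      P (((Coalgebra.comul (R := ℂ) (A := K)).rTensor B ∘ₗ ρB).lTensor K v) := fun v => by
    refine TensorProduct.induction_on v (by simp) (fun h b => ?_)
      (fun x y hx hy => by simp only [map_add, tmul_add, hx, hy])
    simp only [TensorProduct.tensorTensorTensorComm_tmul, LinearMap.rTensor_tmul,
      TensorProduct.assoc_symm_tmul, preRot_tmul, LinearMap.lTensor_tmul, LinearMap.comp_apply]
    refine TensorProduct.induction_on (ρB b) (by simp) (fun k b => ?_)
      (fun x y hx hy => by simp only [map_add, tmul_add, hx, hy])
    simp only [insertMid_tmul, LinearMap.rTensor_tmul, LinearMap.comp_apply, LinearEquiv.coe_coe]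
    exact TensorProduct.induction_on (Coalgebra.comul (R := ℂ) k) (by simp)
      (fun x y => by simp [P, aydShuffle₁_tmul])
      (fun x y hx hy => by simp only [map_add, add_tmul, tmul_add, hx, hy])
  have h2 : ∀ v : K ⊗[ℂ] B, (H.galois.rTensor (M ⊗[ℂ] K)).rTensor (B ⊗[ℂ] A)
      (splitLast M (K ⊗[ℂ] K) A ρB
        (m ⊗ₜ TensorProduct.tensorTensorTensorComm ℂ K A K B ((g ⊗ₜ a) ⊗ₜ v))) =
      P ((TensorProduct.assoc ℂ K K B).symm.toLinearMap.lTensor K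
        (TensorProduct.assoc ℂ K K (K ⊗[ℂ] B) (TensorProduct.map Coalgebra.comul ρB v))) :=
      fun v => by
    refine TensorProduct.induction_on v (by simp) (fun h b => ?_)
      (fun x y hx hy => by simp only [map_add, tmul_add, hx, hy])
    simp only [TensorProduct.tensorTensorTensorComm_tmul, splitLast_tmul, TensorProduct.map_tmul]
    refine TensorProduct.induction_on (ρB b) (by simp) (fun k b => ?_)
      (fun x y hx hy => by simp only [map_add, tmul_add, hx, hy])
    simp only [TensorProduct.map_tmul, LinearMap.comp_apply, TensorProduct.mk_apply,
      LinearMap.flip_apply, LinearMap.rTensor_tmul, LeftBicoalgebroid.galois,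
      LinearMap.lTensor_tmul]
    exact TensorProduct.induction_on (Coalgebra.comul (R := ℂ) h) (by simp)
      (fun x y => by simp [P])
      (fun x y hx hy => by simp only [map_add, add_tmul, tmul_add, hx, hy])
  rw [h1, h2, hB.coassoc_twice]

/-- The anti-Yetter-Drinfeld condition at b₋₁▷m involves ν⁻¹ of m₁ ⊗ b₋₂ with m₁ = a₋₁b₋₃. By
`galois_bicoact` this pair is ν(a₋₁ ⊗ b₋₂) after the Δ in ν is taken into account, so ν⁻ = a₋₁ and
ν⁺ = b₋₂. What remains is b₋₂▷m ⊗ b₋₁a₋₁ ⊗ b₀ ⊗ a₀. -/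
theorem LeftRightSAYD.IsCochain.rot_coact (hx : N.IsCochain ρA ρB x)
    (hA : IsLeftCoaction ρA) (hB : IsLeftCoaction ρB) :
    TensorProduct.assoc ℂ M K (B ⊗[ℂ] A) (N.coact.rTensor (B ⊗[ℂ] A) (rot A N.actExt ρB x)) =
      (H.prodCoact ρB ρA).lTensor M (rot A N.actExt ρB x) := by
  let AY : K ⊗[ℂ] M →ₗ[ℂ] M ⊗[ℂ] K := TensorProduct.map N.actExt H.mulExt ∘ₗ
    (aydShuffle₂ K M).toLinearMap ∘ₗ H.galoisInvExt.rTensor (M ⊗[ℂ] K) ∘ₗ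
    ((aydShuffle₁ K M).toLinearMap ∘ₗ (Coalgebra.comul (R := ℂ) (A := K)).rTensor (M ⊗[ℂ] K)) ∘ₗ
    N.coact.lTensor K
  have hAY : ∀ e ∈ cotensor H.rightC N.coactC, (N.coact ∘ₗ N.actExt) e = AY e := fun e he => by
    have h := N.ayd ⟨e, he⟩
    have h2 : N.actExt e = N.act ⟨e, he⟩ := extend_apply _ N.act ⟨e, he⟩
    have h3 : TensorProduct.map Coalgebra.comul N.coact =
      (Coalgebra.comul (R := ℂ) (A := K)).rTensor (M ⊗[ℂ] K) ∘ₗ N.coact.lTensor K :=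
      (LinearMap.rTensor_comp_lTensor _ _ _).symm
    rw [LinearMap.comp_apply, h2, h, h3]
    rfl
  have hmem : ∀ (φ : B ⊗[ℂ] A →ₗ[ℂ] ℂ) (ψ : M ⊗[ℂ] K →ₗ[ℂ] ℂ), rslice ψ (rslice φ
      (splitLast M (K ⊗[ℂ] K) A ρB ((bicoact ρA ρB).lTensor M x))) ∈ H.KK := fun φ =>
    rslice_mem_eqLocus (by
      rw [← rslice_rTensor, ← rslice_rTensor, rTensor_splitLast, rTensor_splitLast,
        ← LinearMap.lTensor_comp_apply, ← LinearMap.lTensor_comp_apply,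
        lTensor_eqOn (P := H.box ρA ρB) (g := (H.leftC.lTensor K).rTensor (A ⊗[ℂ] B) ∘ₗ
          bicoact ρA ρB) (fun e he => H.bicoact_balanced hA hB he) hx.mem_box])
  have hco : N.coact.rTensor (A ⊗[ℂ] B) x =
      (TensorProduct.assoc ℂ M K (A ⊗[ℂ] B)).symm ((H.prodCoact ρA ρB).lTensor M x) := by
    rw [← hx.coact_eq, LinearEquiv.symm_apply_apply]
  have h1 : N.coact.rTensor (B ⊗[ℂ] A) (rot A N.actExt ρB x) =
      (TensorProduct.map N.actExt H.mulExt ∘ₗ (aydShuffle₂ K M).toLinearMap).rTensor (B ⊗[ℂ] A)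
        (splitLast M (K ⊗[ℂ] K) A ρB ((bicoact ρA ρB).lTensor M x)) := by
    rw [rot, LinearMap.comp_apply, ← LinearMap.rTensor_comp_apply,
      rTensor_eqOn hAY (hx.rslice_preRot_mem hA hB)]
    simp only [AY]
    rw [← LinearMap.comp_assoc, LinearMap.rTensor_comp_apply]
    congr 1
    rw [LinearMap.rTensor_comp_apply, LinearMap.rTensor_comp_apply, rTensor_preRot, hco,
      H.galois_bicoact hB, ← LinearMap.rTensor_comp_apply, ← LinearMap.rTensor_comp]
    rw [rTensor_rTensor_eqOn (P := H.KK) (f := H.galoisInvExt ∘ₗ H.galois) (g := LinearMap.id)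
      (fun e he => H.galoisInvExt_galois he) hmem]
    simp
  rw [h1]
  refine tensor_ext₃ (f := (TensorProduct.assoc ℂ M K (B ⊗[ℂ] A)).toLinearMap ∘ₗ
      (TensorProduct.map N.actExt H.mulExt ∘ₗ (aydShuffle₂ K M).toLinearMap).rTensor (B ⊗[ℂ] A) ∘ₗ
      splitLast M (K ⊗[ℂ] K) A ρB ∘ₗ (bicoact ρA ρB).lTensor M)
    (g := (H.prodCoact ρB ρA).lTensor M ∘ₗ rot A N.actExt ρB) (fun m a b => ?_) x
  simp only [LinearMap.comp_apply, LinearMap.lTensor_tmul, LeftBicoalgebroid.prodCoact, bicoact,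
    TensorProduct.map_tmul, LinearEquiv.coe_coe, rot, preRot_tmul]
  refine TensorProduct.induction_on (ρB b) (by simp) (fun h b => ?_)
    (fun x y hx hy => by simp only [map_add, tmul_add, hx, hy])
  simp only [insertMid_tmul, LinearMap.rTensor_tmul, LinearMap.lTensor_tmul, LinearMap.comp_apply,
    TensorProduct.map_tmul, LinearEquiv.coe_coe]
  refine TensorProduct.induction_on (ρA a) (by simp) (fun g a => ?_)
    (fun x y hx hy => by simp only [map_add, tmul_add, add_tmul, hx, hy])
  simp only [TensorProduct.tensorTensorTensorComm_tmul, splitLast_tmul]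
  exact TensorProduct.induction_on (ρB b) (by simp) (fun x y => by simp [aydShuffle₂_tmul])
    (fun x y hx hy => by simp only [map_add, tmul_add, add_tmul, hx, hy])

/-- The rotation `M □_K (A □_C B) → M □_K (B □_C A)` is well defined. -/
theorem LeftRightSAYD.IsCochain.rot (hx : N.IsCochain ρA ρB x)
    (hA : IsLeftCoaction ρA) (hB : IsLeftCoaction ρB) :
    N.IsCochain ρB ρA (rot A N.actExt ρB x) :=
  ⟨hx.rot_mem_box hA hB, hx.rot_coact hA hB⟩

end Rotation

/-! ### Composites of rotations: involutivity, and rotation by a product of two blocks. -/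

section FrontLeg

variable {K A B D M E : Type*} [AddCommGroup K] [Module ℂ K]
  [AddCommGroup A] [Module ℂ A] [AddCommGroup B] [Module ℂ B] [AddCommGroup M] [Module ℂ M]
  [AddCommGroup D] [Module ℂ D] [AddCommGroup E] [Module ℂ E]
  {ρA : A →ₗ[ℂ] K ⊗[ℂ] A} {ρB : B →ₗ[ℂ] K ⊗[ℂ] B}

/-- `m ⊗ (e ⊗ v) ↦ (e ⊗ m) ⊗ v`. -/
def frontLeg (M E V : Type*) [AddCommGroup M] [Module ℂ M] [AddCommGroup E] [Module ℂ E]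
    [AddCommGroup V] [Module ℂ V] : M ⊗[ℂ] (E ⊗[ℂ] V) →ₗ[ℂ] (E ⊗[ℂ] M) ⊗[ℂ] V :=
  (TensorProduct.comm ℂ M E).toLinearMap.rTensor V ∘ₗ
    (TensorProduct.assoc ℂ M E V).symm.toLinearMap

@[simp] theorem frontLeg_tmul {V : Type*} [AddCommGroup V] [Module ℂ V] (m : M) (e : E) (v : V) :
    frontLeg M E V (m ⊗ₜ (e ⊗ₜ v)) = (e ⊗ₜ m) ⊗ₜ v := by
  simp [frontLeg]

/-- Two successive rotations bring out the legs in the order a₋₁ ⊗ b₋₁, the order of the product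
coaction. As above, G stands for the product and for the two sides of the balancing condition. -/
theorem rTensor_preRot_preRot (G : K ⊗[ℂ] K →ₗ[ℂ] E) (x : M ⊗[ℂ] (A ⊗[ℂ] B)) :
    (G.rTensor M ∘ₗ (TensorProduct.assoc ℂ K K M).symm.toLinearMap).rTensor (A ⊗[ℂ] B)
        (preRot (K ⊗[ℂ] M) B ρA (preRot M A ρB x)) =
      frontLeg M E (A ⊗[ℂ] B) ((G.rTensor (A ⊗[ℂ] B) ∘ₗ bicoact ρA ρB).lTensor M x) := by
  refine tensor_ext₃ (f := (G.rTensor M ∘ₗ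
      (TensorProduct.assoc ℂ K K M).symm.toLinearMap).rTensor (A ⊗[ℂ] B) ∘ₗ
      preRot (K ⊗[ℂ] M) B ρA ∘ₗ preRot M A ρB)
    (g := frontLeg M E (A ⊗[ℂ] B) ∘ₗ (G.rTensor (A ⊗[ℂ] B) ∘ₗ bicoact ρA ρB).lTensor M)
    (fun m a b => ?_) x
  simp only [LinearMap.comp_apply, LinearMap.lTensor_tmul, bicoact, TensorProduct.map_tmul,
    LinearEquiv.coe_coe, preRot_tmul]
  refine TensorProduct.induction_on (ρB b) (by simp) (fun h b => ?_)
    (fun x y hx hy => by simp only [map_add, tmul_add, hx, hy])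
  rw [insertMid_tmul, preRot_tmul]
  exact TensorProduct.induction_on (ρA a) (by simp) (fun x y => by simp)
    (fun x y hx hy => by simp only [map_add, tmul_add, add_tmul, hx, hy])

/-- `m ⊗ (d ⊗ (e ⊗ (a ⊗ b))) ↦ (e ⊗ m) ⊗ (a ⊗ (b ⊗ d))`. -/
def frontLegLast (M D E A B : Type*) [AddCommGroup M] [Module ℂ M] [AddCommGroup D] [Module ℂ D]
    [AddCommGroup E] [Module ℂ E] [AddCommGroup A] [Module ℂ A] [AddCommGroup B] [Module ℂ B] :
    M ⊗[ℂ] (D ⊗[ℂ] (E ⊗[ℂ] (A ⊗[ℂ] B))) →ₗ[ℂ] (E ⊗[ℂ] M) ⊗[ℂ] (A ⊗[ℂ] (B ⊗[ℂ] D)) :=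
  frontLeg M E (A ⊗[ℂ] (B ⊗[ℂ] D)) ∘ₗ
    (((TensorProduct.assoc ℂ A B D).toLinearMap ∘ₗ
      (TensorProduct.comm ℂ D (A ⊗[ℂ] B)).toLinearMap).lTensor E ∘ₗ
      (TensorProduct.leftComm ℂ D E (A ⊗[ℂ] B)).toLinearMap).lTensor M

theorem rTensor_preRot_assoc_preRot (G : K ⊗[ℂ] K →ₗ[ℂ] E) (x : M ⊗[ℂ] ((D ⊗[ℂ] A) ⊗[ℂ] B)) :
    (G.rTensor M ∘ₗ (TensorProduct.assoc ℂ K K M).symm.toLinearMap).rTensor (A ⊗[ℂ] (B ⊗[ℂ] D))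
        (preRot (K ⊗[ℂ] M) (B ⊗[ℂ] D) ρA
          ((TensorProduct.assoc ℂ B D A).symm.toLinearMap.lTensor (K ⊗[ℂ] M)
            (preRot M (D ⊗[ℂ] A) ρB x))) =
      frontLegLast M D E A B (((G.rTensor (A ⊗[ℂ] B) ∘ₗ bicoact ρA ρB).lTensor D).lTensor M
        ((TensorProduct.assoc ℂ D A B).toLinearMap.lTensor M x)) := by
  refine TensorProduct.induction_on x (by simp) (fun m x => ?_)
    (fun x y hx hy => by simp only [map_add, hx, hy])
  refine TensorProduct.induction_on x (by simp) (fun x b => ?_)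
    (fun x y hx hy => by simp only [map_add, tmul_add, hx, hy])
  refine TensorProduct.induction_on x (by simp) (fun d a => ?_)
    (fun x y hx hy => by simp only [map_add, tmul_add, add_tmul, hx, hy])
  simp only [LinearMap.comp_apply, LinearMap.lTensor_tmul, bicoact, TensorProduct.map_tmul,
    LinearEquiv.coe_coe, preRot_tmul, TensorProduct.assoc_tmul]
  refine TensorProduct.induction_on (ρB b) (by simp) (fun h b => ?_)
    (fun x y hx hy => by simp only [map_add, tmul_add, hx, hy])
  simp only [insertMid_tmul, LinearMap.lTensor_tmul, LinearEquiv.coe_coe,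
    TensorProduct.assoc_symm_tmul, preRot_tmul]
  exact TensorProduct.induction_on (ρA a) (by simp) (fun x y => by simp [frontLegLast])
    (fun x y hx hy => by simp only [map_add, tmul_add, add_tmul, hx, hy])

end FrontLeg

section Rotation

variable {C K A B D M : Type*} [AddCommGroup C] [Module ℂ C] [Coalgebra ℂ C]
  [AddCommGroup K] [Module ℂ K] [Coalgebra ℂ K]
  [AddCommGroup A] [Module ℂ A] [AddCommGroup B] [Module ℂ B] [AddCommGroup M] [Module ℂ M]
  [AddCommGroup D] [Module ℂ D] {H : LeftHopfCoalgebra C K}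
  {N : LeftRightSAYD H M} {ρA : A →ₗ[ℂ] K ⊗[ℂ] A} {ρB : B →ₗ[ℂ] K ⊗[ℂ] B}

/-- Rotating twice is the identity. -/
theorem LeftRightSAYD.IsCochain.rot_rot {x : M ⊗[ℂ] (A ⊗[ℂ] B)} (hx : N.IsCochain ρA ρB x)
    (hA : IsLeftCoaction ρA) (hB : IsLeftCoaction ρB) :
    TimesHopf.rot B N.actExt ρA (TimesHopf.rot A N.actExt ρB x) = x := by
  have h1 : TimesHopf.rot B N.actExt ρA (TimesHopf.rot A N.actExt ρB x) =
      (N.actExt ∘ₗ N.actExt.lTensor K).rTensor (A ⊗[ℂ] B)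
        (preRot (K ⊗[ℂ] M) B ρA (preRot M A ρB x)) := by
    rw [LinearMap.rTensor_comp_apply, rTensor_preRot]
    rfl
  -- Associativity replaces a₋₁▷(b₋₁▷m) by (a₋₁b₋₁)▷m; the cochain condition identifies a₋₁b₋₁ with
  -- m₁, and stability concludes.
  rw [h1, rTensor_eqOn (P := H.triple N.coactC) (g := N.actExt ∘ₗ (H.mulExt.rTensor M ∘ₗ
    (TensorProduct.assoc ℂ K K M).symm.toLinearMap)) (fun e he => N.mul_act e he)
    (H.rslice_mem_triple ?_ ?_), LinearMap.rTensor_comp_apply, rTensor_preRot_preRot]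
  · have h2 : frontLeg M K (A ⊗[ℂ] B)
        ((H.mulExt.rTensor (A ⊗[ℂ] B) ∘ₗ bicoact ρA ρB).lTensor M x) =
        ((TensorProduct.comm ℂ M K).toLinearMap ∘ₗ N.coact).rTensor (A ⊗[ℂ] B) x := by
      have h3 := hx.coact_eq
      rw [LeftBicoalgebroid.prodCoact] at h3
      rw [← h3, frontLeg, LinearMap.comp_apply, LinearEquiv.coe_coe, LinearEquiv.symm_apply_apply,
        ← LinearMap.rTensor_comp_apply]
    have h4 : N.actExt ∘ₗ (TensorProduct.comm ℂ M K).toLinearMap ∘ₗ N.coact = LinearMap.id := by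
      ext m; exact N.stable m
    rw [h2, ← LinearMap.rTensor_comp_apply, h4, LinearMap.rTensor_id, LinearMap.id_apply]
  · rw [rTensor_preRot, rTensor_preRot, hx.preRot_balanced hA hB]
  · rw [rTensor_preRot_preRot, rTensor_preRot_preRot, lTensor_eqOn (P := H.box ρA ρB)
      (g := (H.leftC.lTensor K).rTensor (A ⊗[ℂ] B) ∘ₗ bicoact ρA ρB)
      (fun e he => H.bicoact_balanced hA hB he) hx.mem_box]

/-- `(a₋₁b₋₁)▷m ⊗ a₀ ⊗ b₀ ⊗ d = a₋₁▷(b₋₁▷m) ⊗ a₀ ⊗ b₀ ⊗ d`. -/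
theorem LeftRightSAYD.rot_prodCoact (N : LeftRightSAYD H M)
    (hA : IsLeftCoaction ρA) (hB : IsLeftCoaction ρB)
    {x : M ⊗[ℂ] ((D ⊗[ℂ] A) ⊗[ℂ] B)}
    (h1 : ((TensorProduct.assoc ℂ K C M).toLinearMap ∘ₗ
        H.rightC.rTensor M).rTensor (B ⊗[ℂ] (D ⊗[ℂ] A)) (preRot M (D ⊗[ℂ] A) ρB x) =
      (N.coactC.lTensor K).rTensor (B ⊗[ℂ] (D ⊗[ℂ] A)) (preRot M (D ⊗[ℂ] A) ρB x))
    (h2 : ∀ (φ : M →ₗ[ℂ] ℂ) (ψ : D →ₗ[ℂ] ℂ),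
      lslice ψ (lslice φ ((TensorProduct.assoc ℂ D A B).toLinearMap.lTensor M x)) ∈ H.box ρA ρB) :
    (TensorProduct.assoc ℂ A B D).toLinearMap.lTensor M (rot D N.actExt (H.prodCoact ρA ρB)
        ((TensorProduct.assoc ℂ D A B).toLinearMap.lTensor M x)) =
      rot (B ⊗[ℂ] D) N.actExt ρA ((TensorProduct.assoc ℂ B D A).symm.toLinearMap.lTensor M
        (rot (D ⊗[ℂ] A) N.actExt ρB x)) := by
  have hR : rot (B ⊗[ℂ] D) N.actExt ρA ((TensorProduct.assoc ℂ B D A).symm.toLinearMap.lTensor M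
      (rot (D ⊗[ℂ] A) N.actExt ρB x)) =
      (N.actExt ∘ₗ N.actExt.lTensor K).rTensor (A ⊗[ℂ] (B ⊗[ℂ] D))
        (preRot (K ⊗[ℂ] M) (B ⊗[ℂ] D) ρA
          ((TensorProduct.assoc ℂ B D A).symm.toLinearMap.lTensor (K ⊗[ℂ] M)
            (preRot M (D ⊗[ℂ] A) ρB x))) := by
    rw [LinearMap.rTensor_comp_apply, rTensor_preRot, ← lTensor_rTensor_apply]
    rfl
  have hL : (TensorProduct.assoc ℂ A B D).toLinearMap.lTensor M (rot D N.actExt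
      (H.prodCoact ρA ρB) ((TensorProduct.assoc ℂ D A B).toLinearMap.lTensor M x)) =
      N.actExt.rTensor _ (frontLegLast M D K A B
        (((H.mulExt.rTensor (A ⊗[ℂ] B) ∘ₗ bicoact ρA ρB).lTensor D).lTensor M
        ((TensorProduct.assoc ℂ D A B).toLinearMap.lTensor M x))) := by
    generalize (TensorProduct.assoc ℂ D A B).toLinearMap.lTensor M x = y
    refine tensor_ext₃ (f := (TensorProduct.assoc ℂ A B D).toLinearMap.lTensor M ∘ₗ rot D N.actExt
      (H.prodCoact ρA ρB)) (g := N.actExt.rTensor _ ∘ₗ frontLegLast M D K A B ∘ₗ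
        ((H.mulExt.rTensor (A ⊗[ℂ] B) ∘ₗ bicoact ρA ρB).lTensor D).lTensor M)
      (fun m d v => ?_) y
    simp only [LinearMap.comp_apply, rot, preRot_tmul, LinearMap.lTensor_tmul,
      LeftBicoalgebroid.prodCoact]
    refine TensorProduct.induction_on (H.mulExt.rTensor (A ⊗[ℂ] B) (bicoact ρA ρB v)) (by simp)
      (fun k v => ?_) (fun x y hx hy => by simp only [map_add, tmul_add, hx, hy])
    simp [frontLegLast]
  rw [hL, hR, ← rTensor_preRot_assoc_preRot, ← LinearMap.rTensor_comp_apply]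
  -- For associativity of the action, h1 balances b₋₁ against m and h2 balances a₋₁ against b₋₁.
  refine (rTensor_eqOn (P := H.triple N.coactC) (fun e he => N.mul_act e he)
    (H.rslice_mem_triple ?_ ?_)).symm
  · rw [rTensor_preRot, rTensor_preRot, ← lTensor_rTensor_apply, h1, lTensor_rTensor_apply]
  · rw [rTensor_preRot_assoc_preRot, rTensor_preRot_assoc_preRot]
    congr 1
    generalize (TensorProduct.assoc ℂ D A B).toLinearMap.lTensor M x = y at h2 ⊢
    refine lslice_ext fun φ => ?_
    rw [lslice_lTensor, lslice_lTensor]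
    exact lTensor_eqOn (P := H.box ρA ρB)
      (f := ((TensorProduct.assoc ℂ K C K).toLinearMap ∘ₗ H.rightC.rTensor K).rTensor (A ⊗[ℂ] B) ∘ₗ
        bicoact ρA ρB)
      (g := (H.leftC.lTensor K).rTensor (A ⊗[ℂ] B) ∘ₗ bicoact ρA ρB)
      (fun e he => H.bicoact_balanced hA hB he) (h2 φ)

end Rotation

/-! ### Naturality of product coactions, cotensor products and rotations. -/

section Naturality

variable {C K A B A' B' M : Type*} [AddCommGroup C] [Module ℂ C]
  [AddCommGroup K] [Module ℂ K]
  [AddCommGroup A] [Module ℂ A] [AddCommGroup B] [Module ℂ B]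
  [AddCommGroup A'] [Module ℂ A'] [AddCommGroup B'] [Module ℂ B'] [AddCommGroup M] [Module ℂ M]
  {ρA : A →ₗ[ℂ] K ⊗[ℂ] A} {ρB : B →ₗ[ℂ] K ⊗[ℂ] B}
  {ρA' : A' →ₗ[ℂ] K ⊗[ℂ] A'} {ρB' : B' →ₗ[ℂ] K ⊗[ℂ] B'} {f : A →ₗ[ℂ] A'} {g : B →ₗ[ℂ] B'}

theorem bicoact_map (hf : ∀ a, ρA' (f a) = f.lTensor K (ρA a))
    (hg : ∀ b, ρB' (g b) = g.lTensor K (ρB b)) (x : A ⊗[ℂ] B) :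
    bicoact ρA' ρB' (TensorProduct.map f g x) =
      (TensorProduct.map f g).lTensor (K ⊗[ℂ] K) (bicoact ρA ρB x) := by
  refine TensorProduct.induction_on x (by simp) (fun a b => ?_)
    (fun x y hx hy => by simp only [map_add, hx, hy])
  simp only [bicoact, LinearMap.comp_apply, TensorProduct.map_tmul, LinearEquiv.coe_coe, hf, hg]
  refine TensorProduct.induction_on (ρA a) (by simp) (fun k a => ?_)
    (fun x y hx hy => by simp only [map_add, add_tmul, hx, hy])
  exact TensorProduct.induction_on (ρB b) (by simp) (fun x y => by simp)
    (fun x y hx hy => by simp only [map_add, tmul_add, hx, hy])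

theorem LeftBicoalgebroid.prodCoact_map [Coalgebra ℂ C] [Coalgebra ℂ K] (H : LeftBicoalgebroid C K)
    (hf : ∀ a, ρA' (f a) = f.lTensor K (ρA a))
    (hg : ∀ b, ρB' (g b) = g.lTensor K (ρB b)) (x : A ⊗[ℂ] B) :
    H.prodCoact ρA' ρB' (TensorProduct.map f g x) =
      (TensorProduct.map f g).lTensor K (H.prodCoact ρA ρB x) := by
  rw [prodCoact, LinearMap.comp_apply, bicoact_map hf hg, ← lTensor_rTensor_apply]
  rfl

/-- Colinearity of g is asked only on Q, since maps into the full tensor powers of T intertwine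
`diagCoact` only on cotensor products. The tensor is first written as an element of A ⊗ Q. -/
theorem LeftBicoalgebroid.prodCoact_map_of_right [Coalgebra ℂ C] [Coalgebra ℂ K]
    (H : LeftBicoalgebroid C K) {Q : Submodule ℂ B}
    (hf : ∀ a, ρA' (f a) = f.lTensor K (ρA a))
    (hg : ∀ b ∈ Q, ρB' (g b) = g.lTensor K (ρB b)) {x : A ⊗[ℂ] B}
    (hx : ∀ φ : A →ₗ[ℂ] ℂ, lslice φ x ∈ Q) :
    H.prodCoact ρA' ρB' (TensorProduct.map f g x) =
      (TensorProduct.map f g).lTensor K (H.prodCoact ρA ρB x) := by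
  obtain ⟨y, rfl⟩ := (mem_range_lTensor_iff Q x).2 hx
  have h1 : TensorProduct.map f g (Q.subtype.lTensor A y) =
      TensorProduct.map f (g ∘ₗ Q.subtype) y := by
    rw [← LinearMap.comp_apply, LinearMap.map_comp_lTensor]
  have h2 : ∀ z, TensorProduct.tensorTensorTensorComm ℂ K A' K B'
      (TensorProduct.map (f.lTensor K ∘ₗ ρA) (g.lTensor K ∘ₗ (ρB ∘ₗ Q.subtype)) z) =
      (TensorProduct.map f g).lTensor (K ⊗[ℂ] K) (bicoact ρA ρB (Q.subtype.lTensor A z)) :=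
      fun z => by
    refine TensorProduct.induction_on z (by simp) (fun a b => ?_)
      (fun x y hx hy => by simp only [map_add, hx, hy])
    simp only [bicoact, LinearMap.comp_apply, TensorProduct.map_tmul, LinearEquiv.coe_coe,
      LinearMap.lTensor_tmul]
    refine TensorProduct.induction_on (ρA a) (by simp) (fun k a => ?_)
      (fun x y hx hy => by simp only [map_add, add_tmul, hx, hy])
    exact TensorProduct.induction_on (ρB (Q.subtype b)) (by simp) (fun x y => by simp)
      (fun x y hx hy => by simp only [map_add, tmul_add, hx, hy])
  have h3 : ρA' ∘ₗ f = f.lTensor K ∘ₗ ρA := by ext a; exact hf a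
  have h4 : ρB' ∘ₗ g ∘ₗ Q.subtype = g.lTensor K ∘ₗ (ρB ∘ₗ Q.subtype) := by
    ext b; exact hg b b.2
  rw [h1, prodCoact, LinearMap.comp_apply, bicoact, LinearMap.comp_apply,
    ← LinearMap.comp_apply (TensorProduct.map ρA' ρB'), ← TensorProduct.map_comp, h3, h4,
    LinearEquiv.coe_coe, h2, ← lTensor_rTensor_apply]
  rfl

theorem LeftBicoalgebroid.prodCoact_map_of_left [Coalgebra ℂ C] [Coalgebra ℂ K]
    (H : LeftBicoalgebroid C K) {Q : Submodule ℂ A}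
    (hf : ∀ a ∈ Q, ρA' (f a) = f.lTensor K (ρA a))
    (hg : ∀ b, ρB' (g b) = g.lTensor K (ρB b)) {x : A ⊗[ℂ] B}
    (hx : ∀ φ : B →ₗ[ℂ] ℂ, rslice φ x ∈ Q) :
    H.prodCoact ρA' ρB' (TensorProduct.map f g x) =
      (TensorProduct.map f g).lTensor K (H.prodCoact ρA ρB x) := by
  obtain ⟨y, rfl⟩ := (mem_range_rTensor_iff Q x).2 hx
  have h1 : TensorProduct.map f g (Q.subtype.rTensor B y) =
      TensorProduct.map (f ∘ₗ Q.subtype) g y := by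
    rw [← LinearMap.comp_apply, LinearMap.map_comp_rTensor]
  have h2 : ∀ z, TensorProduct.tensorTensorTensorComm ℂ K A' K B'
      (TensorProduct.map (f.lTensor K ∘ₗ (ρA ∘ₗ Q.subtype)) (g.lTensor K ∘ₗ ρB) z) =
      (TensorProduct.map f g).lTensor (K ⊗[ℂ] K) (bicoact ρA ρB (Q.subtype.rTensor B z)) :=
      fun z => by
    refine TensorProduct.induction_on z (by simp) (fun a b => ?_)
      (fun x y hx hy => by simp only [map_add, hx, hy])
    simp only [bicoact, LinearMap.comp_apply, TensorProduct.map_tmul, LinearEquiv.coe_coe,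
      LinearMap.rTensor_tmul]
    refine TensorProduct.induction_on (ρA (Q.subtype a)) (by simp) (fun k a => ?_)
      (fun x y hx hy => by simp only [map_add, add_tmul, hx, hy])
    exact TensorProduct.induction_on (ρB b) (by simp) (fun x y => by simp)
      (fun x y hx hy => by simp only [map_add, tmul_add, hx, hy])
  have h3 : ρA' ∘ₗ f ∘ₗ Q.subtype = f.lTensor K ∘ₗ (ρA ∘ₗ Q.subtype) := by
    ext a; exact hf a a.2
  have h4 : ρB' ∘ₗ g = g.lTensor K ∘ₗ ρB := by ext b; exact hg b
  rw [h1, prodCoact, LinearMap.comp_apply, bicoact, LinearMap.comp_apply,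
    ← LinearMap.comp_apply (TensorProduct.map ρA' ρB'), ← TensorProduct.map_comp, h3, h4,
    LinearEquiv.coe_coe, h2, ← lTensor_rTensor_apply]
  rfl

theorem SourceTarget.lC_map [Coalgebra ℂ C] [Coalgebra ℂ K] (S : SourceTarget C K)
    (hg : ∀ b, ρB' (g b) = g.lTensor K (ρB b))
    (b : B) : S.lC ρB' (g b) = g.lTensor C (S.lC ρB b) := by
  rw [lC, LinearMap.comp_apply, hg, ← lTensor_rTensor_apply]
  rfl

theorem SourceTarget.leftβ_map [Coalgebra ℂ C] [Coalgebra ℂ K] (S : SourceTarget C K)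
    (hg : ∀ b, ρB' (g b) = g.lTensor K (ρB b))
    (b : B) : S.leftβ ρB' (g b) = g.lTensor C (S.leftβ ρB b) := by
  rw [leftβ, LinearMap.comp_apply, hg, ← lTensor_rTensor_apply]
  rfl

theorem SourceTarget.rC_map [Coalgebra ℂ C] [Coalgebra ℂ K] (S : SourceTarget C K)
    (hf : ∀ a, ρA' (f a) = f.lTensor K (ρA a))
    (a : A) : S.rC ρA' (f a) = f.rTensor C (S.rC ρA a) := by
  rw [← S.comm_leftβ, S.leftβ_map hf, comm_lTensor, S.comm_leftβ]

theorem cotensor_map_iff {C A B A' B' : Type*} [AddCommGroup C] [Module ℂ C]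
    [AddCommGroup A] [Module ℂ A] [AddCommGroup B] [Module ℂ B]
    [AddCommGroup A'] [Module ℂ A'] [AddCommGroup B'] [Module ℂ B']
    {f : A →ₗ[ℂ] A'} {g : B →ₗ[ℂ] B'}
    {r : A →ₗ[ℂ] A ⊗[ℂ] C} {l : B →ₗ[ℂ] C ⊗[ℂ] B} {r' : A' →ₗ[ℂ] A' ⊗[ℂ] C}
    {l' : B' →ₗ[ℂ] C ⊗[ℂ] B'} (hf : ∀ a, r' (f a) = f.rTensor C (r a))
    (hg : ∀ b, l' (g b) = g.lTensor C (l b)) (x : A ⊗[ℂ] B) :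
    TensorProduct.map f g x ∈ cotensor r' l' ↔
      TensorProduct.map f (g.lTensor C) (TensorProduct.assoc ℂ A C B (r.rTensor B x)) =
        TensorProduct.map f (g.lTensor C) (l.lTensor A x) := by
  have h1 : TensorProduct.assoc ℂ A' C B' (r'.rTensor B' (TensorProduct.map f g x)) =
      TensorProduct.map f (g.lTensor C) (TensorProduct.assoc ℂ A C B (r.rTensor B x)) := by
    refine TensorProduct.induction_on x (by simp) (fun a b => ?_)
      (fun x y hx hy => by simp only [map_add, hx, hy])
    simp only [TensorProduct.map_tmul, LinearMap.rTensor_tmul, hf]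
    exact TensorProduct.induction_on (r a) (by simp) (fun x y => by simp)
      (fun x y hx hy => by simp only [map_add, add_tmul, hx, hy])
  have h2 : l'.lTensor A' (TensorProduct.map f g x) =
      TensorProduct.map f (g.lTensor C) (l.lTensor A x) := by
    refine TensorProduct.induction_on x (by simp) (fun a b => ?_)
      (fun x y hx hy => by simp only [map_add, hx, hy])
    simp [hg]
  rw [← h1, ← h2]
  rfl

theorem map_mem_cotensor {C A B A' B' : Type*} [AddCommGroup C] [Module ℂ C]
    [AddCommGroup A] [Module ℂ A] [AddCommGroup B] [Module ℂ B]
    [AddCommGroup A'] [Module ℂ A'] [AddCommGroup B'] [Module ℂ B']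
    {f : A →ₗ[ℂ] A'} {g : B →ₗ[ℂ] B'}
    {r : A →ₗ[ℂ] A ⊗[ℂ] C} {l : B →ₗ[ℂ] C ⊗[ℂ] B} {r' : A' →ₗ[ℂ] A' ⊗[ℂ] C}
    {l' : B' →ₗ[ℂ] C ⊗[ℂ] B'} (hf : ∀ a, r' (f a) = f.rTensor C (r a))
    (hg : ∀ b, l' (g b) = g.lTensor C (l b)) {x : A ⊗[ℂ] B} (hx : x ∈ cotensor r l) :
    TensorProduct.map f g x ∈ cotensor r' l' :=
  (cotensor_map_iff hf hg x).2 (congrArg _ hx)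

theorem map_injective {A B A' B' : Type*}
    [AddCommGroup A] [Module ℂ A] [AddCommGroup B] [Module ℂ B]
    [AddCommGroup A'] [Module ℂ A'] [AddCommGroup B'] [Module ℂ B']
    {f : A →ₗ[ℂ] A'} {g : B →ₗ[ℂ] B'} (hf : Function.Injective f) (hg : Function.Injective g) :
    Function.Injective (TensorProduct.map f g) := by
  rw [← LinearMap.lTensor_comp_rTensor]
  exact (lTensor_injective hg _).comp (rTensor_injective hf _)

/-- Injections that respect the coactions also reflect cotensor products, because tensoring over a
field preserves injectivity. -/
theorem mem_cotensor_of_map {C A B A' B' : Type*} [AddCommGroup C] [Module ℂ C]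
    [AddCommGroup A] [Module ℂ A] [AddCommGroup B] [Module ℂ B]
    [AddCommGroup A'] [Module ℂ A'] [AddCommGroup B'] [Module ℂ B']
    {f : A →ₗ[ℂ] A'} {g : B →ₗ[ℂ] B'}
    {r : A →ₗ[ℂ] A ⊗[ℂ] C} {l : B →ₗ[ℂ] C ⊗[ℂ] B} {r' : A' →ₗ[ℂ] A' ⊗[ℂ] C}
    {l' : B' →ₗ[ℂ] C ⊗[ℂ] B'} (hf : ∀ a, r' (f a) = f.rTensor C (r a))
    (hg : ∀ b, l' (g b) = g.lTensor C (l b)) (hfi : Function.Injective f)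
    (hgi : Function.Injective g) {x : A ⊗[ℂ] B}
    (hx : TensorProduct.map f g x ∈ cotensor r' l') : x ∈ cotensor r l :=
  map_injective hfi (lTensor_injective hgi _) ((cotensor_map_iff hf hg x).1 hx)

theorem preRot_map (f : A →ₗ[ℂ] A') (hg : ∀ b, ρB' (g b) = g.lTensor K (ρB b))
    (x : M ⊗[ℂ] (A ⊗[ℂ] B)) :
    preRot M A' ρB' ((TensorProduct.map f g).lTensor M x) =
      (TensorProduct.map g f).lTensor (K ⊗[ℂ] M) (preRot M A ρB x) := by
  refine tensor_ext₃ (f := preRot M A' ρB' ∘ₗ (TensorProduct.map f g).lTensor M)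
    (g := (TensorProduct.map g f).lTensor (K ⊗[ℂ] M) ∘ₗ preRot M A ρB) (fun m a b => ?_) x
  simp only [LinearMap.comp_apply, LinearMap.lTensor_tmul, TensorProduct.map_tmul,
    preRot_tmul, hg]
  exact TensorProduct.induction_on (ρB b) (by simp) (fun x y => by simp)
    (fun x y hx hy => by simp only [map_add, hx, hy])

/-- Rotation is natural. -/
theorem rot_map (act : K ⊗[ℂ] M →ₗ[ℂ] M) (f : A →ₗ[ℂ] A')
    (hg : ∀ b, ρB' (g b) = g.lTensor K (ρB b)) (x : M ⊗[ℂ] (A ⊗[ℂ] B)) :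
    rot A' act ρB' ((TensorProduct.map f g).lTensor M x) =
      (TensorProduct.map g f).lTensor M (rot A act ρB x) := by
  rw [rot, LinearMap.comp_apply, preRot_map f hg, ← lTensor_rTensor_apply]
  rfl

end Naturality

/-! ### Reassociating iterated cotensor products. -/

section Reassociation

variable {C K A B D X : Type*} [AddCommGroup C] [Module ℂ C] [Coalgebra ℂ C]
  [AddCommGroup K] [Module ℂ K] [Coalgebra ℂ K]
  [AddCommGroup A] [Module ℂ A] [AddCommGroup B] [Module ℂ B]
  [AddCommGroup D] [Module ℂ D] [AddCommGroup X] [Module ℂ X]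
  (H : LeftBicoalgebroid C K)
  {ρA : A →ₗ[ℂ] K ⊗[ℂ] A} {ρB : B →ₗ[ℂ] K ⊗[ℂ] B} {ρD : D →ₗ[ℂ] K ⊗[ℂ] D}
  {ρX : X →ₗ[ℂ] K ⊗[ℂ] X}

/-- `e : X → A ⊗ B` is a colinear map into `A □_C B`. -/
structure LeftBicoalgebroid.IsBoxMap (ρA : A →ₗ[ℂ] K ⊗[ℂ] A) (ρB : B →ₗ[ℂ] K ⊗[ℂ] B)
    (ρX : X →ₗ[ℂ] K ⊗[ℂ] X) (e : X →ₗ[ℂ] A ⊗[ℂ] B) : Prop where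
  mem : ∀ x, e x ∈ H.box ρA ρB
  colinear : ∀ x, H.prodCoact ρA ρB (e x) = e.lTensor K (ρX x)

variable {H}

theorem LeftBicoalgebroid.IsBoxMap.lC {e : X →ₗ[ℂ] A ⊗[ℂ] B} (he : H.IsBoxMap ρA ρB ρX e)
    (hA : IsLeftCoaction ρA) (hB : IsLeftCoaction ρB) (x : X) :
    e.lTensor C (H.lC ρX x) = TensorProduct.assoc ℂ C A B ((H.lC ρA).rTensor B (e x)) := by
  rw [← H.lC_prodCoact hA hB (he.mem x), he.colinear, ← lTensor_rTensor_apply]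
  rfl

theorem LeftBicoalgebroid.IsBoxMap.leftβ {e : X →ₗ[ℂ] A ⊗[ℂ] B} (he : H.IsBoxMap ρA ρB ρX e)
    (hA : IsLeftCoaction ρA) (hB : IsLeftCoaction ρB) (x : X) :
    e.lTensor C (H.leftβ ρX x) = TensorProduct.leftComm ℂ A C B ((H.leftβ ρB).lTensor A (e x)) := by
  rw [← H.leftβ_prodCoact hA hB (he.mem x), he.colinear, ← lTensor_rTensor_apply]
  rfl

theorem LeftBicoalgebroid.IsBoxMap.rC {e : X →ₗ[ℂ] A ⊗[ℂ] B} (he : H.IsBoxMap ρA ρB ρX e)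
    (hA : IsLeftCoaction ρA) (hB : IsLeftCoaction ρB) (x : X) :
    e.rTensor C (H.rC ρX x) = (TensorProduct.assoc ℂ A B C).symm ((H.rC ρB).lTensor A (e x)) := by
  rw [← H.comm_leftβ, ← comm_lTensor, he.leftβ hA hB]
  refine TensorProduct.induction_on (e x) (by simp) (fun a b => ?_)
    (fun x y hx hy => by simp only [map_add, hx, hy])
  simp only [LinearMap.lTensor_tmul, ← H.comm_leftβ]
  exact TensorProduct.induction_on (H.leftβ ρB b) (by simp) (fun x y => by simp)
    (fun x y hx hy => by simp only [map_add, tmul_add, hx, hy])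

/-- This needs only that e takes values in A □_C B; D is a spectator, so z need not be balanced. -/
theorem LeftBicoalgebroid.IsBoxMap.balanced_assoc {e : X →ₗ[ℂ] A ⊗[ℂ] B}
    (he : H.IsBoxMap ρA ρB ρX e) (z : X ⊗[ℂ] D) :
    TensorProduct.assoc ℂ A C (B ⊗[ℂ] D) ((H.rC ρA).rTensor (B ⊗[ℂ] D)
      (TensorProduct.assoc ℂ A B D (e.rTensor D z))) =
    ((TensorProduct.assoc ℂ C B D).toLinearMap ∘ₗ (H.lC ρB).rTensor D).lTensor A
      (TensorProduct.assoc ℂ A B D (e.rTensor D z)) := by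
  refine TensorProduct.induction_on z (by simp) (fun x d => ?_)
    (fun x y hx hy => by simp only [map_add, hx, hy])
  have hx : TensorProduct.assoc ℂ A C B ((H.rC ρA).rTensor B (e x)) = (H.lC ρB).lTensor A (e x) :=
    he.mem x
  have h1 : ∀ w : A ⊗[ℂ] B, TensorProduct.assoc ℂ A C (B ⊗[ℂ] D) ((H.rC ρA).rTensor (B ⊗[ℂ] D)
      (TensorProduct.assoc ℂ A B D (w ⊗ₜ d))) = (TensorProduct.assoc ℂ C B D).toLinearMap.lTensor A
      (TensorProduct.assoc ℂ A (C ⊗[ℂ] B) D (TensorProduct.assoc ℂ A C B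
        ((H.rC ρA).rTensor B w) ⊗ₜ d)) := fun w => by
    refine TensorProduct.induction_on w (by simp) (fun a b => ?_)
      (fun x y hx hy => by simp only [map_add, add_tmul, hx, hy])
    simp only [LinearMap.rTensor_tmul, TensorProduct.assoc_tmul]
    exact TensorProduct.induction_on (H.rC ρA a) (by simp) (fun x y => by simp)
      (fun x y hx hy => by simp only [map_add, add_tmul, hx, hy])
  have h2 : ∀ w : A ⊗[ℂ] B, ((TensorProduct.assoc ℂ C B D).toLinearMap ∘ₗ
      (H.lC ρB).rTensor D).lTensor A (TensorProduct.assoc ℂ A B D (w ⊗ₜ d)) =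
      (TensorProduct.assoc ℂ C B D).toLinearMap.lTensor A
      (TensorProduct.assoc ℂ A (C ⊗[ℂ] B) D ((H.lC ρB).lTensor A w ⊗ₜ d)) := fun w =>
    TensorProduct.induction_on w (by simp) (fun a b => by simp)
      (fun x y hx hy => by simp only [map_add, add_tmul, hx, hy])
  rw [LinearMap.rTensor_tmul, h1, h2, hx]

theorem LeftBicoalgebroid.IsBoxMap.balanced_assoc_symm {e : X →ₗ[ℂ] B ⊗[ℂ] D}
    (he : H.IsBoxMap ρB ρD ρX e) (z : A ⊗[ℂ] X) :
    TensorProduct.assoc ℂ (A ⊗[ℂ] B) C D (((TensorProduct.assoc ℂ A B C).symm.toLinearMap ∘ₗ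
      (H.rC ρB).lTensor A).rTensor D ((TensorProduct.assoc ℂ A B D).symm (e.lTensor A z))) =
    (H.lC ρD).lTensor (A ⊗[ℂ] B) ((TensorProduct.assoc ℂ A B D).symm (e.lTensor A z)) := by
  refine TensorProduct.induction_on z (by simp) (fun a x => ?_)
    (fun x y hx hy => by simp only [map_add, hx, hy])
  have hx : TensorProduct.assoc ℂ B C D ((H.rC ρB).rTensor D (e x)) = (H.lC ρD).lTensor B (e x) :=
    he.mem x
  have h1 : ∀ w : B ⊗[ℂ] D, TensorProduct.assoc ℂ (A ⊗[ℂ] B) C D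
      (((TensorProduct.assoc ℂ A B C).symm.toLinearMap ∘ₗ (H.rC ρB).lTensor A).rTensor D
        ((TensorProduct.assoc ℂ A B D).symm (a ⊗ₜ w))) =
      (TensorProduct.assoc ℂ A B (C ⊗[ℂ] D)).symm (a ⊗ₜ
        TensorProduct.assoc ℂ B C D ((H.rC ρB).rTensor D w)) := fun w => by
    refine TensorProduct.induction_on w (by simp) (fun b d => ?_)
      (fun x y hx hy => by simp only [map_add, tmul_add, hx, hy])
    simp only [LinearMap.rTensor_tmul, TensorProduct.assoc_symm_tmul, LinearMap.comp_apply,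
      LinearMap.lTensor_tmul]
    exact TensorProduct.induction_on (H.rC ρB b) (by simp) (fun x y => by simp)
      (fun x y hx hy => by simp only [map_add, tmul_add, add_tmul, hx, hy])
  have h2 : ∀ w : B ⊗[ℂ] D, (H.lC ρD).lTensor (A ⊗[ℂ] B)
      ((TensorProduct.assoc ℂ A B D).symm (a ⊗ₜ w)) =
      (TensorProduct.assoc ℂ A B (C ⊗[ℂ] D)).symm (a ⊗ₜ (H.lC ρD).lTensor B w) := fun w =>
    TensorProduct.induction_on w (by simp) (fun b d => by simp)
      (fun x y hx hy => by simp only [map_add, tmul_add, hx, hy])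
  rw [LinearMap.lTensor_tmul, h1, h2, hx]

/-- `A □_C (B □_C D) ⊆ (A □_C B) ⊗ D`. -/
theorem LeftBicoalgebroid.IsBoxMap.rslice_assoc_symm_mem {e : X →ₗ[ℂ] B ⊗[ℂ] D}
    (he : H.IsBoxMap ρB ρD ρX e) (hB : IsLeftCoaction ρB) (hD : IsLeftCoaction ρD)
    {z : A ⊗[ℂ] X} (hz : z ∈ H.box ρA ρX) (φ : D →ₗ[ℂ] ℂ) :
    rslice φ ((TensorProduct.assoc ℂ A B D).symm (e.lTensor A z)) ∈ H.box ρA ρB := by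
  have hz' : TensorProduct.assoc ℂ A C X ((H.rC ρA).rTensor X z) = (H.lC ρX).lTensor A z := hz
  refine rslice_mem_eqLocus ?_ φ
  let P : A ⊗[ℂ] (C ⊗[ℂ] (B ⊗[ℂ] D)) →ₗ[ℂ] (A ⊗[ℂ] (C ⊗[ℂ] B)) ⊗[ℂ] D :=
    (TensorProduct.assoc ℂ A (C ⊗[ℂ] B) D).symm.toLinearMap ∘ₗ
      ((TensorProduct.assoc ℂ C B D).symm.toLinearMap).lTensor A
  have h1 : ((TensorProduct.assoc ℂ A C B).toLinearMap ∘ₗ (H.rC ρA).rTensor B).rTensor D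
      ((TensorProduct.assoc ℂ A B D).symm (e.lTensor A z)) =
      P ((e.lTensor C).lTensor A (TensorProduct.assoc ℂ A C X ((H.rC ρA).rTensor X z))) := by
    refine TensorProduct.induction_on z (by simp) (fun a x => ?_)
      (fun x y hx hy => by simp only [map_add, hx, hy])
    have h2 : ∀ (r : A ⊗[ℂ] C), (e.lTensor C).lTensor A (TensorProduct.assoc ℂ A C X (r ⊗ₜ x)) =
        TensorProduct.assoc ℂ A C (B ⊗[ℂ] D) (r ⊗ₜ e x) := fun r =>
      TensorProduct.induction_on r (by simp) (fun x y => by simp)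
        (fun x y hx hy => by simp only [map_add, add_tmul, hx, hy])
    rw [LinearMap.rTensor_tmul, h2, LinearMap.lTensor_tmul]
    refine TensorProduct.induction_on (e x) (by simp) (fun b d => ?_)
      (fun x y hx hy => by simp only [map_add, tmul_add, hx, hy])
    simp only [TensorProduct.assoc_symm_tmul, LinearMap.rTensor_tmul, LinearMap.comp_apply]
    exact TensorProduct.induction_on (H.rC ρA a) (by simp) (fun x y => by simp [P])
      (fun x y hx hy => by simp only [map_add, add_tmul, hx, hy])
  -- Balancing between A and X becomes balancing between A and B, because the left coaction of X = B
  -- □_C D sits on its first factor.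
  rw [h1, hz', ← LinearMap.lTensor_comp_apply]
  refine TensorProduct.induction_on z (by simp) (fun a x => ?_)
    (fun x y hx hy => by simp only [map_add, hx, hy])
  simp only [LinearMap.lTensor_tmul, LinearMap.comp_apply, he.lC hB hD]
  refine TensorProduct.induction_on (e x) (by simp) (fun b d => ?_)
    (fun x y hx hy => by simp only [map_add, tmul_add, hx, hy])
  simp only [TensorProduct.assoc_symm_tmul, LinearMap.rTensor_tmul, LinearMap.lTensor_tmul]
  exact TensorProduct.induction_on (H.lC ρB b) (by simp) (fun x y => by simp [P])
    (fun x y hx hy => by simp only [map_add, add_tmul, tmul_add, hx, hy])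

/-- `(A □_C B) □_C D ⊆ A ⊗ (B □_C D)`. -/
theorem LeftBicoalgebroid.IsBoxMap.lslice_assoc_mem {e : X →ₗ[ℂ] A ⊗[ℂ] B}
    (he : H.IsBoxMap ρA ρB ρX e) (hA : IsLeftCoaction ρA) (hB : IsLeftCoaction ρB)
    {z : X ⊗[ℂ] D} (hz : z ∈ H.box ρX ρD) (φ : A →ₗ[ℂ] ℂ) :
    lslice φ (TensorProduct.assoc ℂ A B D (e.rTensor D z)) ∈ H.box ρB ρD := by
  have hz' : TensorProduct.assoc ℂ X C D ((H.rC ρX).rTensor D z) = (H.lC ρD).lTensor X z := hz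
  refine lslice_mem_eqLocus ?_ φ
  let P : (A ⊗[ℂ] B) ⊗[ℂ] (C ⊗[ℂ] D) →ₗ[ℂ] A ⊗[ℂ] (B ⊗[ℂ] (C ⊗[ℂ] D)) :=
    (TensorProduct.assoc ℂ A B (C ⊗[ℂ] D)).toLinearMap
  have h1 : ((H.lC ρD).lTensor B).lTensor A (TensorProduct.assoc ℂ A B D (e.rTensor D z)) =
      P (e.rTensor (C ⊗[ℂ] D) ((H.lC ρD).lTensor X z)) := by
    refine TensorProduct.induction_on z (by simp) (fun x d => ?_)
      (fun x y hx hy => by simp only [map_add, hx, hy])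
    simp only [LinearMap.rTensor_tmul, LinearMap.lTensor_tmul]
    exact TensorProduct.induction_on (e x) (by simp) (fun x y => by simp [P])
      (fun x y hx hy => by simp only [map_add, add_tmul, hx, hy])
  rw [h1, ← hz']
  refine TensorProduct.induction_on z (by simp) (fun x d => ?_)
    (fun x y hx hy => by simp only [map_add, hx, hy])
  have h2 : ∀ r : X ⊗[ℂ] C, e.rTensor (C ⊗[ℂ] D) (TensorProduct.assoc ℂ X C D (r ⊗ₜ d)) =
      TensorProduct.assoc ℂ (A ⊗[ℂ] B) C D (e.rTensor C r ⊗ₜ d) := fun r =>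
    TensorProduct.induction_on r (by simp) (fun x y => by simp)
      (fun x y hx hy => by simp only [map_add, add_tmul, hx, hy])
  simp only [LinearMap.rTensor_tmul, h2, he.rC hA hB]
  refine TensorProduct.induction_on (e x) (by simp) (fun a b => ?_)
    (fun x y hx hy => by simp only [map_add, add_tmul, hx, hy])
  simp only [TensorProduct.assoc_tmul, LinearMap.lTensor_tmul, LinearMap.comp_apply,
    LinearMap.rTensor_tmul]
  exact TensorProduct.induction_on (H.rC ρB b) (by simp) (fun x y => by simp [P])
    (fun x y hx hy => by simp only [map_add, add_tmul, tmul_add, hx, hy])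

/-- A coaction restricts to a stable subspace on which it is coassociative and counital. -/
theorem IsLeftCoaction.of_injective {Y : Type*} [AddCommGroup Y] [Module ℂ Y]
    {ρY : Y →ₗ[ℂ] K ⊗[ℂ] Y} {e : X →ₗ[ℂ] Y} (he : Function.Injective e)
    (hρ : ∀ x, ρY (e x) = e.lTensor K (ρX x))
    (h1 : ∀ x, TensorProduct.assoc ℂ K K Y ((Coalgebra.comul (R := ℂ) (A := K)).rTensor Y
      (ρY (e x))) = ρY.lTensor K (ρY (e x)))
    (h2 : ∀ x, TensorProduct.lid ℂ Y ((Coalgebra.counit (R := ℂ) (A := K)).rTensor Y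
      (ρY (e x))) = e x) : IsLeftCoaction ρX := by
  refine ⟨fun x => ?_, fun x => ?_⟩
  · apply lTensor_injective (lTensor_injective he K) K
    have h := h1 x
    rw [hρ] at h
    have h1 : ∀ u : K ⊗[ℂ] X, ρY.lTensor K (e.lTensor K u) =
        (e.lTensor K).lTensor K (ρX.lTensor K u) := fun u => by
      rw [← LinearMap.lTensor_comp_apply, ← LinearMap.lTensor_comp_apply]
      congr 2
      ext x
      exact hρ x
    have h2 : ∀ u : K ⊗[ℂ] X, TensorProduct.assoc ℂ K K Y
        ((Coalgebra.comul (R := ℂ) (A := K)).rTensor Y (e.lTensor K u)) =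
        (e.lTensor K).lTensor K (TensorProduct.assoc ℂ K K X
          ((Coalgebra.comul (R := ℂ) (A := K)).rTensor X u)) := fun u => by
      refine TensorProduct.induction_on u (by simp) (fun k x => ?_)
        (fun x y hx hy => by simp only [map_add, hx, hy])
      simp only [LinearMap.lTensor_tmul, LinearMap.rTensor_tmul]
      exact TensorProduct.induction_on (Coalgebra.comul (R := ℂ) k) (by simp) (fun x y => by simp)
        (fun x y hx hy => by simp only [map_add, add_tmul, hx, hy])
    rw [← h1, ← h2, h]
  · apply he
    have h := h2 x
    rw [hρ] at h
    have h1 : ∀ u : K ⊗[ℂ] X, TensorProduct.lid ℂ Y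
        ((Coalgebra.counit (R := ℂ) (A := K)).rTensor Y (e.lTensor K u)) =
        e (TensorProduct.lid ℂ X ((Coalgebra.counit (R := ℂ) (A := K)).rTensor X u)) := fun u =>
      TensorProduct.induction_on u (by simp) (fun x y => by simp)
        (fun x y hx hy => by simp only [map_add, hx, hy])
    rw [← h1, h]

/-- A subspace `X ≅ A □_C B` of `A ⊗ B` is a comodule. -/
theorem LeftBicoalgebroid.exists_isBoxMap (hA : IsLeftCoaction ρA) (hB : IsLeftCoaction ρB)
    (e : X →ₗ[ℂ] A ⊗[ℂ] B) (he : Function.Injective e)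
    (hr : LinearMap.range e = H.box ρA ρB) :
    ∃ ρX : X →ₗ[ℂ] K ⊗[ℂ] X, IsLeftCoaction ρX ∧ H.IsBoxMap ρA ρB ρX e := by
  have hm : ∀ x, e x ∈ H.box ρA ρB := fun x => hr ▸ LinearMap.mem_range_self e x
  -- A □_C B is stable under the product coaction, hence so is the range of e, and injectivity of e
  -- transports the coaction to X.
  have hlift : ∀ x, (H.prodCoact ρA ρB ∘ₗ e) x ∈ LinearMap.range (e.lTensor K) := fun x => by
    obtain ⟨w, hw⟩ := (mem_range_lTensor_iff (LinearMap.range e) _).2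
      (fun φ => hr ▸ H.lslice_prodCoact_mem hA hB (hm x) φ)
    obtain ⟨v, hv⟩ := LinearMap.lTensor_surjective K (LinearMap.surjective_rangeRestrict e) w
    refine ⟨v, ?_⟩
    rw [LinearMap.comp_apply, ← hw, ← hv, ← LinearMap.lTensor_comp_apply]
    rfl
  have hρ : ∀ x, H.prodCoact ρA ρB (e x) = e.lTensor K (liftInj (e.lTensor K)
      (lTensor_injective he K) (H.prodCoact ρA ρB ∘ₗ e) hlift x) :=
    fun x => (liftInj_apply _ _ _ hlift x).symm
  exact ⟨_, .of_injective he hρ (fun x => H.prodCoact_coassoc hA hB (hm x))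
    (fun x => H.prodCoact_counit hA hB (hm x)), hm, hρ⟩

end Reassociation

/-! ### Cotensor powers of T as comodules. -/

section CotensorPowers

variable {C K T : Type*} [AddCommGroup C] [Module ℂ C] [Coalgebra ℂ C]
  [AddCommGroup K] [Module ℂ K] [Coalgebra ℂ K]
  [AddCommGroup T] [Module ℂ T] [Coalgebra ℂ T]
  {H : LeftHopfCoalgebra C K} (L : LeftComoduleCoalgebra H T)

namespace LeftComoduleCoalgebra

theorem diagCoact_succ (n : ℕ) (x : Tpow T (n + 1)) : L.diagCoact H.mulExt (n + 1) x =
    (Tpow.cons T n).toLinearMap.lTensor K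
      (H.prodCoact L.coact (L.diagCoact H.mulExt n) ((Tpow.cons T n).symm x)) := by
  rw [LeftBicoalgebroid.prodCoact, LinearMap.comp_apply, ← LinearMap.comp_apply (LinearMap.lTensor _ _),
    LinearMap.lTensor_comp_rTensor]
  rfl

theorem headC_succ (n : ℕ) (x : Tpow T (n + 1)) : L.headC (n + 1) x =
    (Tpow.cons T n).toLinearMap.lTensor C
      (TensorProduct.assoc ℂ C T (Tpow T n) ((H.lC L.coact).rTensor (Tpow T n)
        ((Tpow.cons T n).symm x))) := rfl

/-- `T^{□1} = T`. -/
def inclOne : L.cotensorPower 0 →ₗ[ℂ] T :=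
  (Tpow.one T).symm.toLinearMap ∘ₗ (L.cotensorPower 0).subtype

theorem inclOne_injective : Function.Injective L.inclOne :=
  (Tpow.one T).symm.injective.comp (Submodule.subtype_injective _)

theorem inclOne_surjective : Function.Surjective L.inclOne := fun t =>
  ⟨⟨Tpow.one T t, Submodule.mem_top⟩, (Tpow.one T).symm_apply_apply t⟩

/-- `T^{□(n+2)} ⊆ T ⊗ T^{□(n+1)}`. -/
theorem exists_uncons (n : ℕ) (x : L.cotensorPower (n + 1)) :
    ((Tpow.cons T n).symm.toLinearMap ∘ₗ (L.cotensorPower (n + 1)).subtype) x ∈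
      LinearMap.range (TensorProduct.map L.inclOne (L.cotensorPower n).subtype) := by
  obtain ⟨_, y, ⟨-, z, rfl⟩, rfl⟩ := x
  obtain ⟨z, rfl⟩ := LinearMap.rTensor_surjective _ L.inclOne_surjective z
  refine ⟨z, ?_⟩
  rw [← LinearMap.lTensor_comp_rTensor, LinearMap.comp_apply]
  exact ((Tpow.cons T n).symm_apply_apply _).symm

/-- The inclusion `T^{□(n+2)} → T^{□1} ⊗ T^{□(n+1)}`. -/
def uncons (n : ℕ) : L.cotensorPower (n + 1) →ₗ[ℂ] L.cotensorPower 0 ⊗[ℂ] L.cotensorPower n :=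
  liftInj (TensorProduct.map L.inclOne (L.cotensorPower n).subtype)
    (map_injective L.inclOne_injective (Submodule.subtype_injective _))
    ((Tpow.cons T n).symm.toLinearMap ∘ₗ (L.cotensorPower (n + 1)).subtype) (L.exists_uncons n)

theorem map_uncons (n : ℕ) (x : L.cotensorPower (n + 1)) :
    TensorProduct.map L.inclOne (L.cotensorPower n).subtype (L.uncons n x) =
      (Tpow.cons T n).symm x := liftInj_apply _ _ _ (L.exists_uncons n) x

theorem subtype_succ (n : ℕ) : (L.cotensorPower (n + 1)).subtype =
    (Tpow.cons T n).toLinearMap ∘ₗ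
      TensorProduct.map L.inclOne (L.cotensorPower n).subtype ∘ₗ L.uncons n := by
  ext x
  simp [map_uncons]

theorem uncons_injective (n : ℕ) : Function.Injective (L.uncons n) := fun x y h => by
  have := L.map_uncons n x
  rw [h, map_uncons] at this
  exact Subtype.ext ((Tpow.cons T n).symm.injective this.symm)

/-- The coaction of `K` on `T^{□(n+1)}`, and its compatibility with the given formulas. -/
structure IsPowCoact (n : ℕ) (ρ : L.cotensorPower n →ₗ[ℂ] K ⊗[ℂ] L.cotensorPower n) : Prop where
  isLeftCoaction : IsLeftCoaction ρ
  diagCoact : ∀ x : L.cotensorPower n, L.diagCoact H.mulExt n x =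
    (L.cotensorPower n).subtype.lTensor K (ρ x)
  headC : ∀ x : L.cotensorPower n, L.headC n x = (L.cotensorPower n).subtype.lTensor C (H.lC ρ x)

theorem exists_powCoact_zero : ∃ ρ, L.IsPowCoact 0 ρ := by
  have hl : ∀ x, (L.coact ∘ₗ L.inclOne) x ∈ LinearMap.range (L.inclOne.lTensor K) :=
    fun x => LinearMap.lTensor_surjective K L.inclOne_surjective _
  let ρ := liftInj (L.inclOne.lTensor K) (lTensor_injective L.inclOne_injective K)
    (L.coact ∘ₗ L.inclOne) hl
  have hρ : ∀ x, L.coact (L.inclOne x) = L.inclOne.lTensor K (ρ x) :=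
    fun x => (liftInj_apply _ _ _ hl x).symm
  have hsub : (Tpow.one T).toLinearMap ∘ₗ L.inclOne = (L.cotensorPower 0).subtype := rfl
  refine ⟨ρ, .of_injective L.inclOne_injective hρ (fun x => L.coact_isLeftCoaction.coassoc _)
    (fun x => L.coact_isLeftCoaction.counit _), fun x => ?_, fun x => ?_⟩
  · rw [← hsub, LinearMap.lTensor_comp_apply, ← hρ]
    rfl
  · rw [← hsub, LinearMap.lTensor_comp_apply, ← H.lC_map hρ]
    rfl

theorem IsPowCoact.coact_inclOne {L : LeftComoduleCoalgebra H T}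
    {ρ : L.cotensorPower 0 →ₗ[ℂ] K ⊗[ℂ] L.cotensorPower 0} (h : L.IsPowCoact 0 ρ)
    (x : L.cotensorPower 0) : L.coact (L.inclOne x) = L.inclOne.lTensor K (ρ x) := by
  apply (TensorProduct.congr (LinearEquiv.refl ℂ K) (Tpow.one T)).injective
  have hx := h.diagCoact x
  have hsub : (Tpow.one T).toLinearMap ∘ₗ L.inclOne = (L.cotensorPower 0).subtype := rfl
  rw [← hsub, LinearMap.lTensor_comp_apply] at hx
  exact hx

/-- Powers are defined inside T^{⊗} with the coaction of C on the first factor, whereas `box` uses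
comodule structures on the powers themselves. The inclusions respect both coactions, so they
preserve and reflect membership in the cotensor products. -/
theorem IsPowCoact.range_uncons {L : LeftComoduleCoalgebra H T} {n : ℕ}
    {ρ₀ : L.cotensorPower 0 →ₗ[ℂ] K ⊗[ℂ] L.cotensorPower 0} (h₀ : L.IsPowCoact 0 ρ₀)
    {ρ : L.cotensorPower n →ₗ[ℂ] K ⊗[ℂ] L.cotensorPower n} (h : L.IsPowCoact n ρ) :
    LinearMap.range (L.uncons n) = H.box ρ₀ ρ := by
  ext y
  constructor
  · rintro ⟨x, rfl⟩
    refine mem_cotensor_of_map (H.rC_map h₀.coact_inclOne) h.headC L.inclOne_injective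
      (Submodule.subtype_injective _) ?_
    rw [map_uncons]
    obtain ⟨_, y, ⟨hy, -⟩, rfl⟩ := x
    exact hy
  · intro hy
    refine ⟨⟨Tpow.cons T n (TensorProduct.map L.inclOne (L.cotensorPower n).subtype y), _,
      ⟨map_mem_cotensor (H.rC_map h₀.coact_inclOne) h.headC hy, L.inclOne.rTensor _ y, ?_⟩,
      rfl⟩, ?_⟩
    · rw [← LinearMap.comp_apply, LinearMap.lTensor_comp_rTensor]
    · apply map_injective L.inclOne_injective (Submodule.subtype_injective (L.cotensorPower n))
      rw [map_uncons]
      simp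

theorem IsPowCoact.succ {L : LeftComoduleCoalgebra H T} {n : ℕ}
    {ρ₀ : L.cotensorPower 0 →ₗ[ℂ] K ⊗[ℂ] L.cotensorPower 0} (h₀ : L.IsPowCoact 0 ρ₀)
    {ρ : L.cotensorPower n →ₗ[ℂ] K ⊗[ℂ] L.cotensorPower n} (h : L.IsPowCoact n ρ)
    {ρ' : L.cotensorPower (n + 1) →ₗ[ℂ] K ⊗[ℂ] L.cotensorPower (n + 1)} (h' : IsLeftCoaction ρ')
    (hb : H.IsBoxMap ρ₀ ρ ρ' (L.uncons n)) : L.IsPowCoact (n + 1) ρ' := by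
  refine ⟨h', fun x => ?_, fun x => ?_⟩
  · rw [diagCoact_succ, ← map_uncons, H.prodCoact_map h₀.coact_inclOne h.diagCoact, hb.colinear,
      L.subtype_succ, LinearMap.lTensor_comp_apply, LinearMap.lTensor_comp_apply]
  · rw [headC_succ, ← map_uncons, L.subtype_succ, LinearMap.lTensor_comp_apply, LinearMap.lTensor_comp_apply,
      hb.lC h₀.isLeftCoaction h.isLeftCoaction]
    congr 1
    refine TensorProduct.induction_on (L.uncons n x) (by simp) (fun a b => ?_)
      (fun x y hx hy => by simp only [map_add, hx, hy])
    simp only [TensorProduct.map_tmul, LinearMap.rTensor_tmul, H.lC_map h₀.coact_inclOne]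
    exact TensorProduct.induction_on (H.lC ρ₀ a) (by simp) (fun x y => by simp)
      (fun x y hx hy => by simp only [map_add, add_tmul, hx, hy])

/-- Inductively, `uncons` identifies the next power with T^{□1} □_C T^{□(n+1)}, and a cotensor
product of comodules is a comodule. -/
theorem exists_powCoact (n : ℕ) : ∃ ρ, L.IsPowCoact n ρ := by
  obtain ⟨ρ₀, h₀⟩ := L.exists_powCoact_zero
  induction n with
  | zero => exact ⟨ρ₀, h₀⟩
  | succ n ih =>
    obtain ⟨ρ, h⟩ := ih
    obtain ⟨ρ', h', hb⟩ := LeftBicoalgebroid.exists_isBoxMap h₀.isLeftCoaction h.isLeftCoaction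
      (L.uncons n) (L.uncons_injective n) (h₀.range_uncons h)
    exact ⟨ρ', h₀.succ h h' hb⟩

/-- The coaction of `K` on `T^{□(n+1)}`. -/
def powCoact (n : ℕ) : L.cotensorPower n →ₗ[ℂ] K ⊗[ℂ] L.cotensorPower n :=
  Classical.choose (L.exists_powCoact n)

theorem isPowCoact (n : ℕ) : L.IsPowCoact n (L.powCoact n) :=
  Classical.choose_spec (L.exists_powCoact n)

theorem powCoact_isLeftCoaction (n : ℕ) : IsLeftCoaction (L.powCoact n) :=
  (L.isPowCoact n).isLeftCoaction

theorem range_uncons (n : ℕ) :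
    LinearMap.range (L.uncons n) = H.box (L.powCoact 0) (L.powCoact n) :=
  (L.isPowCoact 0).range_uncons (L.isPowCoact n)

/-- The coactions `powCoact` are chosen separately in each degree, yet each is determined by the
explicit formula `diagCoact`; comparing inside T^{⊗} restores the link between consecutive degrees.
-/
theorem uncons_isBoxMap (n : ℕ) :
    H.IsBoxMap (L.powCoact 0) (L.powCoact n) (L.powCoact (n + 1)) (L.uncons n) := by
  refine ⟨fun x => L.range_uncons n ▸ LinearMap.mem_range_self _ x, fun x => ?_⟩
  apply lTensor_injective (map_injective L.inclOne_injective
    (Submodule.subtype_injective (L.cotensorPower n))) K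
  rw [← H.prodCoact_map (L.isPowCoact 0).coact_inclOne (L.isPowCoact n).diagCoact, map_uncons,
    ← LinearMap.lTensor_comp_apply]
  apply lTensor_injective (Tpow.cons T n).injective K
  have hd := L.diagCoact_succ n x
  rw [(L.isPowCoact (n + 1)).diagCoact] at hd
  refine hd.symm.trans ?_
  rw [L.subtype_succ, LinearMap.lTensor_comp_apply]

end LeftComoduleCoalgebra
end CotensorPowers

/-! ### Concatenation of tensor powers. -/

section Concatenation

variable {T : Type*} [AddCommGroup T] [Module ℂ T]

/-- `Tpow.Concat f` says that `f` is the concatenation map `T^{⊗(p+1)} ⊗ T^{⊗(q+1)} → T^{⊗(n+1)}`,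
where `n = p + q + 1`. -/
inductive Tpow.Concat : ∀ {p q n : ℕ}, (Tpow T p ⊗[ℂ] Tpow T q →ₗ[ℂ] Tpow T n) → Prop
  | cons (q : ℕ) : Tpow.Concat (p := 0) (q := q) (n := q + 1)
      ((Tpow.cons T q).toLinearMap ∘ₗ (Tpow.one T).symm.toLinearMap.rTensor (Tpow T q))
  | succ {p q n : ℕ} (f : Tpow T p ⊗[ℂ] Tpow T q →ₗ[ℂ] Tpow T n) : Tpow.Concat f →
      Tpow.Concat (p := p + 1) (q := q) (n := n + 1) ((Tpow.cons T n).toLinearMap ∘ₗ f.lTensor T ∘ₗ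
        (TensorProduct.assoc ℂ T (Tpow T p) (Tpow T q)).toLinearMap ∘ₗ
        (Tpow.cons T p).symm.toLinearMap.rTensor (Tpow T q))

theorem Tpow.snoc_zero (t : T) (u : Tpow T 0) :
    Tpow.snoc T 0 (t ⊗ₜ u) = Tpow.cons T 0 ((Tpow.one T).symm u ⊗ₜ Tpow.one T t) := by
  simp [Tpow.snoc]

theorem Tpow.snoc_succ (n : ℕ) (t s : T) (u : Tpow T n) :
    Tpow.snoc T (n + 1) (t ⊗ₜ Tpow.cons T n (s ⊗ₜ u)) =
      Tpow.cons T (n + 1) (s ⊗ₜ Tpow.snoc T n (t ⊗ₜ u)) := by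
  simp [Tpow.snoc]

@[elab_as_elim]
theorem Tpow.induction_cons {n : ℕ} {P : Tpow T (n + 1) → Prop} (u : Tpow T (n + 1))
    (zero : P 0) (cons : ∀ (t : T) (u : Tpow T n), P (Tpow.cons T n (t ⊗ₜ u)))
    (add : ∀ x y, P x → P y → P (x + y)) : P u := by
  obtain ⟨u, rfl⟩ := (Tpow.cons T n).surjective u
  exact TensorProduct.induction_on u (by rwa [map_zero]) cons
    (fun x y hx hy => by rw [map_add]; exact add _ _ hx hy)

variable {p q n : ℕ}

/-- v(ut) = (vu)t. As concatenation is a predicate on maps, with n not computed from p and q, the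
longer concatenation is produced together with its compatibility and no transport along equalities
of lengths occurs. -/
theorem Tpow.Concat.exists_snoc {f : Tpow T p ⊗[ℂ] Tpow T q →ₗ[ℂ] Tpow T n} (hf : Tpow.Concat f) :
    ∃ f' : Tpow T p ⊗[ℂ] Tpow T (q + 1) →ₗ[ℂ] Tpow T (n + 1), Tpow.Concat f' ∧
      ∀ v t u, f' (v ⊗ₜ Tpow.snoc T q (t ⊗ₜ u)) = Tpow.snoc T n (t ⊗ₜ f (v ⊗ₜ u)) := by
  induction hf with
  | cons q =>
    refine ⟨_, .cons (q + 1), fun v t u => ?_⟩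
    simp only [LinearMap.comp_apply, LinearMap.rTensor_tmul, LinearEquiv.coe_coe]
    rw [Tpow.snoc_succ]
  | @succ p q n f hf ih =>
    obtain ⟨f', hf', h⟩ := ih
    refine ⟨_, .succ f' hf', fun v t u => ?_⟩
    induction v using Tpow.induction_cons with
    | zero => simp
    | add x y hx hy => simp only [add_tmul, map_add, tmul_add, hx, hy]
    | cons s v =>
      simp only [LinearMap.comp_apply, LinearMap.rTensor_tmul, LinearEquiv.coe_coe,
        LinearEquiv.symm_apply_apply, TensorProduct.assoc_tmul, LinearMap.lTensor_tmul, h]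
      rw [Tpow.snoc_succ]

/-- (ut)v = u(tv): with `exists_snoc`, this follows the concatenations through the induction of
`rotate_pow`, in which one factor t at a time changes blocks. -/
theorem Tpow.Concat.exists_shift {g : Tpow T q ⊗[ℂ] Tpow T (p + 1) →ₗ[ℂ] Tpow T n}
    (hg : Tpow.Concat g) :
    ∃ g' : Tpow T (q + 1) ⊗[ℂ] Tpow T p →ₗ[ℂ] Tpow T n, Tpow.Concat g' ∧
      ∀ u t v, g' (Tpow.snoc T q (t ⊗ₜ u) ⊗ₜ v) = g (u ⊗ₜ Tpow.cons T p (t ⊗ₜ v)) := by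
  induction q generalizing n with
  | zero =>
    cases hg
    refine ⟨_, .succ _ (.cons p), fun u t v => ?_⟩
    rw [Tpow.snoc_zero]
    simp only [LinearMap.comp_apply, LinearMap.rTensor_tmul, LinearEquiv.coe_coe,
      LinearEquiv.symm_apply_apply, TensorProduct.assoc_tmul, LinearMap.lTensor_tmul]
  | succ q ih =>
    cases hg with
    | succ f hf =>
      obtain ⟨g', hg', h⟩ := ih hf
      refine ⟨_, .succ g' hg', fun u t v => ?_⟩
      induction u using Tpow.induction_cons with
      | zero => simp
      | add x y hx hy => simp only [add_tmul, map_add, tmul_add, hx, hy]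
      | cons s u =>
        rw [Tpow.snoc_succ]
        simp only [LinearMap.comp_apply, LinearMap.rTensor_tmul, LinearEquiv.coe_coe,
          LinearEquiv.symm_apply_apply, TensorProduct.assoc_tmul, LinearMap.lTensor_tmul, h]

theorem Tpow.Concat.eq_snoc {g : Tpow T q ⊗[ℂ] Tpow T 0 →ₗ[ℂ] Tpow T (q + 1)}
    (hg : Tpow.Concat g) (u : Tpow T q) (t : T) :
    g (u ⊗ₜ Tpow.one T t) = Tpow.snoc T q (t ⊗ₜ u) := by
  induction q with
  | zero =>
    cases hg
    simp [Tpow.snoc_zero]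
  | succ q ih =>
    cases hg with
    | succ f hf =>
      induction u using Tpow.induction_cons with
      | zero => simp
      | add x y hx hy => simp only [add_tmul, map_add, tmul_add, hx, hy]
      | cons s v =>
        rw [Tpow.snoc_succ, ← ih hf]
        simp

variable (T) in
theorem Tpow.Concat.exists_snoc_concat (q : ℕ) :
    ∃ g : Tpow T q ⊗[ℂ] Tpow T 0 →ₗ[ℂ] Tpow T (q + 1), Tpow.Concat g := by
  induction q with
  | zero => exact ⟨_, .cons 0⟩
  | succ q ih =>
    obtain ⟨g, hg⟩ := ih
    exact ⟨_, .succ g hg⟩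

end Concatenation

theorem exists_lTensor_of_lslice {X Y V : Type*} [AddCommGroup X] [Module ℂ X]
    [AddCommGroup Y] [Module ℂ Y] [AddCommGroup V] [Module ℂ V] (j : X →ₗ[ℂ] Y) {x : V ⊗[ℂ] Y}
    (h : ∀ φ : V →ₗ[ℂ] ℂ, lslice φ x ∈ LinearMap.range j) : ∃ z, j.lTensor V z = x := by
  obtain ⟨w, rfl⟩ := (mem_range_lTensor_iff (LinearMap.range j) _).2 h
  obtain ⟨v, rfl⟩ := LinearMap.lTensor_surjective V (LinearMap.surjective_rangeRestrict j) w
  exact ⟨v, by rw [← LinearMap.lTensor_comp_apply]; rfl⟩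

theorem assoc_rTensor_map {C A A' B B' : Type*} [AddCommGroup C] [Module ℂ C]
    [AddCommGroup A] [Module ℂ A] [AddCommGroup B] [Module ℂ B]
    [AddCommGroup A'] [Module ℂ A'] [AddCommGroup B'] [Module ℂ B']
    {f : A →ₗ[ℂ] A'} (g : B →ₗ[ℂ] B') {r : A →ₗ[ℂ] A ⊗[ℂ] C} {r' : A' →ₗ[ℂ] A' ⊗[ℂ] C}
    (hf : ∀ a, r' (f a) = f.rTensor C (r a)) (x : A ⊗[ℂ] B) :
    TensorProduct.assoc ℂ A' C B' (r'.rTensor B' (TensorProduct.map f g x)) =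
      TensorProduct.map f (g.lTensor C) (TensorProduct.assoc ℂ A C B (r.rTensor B x)) := by
  refine TensorProduct.induction_on x (by simp) (fun a b => ?_)
    (fun x y hx hy => by simp only [map_add, hx, hy])
  simp only [TensorProduct.map_tmul, LinearMap.rTensor_tmul, hf]
  exact TensorProduct.induction_on (r a) (by simp) (fun x y => by simp)
    (fun x y hx hy => by simp only [map_add, add_tmul, hx, hy])

/-! ### Concatenation is colinear on cotensor products. -/

section CotensorPowers

variable {C K T : Type*} [AddCommGroup C] [Module ℂ C] [Coalgebra ℂ C]
  [AddCommGroup K] [Module ℂ K] [Coalgebra ℂ K]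
  [AddCommGroup T] [Module ℂ T] [Coalgebra ℂ T]
  {H : LeftHopfCoalgebra C K} (L : LeftComoduleCoalgebra H T)

namespace LeftComoduleCoalgebra

theorem coact_inclOne (a : L.cotensorPower 0) :
    L.coact (L.inclOne a) = L.inclOne.lTensor K (L.powCoact 0 a) :=
  (L.isPowCoact 0).coact_inclOne a

theorem diagCoact_coe {n : ℕ} (x : L.cotensorPower n) : L.diagCoact H.mulExt n x =
    (L.cotensorPower n).subtype.lTensor K (L.powCoact n x) := (L.isPowCoact n).diagCoact x

theorem headC_eq {n : ℕ} {x : Tpow T n} (hx : x ∈ L.cotensorPower n) :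
    L.headC n x = (H.α : K →ₗ[ℂ] C).rTensor _ (L.diagCoact H.mulExt n x) := by
  have h1 := (L.isPowCoact n).headC ⟨x, hx⟩
  have h2 := L.diagCoact_coe ⟨x, hx⟩
  simp only at h1 h2
  rw [h1, h2, ← lTensor_rTensor_apply]
  rfl

/-- An element of `T ⊗ T^{□(n+1)}` in `T □_C T^{⊗(n+1)}` lies in `T^{□(n+2)}`. -/
theorem cons_mem {n : ℕ} {y : T ⊗[ℂ] Tpow T n} (hy : y ∈ cotensor L.rightC (L.headC n))
    (h : ∀ φ : T →ₗ[ℂ] ℂ, lslice φ y ∈ L.cotensorPower n) :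
    Tpow.cons T n y ∈ L.cotensorPower (n + 1) :=
  ⟨y, ⟨hy, (mem_range_lTensor_iff _ _).2 h⟩, rfl⟩

/-- `F` restricts to a colinear map from the subspace `Q` of `X` to `T^{□(n+1)}`. -/
structure IsColinearOn {X : Type*} [AddCommGroup X] [Module ℂ X] (Q : Submodule ℂ X)
    (ρ : X →ₗ[ℂ] K ⊗[ℂ] X) {n : ℕ} (F : X →ₗ[ℂ] Tpow T n) : Prop where
  mem : ∀ x ∈ Q, F x ∈ L.cotensorPower n
  colinear : ∀ x ∈ Q, L.diagCoact H.mulExt n (F x) = F.lTensor K (ρ x)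

variable {L}

/-- The inductive step for any map that leaves the first factor untouched: F carries the coactions
of X to `headC` and `diagCoact` on Q, so the balancing and the product coaction with the first
factor are carried along. -/
theorem IsColinearOn.cons {X : Type*} [AddCommGroup X] [Module ℂ X] {Q : Submodule ℂ X}
    {ρ : X →ₗ[ℂ] K ⊗[ℂ] X} {n : ℕ} {F : X →ₗ[ℂ] Tpow T n} (hF : L.IsColinearOn Q ρ F)
    {z : L.cotensorPower 0 ⊗[ℂ] X} (hz : z ∈ cotensor (H.rC (L.powCoact 0)) (H.lC ρ))
    (hQ : ∀ φ : L.cotensorPower 0 →ₗ[ℂ] ℂ, lslice φ z ∈ Q) :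
    Tpow.cons T n (TensorProduct.map L.inclOne F z) ∈ L.cotensorPower (n + 1) ∧
      L.diagCoact H.mulExt (n + 1) (Tpow.cons T n (TensorProduct.map L.inclOne F z)) =
        ((Tpow.cons T n).toLinearMap ∘ₗ TensorProduct.map L.inclOne F).lTensor K
          (H.prodCoact (L.powCoact 0) ρ z) := by
  constructor
  · refine L.cons_mem ?_ fun φ => ?_
    · have h1 : L.headC n ∘ₗ F ∘ₗ Q.subtype = F.lTensor C ∘ₗ H.lC ρ ∘ₗ Q.subtype := by
        ext x
        change L.headC n (F x) = _
        rw [L.headC_eq (hF.mem _ x.2), hF.colinear _ x.2, ← lTensor_rTensor_apply]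
        rfl
      have hz' : TensorProduct.assoc ℂ _ C X ((H.rC (L.powCoact 0)).rTensor X z) =
        (H.lC ρ).lTensor _ z := hz
      change TensorProduct.assoc ℂ T C _ ((H.rC L.coact).rTensor _ (TensorProduct.map L.inclOne F z))
        = (L.headC n).lTensor T (TensorProduct.map L.inclOne F z)
      rw [assoc_rTensor_map F (H.rC_map L.coact_inclOne), hz', ← LinearMap.comp_apply,
        ← LinearMap.comp_apply, LinearMap.map_comp_lTensor, LinearMap.lTensor_comp_map]
      exact (map_eqOn_right L.inclOne (fun e he => LinearMap.congr_fun h1 ⟨e, he⟩) hQ).symm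
    · rw [← LinearMap.lTensor_comp_rTensor, LinearMap.comp_apply, lslice_lTensor, lslice_rTensor]
      exact hF.mem _ (hQ _)
  · rw [diagCoact_succ, LinearEquiv.symm_apply_apply,
      H.prodCoact_map_of_right L.coact_inclOne hF.colinear hQ, LinearMap.lTensor_comp_apply]

/-- `T^{⊗(p+1)} ⊗ T^{⊗(q+1)} → T^{⊗(n+1)}` on cotensor powers, in terms of the first factor. -/
theorem concat_succ {p q n : ℕ}
    (f : Tpow T p ⊗[ℂ] Tpow T q →ₗ[ℂ] Tpow T n) :
    ((Tpow.cons T n).toLinearMap ∘ₗ f.lTensor T ∘ₗ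
        (TensorProduct.assoc ℂ T (Tpow T p) (Tpow T q)).toLinearMap ∘ₗ
        (Tpow.cons T p).symm.toLinearMap.rTensor (Tpow T q)) ∘ₗ
        TensorProduct.map (L.cotensorPower (p + 1)).subtype (L.cotensorPower q).subtype =
    (Tpow.cons T n).toLinearMap ∘ₗ TensorProduct.map L.inclOne
      (f ∘ₗ TensorProduct.map (L.cotensorPower p).subtype (L.cotensorPower q).subtype) ∘ₗ
      (TensorProduct.assoc ℂ (L.cotensorPower 0) (L.cotensorPower p)
        (L.cotensorPower q)).toLinearMap ∘ₗ (L.uncons p).rTensor (L.cotensorPower q) := by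
  ext a b
  simp only [AlgebraTensorModule.curry_apply, curry_apply,
    LinearMap.coe_restrictScalars, LinearMap.comp_apply, LinearEquiv.coe_coe,
    TensorProduct.map_tmul, LinearMap.rTensor_tmul, Submodule.subtype_apply, ← L.map_uncons]
  congr 1
  exact TensorProduct.induction_on (L.uncons p a) (by simp) (fun x y => by simp)
    (fun x y hx hy => by simp only [map_add, add_tmul, hx, hy])

theorem concat_zero (q : ℕ) :
    ((Tpow.cons T q).toLinearMap ∘ₗ (Tpow.one T).symm.toLinearMap.rTensor (Tpow T q)) ∘ₗ
      TensorProduct.map (L.cotensorPower 0).subtype (L.cotensorPower q).subtype =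
    (Tpow.cons T q).toLinearMap ∘ₗ TensorProduct.map L.inclOne (L.cotensorPower q).subtype := by
  rw [LinearMap.comp_assoc, LinearMap.rTensor_comp_map]
  rfl

/-- Concatenation is a colinear map `T^{□(p+1)} □_C T^{□(q+1)} → T^{□(n+1)}`. -/
theorem isColinearOn_concat (L : LeftComoduleCoalgebra H T) {p q n : ℕ}
    {f : Tpow T p ⊗[ℂ] Tpow T q →ₗ[ℂ] Tpow T n} (hf : Tpow.Concat f) :
    L.IsColinearOn (H.box (L.powCoact p) (L.powCoact q)) (H.prodCoact (L.powCoact p) (L.powCoact q))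
      (f ∘ₗ TensorProduct.map (L.cotensorPower p).subtype (L.cotensorPower q).subtype) := by
  induction hf with
  | cons q =>
    have hq : L.IsColinearOn ⊤ (L.powCoact q) (L.cotensorPower q).subtype :=
      ⟨fun x _ => x.2, fun x _ => L.diagCoact_coe x⟩
    rw [L.concat_zero]
    exact ⟨fun x hx => (hq.cons hx fun _ => Submodule.mem_top).1,
      fun x hx => (hq.cons hx fun _ => Submodule.mem_top).2⟩
  | @succ p q n f hf ih =>
    have hu := L.uncons_isBoxMap p
    have h0 := L.powCoact_isLeftCoaction 0
    have hp := L.powCoact_isLeftCoaction p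
    have hq := L.powCoact_isLeftCoaction q
    have key : ∀ x ∈ H.box (L.powCoact (p + 1)) (L.powCoact q), _ := fun x hx =>
      ih.cons (z := TensorProduct.assoc ℂ _ _ _ ((L.uncons p).rTensor (L.cotensorPower q) x))
        (by
          refine (hu.balanced_assoc x).trans ?_
          exact lTensor_eqOn (P := H.box (L.powCoact p) (L.powCoact q))
            (fun e he => (H.lC_prodCoact hp hq he).symm) (hu.lslice_assoc_mem h0 hp hx))
        (hu.lslice_assoc_mem h0 hp hx)
    rw [L.concat_succ f, ← LinearMap.comp_assoc]
    refine ⟨fun x hx => (key x hx).1, fun x hx => (key x hx).2.trans ?_⟩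
    -- The induction hypothesis yields the coaction t₋₁(v₋₁u₋₁), while the first block carries
    -- t₋₁v₋₁ through `uncons`; associativity in `K` compares them.
    rw [H.prodCoact_assoc h0 hp hq (hu.lslice_assoc_mem h0 hp hx) (fun φ => ?_),
      LinearEquiv.symm_apply_apply, LinearMap.lTensor_comp_apply K _ (_ ∘ₗ _),
      LinearMap.lTensor_comp_apply K _ (LinearMap.rTensor _ _)]
    · congr 2
      exact H.prodCoact_map (g := LinearMap.id) hu.colinear (fun b => by simp) x
    · rw [LinearEquiv.symm_apply_apply, rslice_rTensor]
      exact hu.mem _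

end LeftComoduleCoalgebra
end CotensorPowers

/-! ### Powers of the cyclic operator as block rotations. -/

section Cyclicity

variable {C K T M : Type*} [AddCommGroup C] [Module ℂ C] [Coalgebra ℂ C]
  [AddCommGroup K] [Module ℂ K] [Coalgebra ℂ K]
  [AddCommGroup T] [Module ℂ T] [Coalgebra ℂ T] [AddCommGroup M] [Module ℂ M]
  {H : LeftHopfCoalgebra C K} (L : LeftComoduleCoalgebra H T) (N : LeftRightSAYD H M)

theorem assoc_rTensor_lTensor {K M X Y : Type*} [AddCommGroup K] [Module ℂ K]
    [AddCommGroup M] [Module ℂ M] [AddCommGroup X] [Module ℂ X] [AddCommGroup Y]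
    [Module ℂ Y] (c : M →ₗ[ℂ] M ⊗[ℂ] K) (Φ : X →ₗ[ℂ] Y) (x : M ⊗[ℂ] X) :
    TensorProduct.assoc ℂ M K Y (c.rTensor Y (Φ.lTensor M x)) =
      (Φ.lTensor K).lTensor M (TensorProduct.assoc ℂ M K X (c.rTensor X x)) := by
  refine TensorProduct.induction_on x (by simp) (fun m x => ?_)
    (fun x y hx hy => by simp only [map_add, hx, hy])
  simp only [LinearMap.lTensor_tmul, LinearMap.rTensor_tmul]
  exact TensorProduct.induction_on (c m) (by simp) (fun x y => by simp)
    (fun x y hx hy => by simp only [map_add, add_tmul, hx, hy])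

namespace LeftComoduleCoalgebra

/-- The map `T^{□(q+1)} ⊗ T^{□(p+2)} → T^{⊗(q+2)} ⊗ T^{□(p+1)}` moving a tensor factor. -/
def shiftFactor (p q : ℕ) : L.cotensorPower q ⊗[ℂ] L.cotensorPower (p + 1) →ₗ[ℂ]
    Tpow T (q + 1) ⊗[ℂ] L.cotensorPower p :=
  (Tpow.snoc T q ∘ₗ (TensorProduct.comm ℂ (Tpow T q) T).toLinearMap ∘ₗ
    TensorProduct.map (L.cotensorPower q).subtype L.inclOne).rTensor (L.cotensorPower p) ∘ₗ
  (TensorProduct.assoc ℂ (L.cotensorPower q) (L.cotensorPower 0)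
    (L.cotensorPower p)).symm.toLinearMap ∘ₗ (L.uncons p).lTensor (L.cotensorPower q)

/-- Appending a factor is concatenation with T^{□1}, so this is a case of `isColinearOn_concat`. -/
theorem isColinearOn_snoc (q : ℕ) :
    L.IsColinearOn (H.box (L.powCoact q) (L.powCoact 0)) (H.prodCoact (L.powCoact q) (L.powCoact 0))
      (Tpow.snoc T q ∘ₗ (TensorProduct.comm ℂ (Tpow T q) T).toLinearMap ∘ₗ
        TensorProduct.map (L.cotensorPower q).subtype L.inclOne) := by
  obtain ⟨g, hg⟩ := Tpow.Concat.exists_snoc_concat T q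
  have h : g ∘ₗ TensorProduct.map (L.cotensorPower q).subtype (L.cotensorPower 0).subtype =
      Tpow.snoc T q ∘ₗ (TensorProduct.comm ℂ (Tpow T q) T).toLinearMap ∘ₗ
        TensorProduct.map (L.cotensorPower q).subtype L.inclOne := by
    ext a b
    exact hg.eq_snoc a (L.inclOne b)
  rw [← h]
  exact L.isColinearOn_concat hg

variable {L}

theorem shiftFactor_mem {p q : ℕ} {z : L.cotensorPower q ⊗[ℂ] L.cotensorPower (p + 1)}
    (hz : z ∈ H.box (L.powCoact q) (L.powCoact (p + 1))) :
    L.shiftFactor p q z ∈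
      LinearMap.range ((L.cotensorPower (q + 1)).subtype.rTensor (L.cotensorPower p)) := by
  refine (mem_range_rTensor_iff _ _).2 fun φ => ?_
  rw [shiftFactor, LinearMap.comp_apply, rslice_rTensor]
  exact (L.isColinearOn_snoc q).mem _ ((L.uncons_isBoxMap p).rslice_assoc_symm_mem
    (L.powCoact_isLeftCoaction 0) (L.powCoact_isLeftCoaction p) hz φ)

/-- The right coaction of the enlarged block ut comes from t alone (`leftβ_prodCoact`), and t is
already balanced against v, since t ⊗ v comes from T^{□(p+2)}. -/
theorem shiftFactor_mem_box {p q : ℕ} {z : L.cotensorPower q ⊗[ℂ] L.cotensorPower (p + 1)}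
    (hz : z ∈ H.box (L.powCoact q) (L.powCoact (p + 1)))
    {u : L.cotensorPower (q + 1) ⊗[ℂ] L.cotensorPower p}
    (hu : (L.cotensorPower (q + 1)).subtype.rTensor _ u = L.shiftFactor p q z) :
    u ∈ H.box (L.powCoact (q + 1)) (L.powCoact p) := by
  have hF := L.isColinearOn_snoc q
  have he := L.uncons_isBoxMap p
  have h0 := L.powCoact_isLeftCoaction 0
  have hm := he.rslice_assoc_symm_mem h0 (L.powCoact_isLeftCoaction p) hz
  refine mem_cotensor_of_map (f := (L.cotensorPower (q + 1)).subtype) (g := LinearMap.id)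
    (r' := H.rC (L.diagCoact H.mulExt (q + 1))) (l' := H.lC (L.powCoact p))
    (H.rC_map L.diagCoact_coe) (fun b => by simp)
    (Submodule.subtype_injective _) Function.injective_id ?_
  change TensorProduct.assoc ℂ _ C _ (LinearMap.rTensor _ _ (LinearMap.rTensor _ _ u)) =
    LinearMap.lTensor _ _ (LinearMap.rTensor _ _ u)
  rw [hu, shiftFactor, LinearMap.comp_apply, lTensor_rTensor_apply, ← LinearMap.rTensor_comp_apply]
  simp only [LinearMap.comp_apply (LinearEquiv.toLinearMap _), LinearEquiv.coe_coe]
  rw [← he.balanced_assoc_symm, rTensor_eqOn (P := H.box (L.powCoact q) (L.powCoact 0))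
    (g := ((Tpow.snoc T q ∘ₗ (TensorProduct.comm ℂ (Tpow T q) T).toLinearMap ∘ₗ
      TensorProduct.map (L.cotensorPower q).subtype L.inclOne).rTensor C ∘ₗ
      ((TensorProduct.assoc ℂ _ _ C).symm.toLinearMap ∘ₗ
        (H.rC (L.powCoact 0)).lTensor (L.cotensorPower q)))) (fun e he => ?_) hm,
    LinearMap.rTensor_comp_apply]
  · generalize ((TensorProduct.assoc ℂ _ _ C).symm.toLinearMap ∘ₗ
      (H.rC (L.powCoact 0)).lTensor (L.cotensorPower q)).rTensor (L.cotensorPower p) _ = v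
    refine TensorProduct.induction_on v (by simp) (fun v b => ?_)
      (fun x y hx hy => by simp only [map_add, hx, hy])
    exact TensorProduct.induction_on v (by simp) (fun x y => by simp)
      (fun x y hx hy => by simp only [map_add, add_tmul, hx, hy])
  · rw [LinearMap.comp_apply, ← H.comm_leftβ, SourceTarget.leftβ, LinearMap.comp_apply,
      hF.colinear e he, ← lTensor_rTensor_apply, H.leftβ_prodCoact (L.powCoact_isLeftCoaction q) h0 he,
      comm_lTensor, LinearMap.comp_apply]
    congr 1
    clear he
    refine TensorProduct.induction_on e (by simp) (fun a b => ?_)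
      (fun x y hx hy => by simp only [map_add, hx, hy])
    simp only [LinearMap.lTensor_tmul, LinearMap.comp_apply, ← H.comm_leftβ]
    exact TensorProduct.induction_on (H.leftβ (L.powCoact 0) b) (by simp) (fun x y => by simp)
      (fun x y hx hy => by simp only [map_add, tmul_add, hx, hy])

/-- Detaching t from tv and appending it to u are colinear; in between, u₋₁(t₋₁v₋₁) = (u₋₁t₋₁)v₋₁.
-/
theorem shiftFactor_colinear {p q : ℕ} {z : L.cotensorPower q ⊗[ℂ] L.cotensorPower (p + 1)}
    (hz : z ∈ H.box (L.powCoact q) (L.powCoact (p + 1)))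
    {u : L.cotensorPower (q + 1) ⊗[ℂ] L.cotensorPower p}
    (hu : (L.cotensorPower (q + 1)).subtype.rTensor _ u = L.shiftFactor p q z) :
    ((L.cotensorPower (q + 1)).subtype.rTensor _).lTensor K
        (H.prodCoact (L.powCoact (q + 1)) (L.powCoact p) u) =
      (L.shiftFactor p q).lTensor K (H.prodCoact (L.powCoact q) (L.powCoact (p + 1)) z) := by
  have hF := L.isColinearOn_snoc q
  have he := L.uncons_isBoxMap p
  have h0 := L.powCoact_isLeftCoaction 0
  have hp := L.powCoact_isLeftCoaction p
  have hq := L.powCoact_isLeftCoaction q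
  have hm := he.rslice_assoc_symm_mem h0 (L.powCoact_isLeftCoaction p) hz
  have h1 := H.prodCoact_map (ρA' := L.diagCoact H.mulExt (q + 1)) (ρB := L.powCoact p)
    (ρB' := L.powCoact p)
    (f := (L.cotensorPower (q + 1)).subtype) (g := LinearMap.id) L.diagCoact_coe
    (fun b => by simp) u
  have h2 := H.prodCoact_map_of_left (g := LinearMap.id) (ρB := L.powCoact p)
    (ρB' := L.powCoact p) hF.colinear
    (fun b => by simp) hm
  have h3 := H.prodCoact_map (ρA := L.powCoact q) (f := LinearMap.id) (g := L.uncons p)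
    (ρA' := L.powCoact q) (fun b => by simp) he.colinear z
  have h4 := H.prodCoact_assoc hq h0 hp (x := (L.uncons p).lTensor _ z) (fun φ => by
    rw [lslice_lTensor]; exact he.mem _) hm
  rw [shiftFactor, LinearMap.lTensor_comp_apply, LinearMap.lTensor_comp_apply]
  refine h1.symm.trans (Eq.trans ?_ (h2.trans ?_))
  · exact congrArg _ hu
  · congr 1
    apply (TensorProduct.congr (LinearEquiv.refl ℂ K) (TensorProduct.assoc ℂ (L.cotensorPower q)
      (L.cotensorPower 0) (L.cotensorPower p))).injective
    refine h4.symm.trans (h3.trans ?_)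
    generalize H.prodCoact (L.powCoact q) (L.powCoact (p + 1)) z = w
    refine TensorProduct.induction_on w (by simp) (fun k w => ?_)
      (fun x y hx hy => by simp only [map_add, hx, hy])
    simp [LinearMap.lTensor]

end LeftComoduleCoalgebra

variable {L N}

/-- Moving a tensor factor across the middle of `M □_K (T^{□(q+1)} □_C T^{□(p+2)})`. -/
theorem LeftRightSAYD.IsCochain.exists_shiftFactor {p q : ℕ}
    {w : M ⊗[ℂ] (L.cotensorPower q ⊗[ℂ] L.cotensorPower (p + 1))}
    (hw : N.IsCochain (L.powCoact q) (L.powCoact (p + 1)) w) :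
    ∃ u : M ⊗[ℂ] (L.cotensorPower (q + 1) ⊗[ℂ] L.cotensorPower p),
      N.IsCochain (L.powCoact (q + 1)) (L.powCoact p) u ∧
      ((L.cotensorPower (q + 1)).subtype.rTensor _).lTensor M u =
        (L.shiftFactor p q).lTensor M w := by
  obtain ⟨u, hu⟩ := exists_lTensor_of_lslice (x := (L.shiftFactor p q).lTensor M w)
    ((L.cotensorPower (q + 1)).subtype.rTensor (L.cotensorPower p))
    (fun φ => by rw [lslice_lTensor]; exact L.shiftFactor_mem (hw.mem_box φ))
  have hs : ∀ φ, (L.cotensorPower (q + 1)).subtype.rTensor _ (lslice φ u) =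
      L.shiftFactor p q (lslice φ w) := fun φ => by
    rw [← lslice_lTensor, hu, lslice_lTensor]
  refine ⟨u, ⟨fun φ => L.shiftFactor_mem_box (hw.mem_box φ) (hs φ), ?_⟩, hu⟩
  apply lTensor_injective (lTensor_injective (rTensor_injective
    (Submodule.subtype_injective (L.cotensorPower (q + 1))) (L.cotensorPower p)) K) M
  rw [← assoc_rTensor_lTensor, hu, assoc_rTensor_lTensor, hw.coact_eq]
  refine lslice_ext fun φ => ?_
  simp only [lslice_lTensor]
  exact (L.shiftFactor_colinear (hw.mem_box φ) (hs φ)).symm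

end Cyclicity

theorem lslice_assoc_lTensor {M X A B D : Type*} [AddCommGroup M] [Module ℂ M]
    [AddCommGroup X] [Module ℂ X] [AddCommGroup A] [Module ℂ A]
    [AddCommGroup B] [Module ℂ B] [AddCommGroup D] [Module ℂ D] (φ : M →ₗ[ℂ] ℂ)
    (e : X →ₗ[ℂ] D ⊗[ℂ] A) (y : M ⊗[ℂ] (X ⊗[ℂ] B)) :
    lslice φ ((TensorProduct.assoc ℂ D A B).toLinearMap.lTensor M ((e.rTensor B).lTensor M y)) =
      TensorProduct.assoc ℂ D A B (e.rTensor B (lslice φ y)) :=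
  TensorProduct.induction_on y (by simp) (fun m v => by simp)
    (fun x y hx hy => by simp only [map_add, hx, hy])

section Cyclicity

variable {C K T M : Type*} [AddCommGroup C] [Module ℂ C] [Coalgebra ℂ C]
  [AddCommGroup K] [Module ℂ K] [Coalgebra ℂ K]
  [AddCommGroup T] [Module ℂ T] [Coalgebra ℂ T] [AddCommGroup M] [Module ℂ M]
  {H : LeftHopfCoalgebra C K} (L : LeftComoduleCoalgebra H T) (N : LeftRightSAYD H M)

/-- The rotation of `m ⊗ t ⊗ F(x)`, for a map `F` which is colinear on the slices of the tensor. -/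
theorem rotate_cons {X : Type*} [AddCommGroup X] [Module ℂ X] {n : ℕ} (mul' : K ⊗[ℂ] K →ₗ[ℂ] K)
    (act' : K ⊗[ℂ] M →ₗ[ℂ] M) {F : X →ₗ[ℂ] Tpow T n} {ρ : X →ₗ[ℂ] K ⊗[ℂ] X} {Q : Submodule ℂ X}
    (hF : ∀ b ∈ Q, L.diagCoact mul' n (F b) = F.lTensor K (ρ b))
    {x : M ⊗[ℂ] (L.cotensorPower 0 ⊗[ℂ] X)} (hx : ∀ φ ψ, lslice ψ (lslice φ x) ∈ Q) :
    rotate L mul' act' n (((Tpow.cons T n).toLinearMap ∘ₗ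
      TensorProduct.map L.inclOne F).lTensor M x) =
    (Tpow.snoc T n ∘ₗ (TensorProduct.comm ℂ (Tpow T n) T).toLinearMap ∘ₗ
      TensorProduct.map F L.inclOne).lTensor M (rot (L.cotensorPower 0) act' ρ x) := by
  let P : M ⊗[ℂ] (T ⊗[ℂ] (K ⊗[ℂ] Tpow T n)) →ₗ[ℂ] M ⊗[ℂ] Tpow T (n + 1) :=
    TensorProduct.map act' (Tpow.snoc T n) ∘ₗ
    (TensorProduct.comm ℂ M K).toLinearMap.rTensor (T ⊗[ℂ] Tpow T n) ∘ₗ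
    (TensorProduct.assoc ℂ M K (T ⊗[ℂ] Tpow T n)).symm.toLinearMap ∘ₗ
    (TensorProduct.leftComm ℂ T K (Tpow T n)).toLinearMap.lTensor M
  have h1 : ∀ x : M ⊗[ℂ] (L.cotensorPower 0 ⊗[ℂ] X), rotate L mul' act' n
      (((Tpow.cons T n).toLinearMap ∘ₗ TensorProduct.map L.inclOne F).lTensor M x) =
      P ((L.inclOne.rTensor _).lTensor M (((L.diagCoact mul' n ∘ₗ F).lTensor _).lTensor M x)) :=
      fun x => by
    refine tensor_ext₃ (f := rotate L mul' act' n ∘ₗ ((Tpow.cons T n).toLinearMap ∘ₗ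
      TensorProduct.map L.inclOne F).lTensor M) (g := P ∘ₗ (L.inclOne.rTensor _).lTensor M ∘ₗ
      ((L.diagCoact mul' n ∘ₗ F).lTensor _).lTensor M) (fun m a b => ?_) x
    simp [rotate, P]
  have h2 : ((L.diagCoact mul' n ∘ₗ F).lTensor (L.cotensorPower 0)).lTensor M x =
      ((F.lTensor K ∘ₗ ρ).lTensor (L.cotensorPower 0)).lTensor M x := by
    refine lslice_ext fun φ => ?_
    rw [lslice_lTensor, lslice_lTensor]
    exact lTensor_eqOn hF (hx φ)
  rw [h1, h2]
  refine tensor_ext₃ (f := P ∘ₗ (L.inclOne.rTensor _).lTensor M ∘ₗ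
      ((F.lTensor K ∘ₗ ρ).lTensor _).lTensor M) (g := (Tpow.snoc T n ∘ₗ
      (TensorProduct.comm ℂ (Tpow T n) T).toLinearMap ∘ₗ
      TensorProduct.map F L.inclOne).lTensor M ∘ₗ rot (L.cotensorPower 0) act' ρ)
      (fun m a b => ?_) x
  simp only [LinearMap.comp_apply, LinearMap.lTensor_tmul, LinearMap.rTensor_tmul, rot, preRot_tmul]
  refine TensorProduct.induction_on (ρ b) (by simp) (fun k b => ?_)
    (fun x y hx hy => by simp only [map_add, tmul_add, hx, hy])
  simp [P]

variable {L N}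

/-- The rotation of `m ⊗ t ⊗ F(a ⊗ b)` is obtained from that of `m ⊗ (t ⊗ a) ⊗ b`. -/
theorem LeftRightSAYD.IsCochain.rotate_cons_assoc {X A B : Type*} [AddCommGroup X] [Module ℂ X]
    [AddCommGroup A] [Module ℂ A] [AddCommGroup B] [Module ℂ B] {ρX : X →ₗ[ℂ] K ⊗[ℂ] X}
    {ρA : A →ₗ[ℂ] K ⊗[ℂ] A} {ρB : B →ₗ[ℂ] K ⊗[ℂ] B} (hX : IsLeftCoaction ρX)
    (hA : IsLeftCoaction ρA) (hB : IsLeftCoaction ρB) {e : X →ₗ[ℂ] L.cotensorPower 0 ⊗[ℂ] A}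
    (he : H.IsBoxMap (L.powCoact 0) ρA ρX e) {n : ℕ} {F : A ⊗[ℂ] B →ₗ[ℂ] Tpow T n}
    (hF : L.IsColinearOn (H.box ρA ρB) (H.prodCoact ρA ρB) F) {y : M ⊗[ℂ] (X ⊗[ℂ] B)}
    (hy : N.IsCochain ρX ρB y) :
    rotate L H.mulExt N.actExt n (((Tpow.cons T n).toLinearMap ∘ₗ TensorProduct.map L.inclOne F ∘ₗ
      (TensorProduct.assoc ℂ (L.cotensorPower 0) A B).toLinearMap ∘ₗ e.rTensor B).lTensor M y) =
    (Tpow.snoc T n ∘ₗ (TensorProduct.comm ℂ (Tpow T n) T).toLinearMap ∘ₗ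
      TensorProduct.map F L.inclOne ∘ₗ
      (TensorProduct.assoc ℂ A B (L.cotensorPower 0)).symm.toLinearMap).lTensor M
      (TimesHopf.rot (B ⊗[ℂ] L.cotensorPower 0) N.actExt ρA
        (((TensorProduct.assoc ℂ B (L.cotensorPower 0) A).symm.toLinearMap ∘ₗ
          e.lTensor B).lTensor M (TimesHopf.rot X N.actExt ρB y))) := by
  have hsl : ∀ φ ψ, lslice ψ (lslice φ ((TensorProduct.assoc ℂ (L.cotensorPower 0) A
      B).toLinearMap.lTensor M ((e.rTensor B).lTensor M y))) ∈ H.box ρA ρB := fun φ ψ => by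
    rw [lslice_assoc_lTensor]
    exact he.lslice_assoc_mem (L.powCoact_isLeftCoaction 0) hA (hy.mem_box φ) ψ
  have hrot : TimesHopf.rot (L.cotensorPower 0 ⊗[ℂ] A) N.actExt ρB ((e.rTensor B).lTensor M y) =
      (e.lTensor B).lTensor M (TimesHopf.rot X N.actExt ρB y) :=
    rot_map N.actExt e (g := LinearMap.id) (fun b => by simp) y
  -- Since (a₋₁b₋₁)▷m = a₋₁▷(b₋₁▷m), the rotation by the joint block a ⊗ b is a rotation by b
  -- followed by a rotation by a.
  have hhex := N.rot_prodCoact hA hB (x := (e.rTensor B).lTensor M y) (by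
    have hpre : preRot M _ ρB ((e.rTensor B).lTensor M y) =
        (TensorProduct.map LinearMap.id e).lTensor (K ⊗[ℂ] M) (preRot M X ρB y) :=
      preRot_map (M := M) e (g := LinearMap.id) (fun b => by simp) y
    rw [hpre, ← lTensor_rTensor_apply, hy.preRot_balanced hX hB, lTensor_rTensor_apply]) hsl
  have hr := rotate_cons L H.mulExt N.actExt hF.colinear hsl
  rw [hrot] at hhex
  rw [LinearMap.lTensor_comp_apply M _ (e.lTensor B), ← hhex, ← LinearMap.lTensor_comp_apply]
  refine (congrArg _ ?_).trans (hr.trans (congrFun (congrArg _ ?_) _))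
  · rw [← LinearMap.lTensor_comp_apply, ← LinearMap.lTensor_comp_apply]
    rfl
  · congr 1
    ext a b c
    simp

/-- One cyclic step on m ⊗ tvu. A block rotation gives u₋₁▷m ⊗ u₀ ⊗ tv; passing t to the end of u₀
gives w; rotating the block v of w gives v₋₁▷(u₋₁▷m) ⊗ v₀ ⊗ u₀t, whose concatenation is the cyclic
rotation of tvu. -/
theorem LeftRightSAYD.IsCochain.rotate_concat {p q n : ℕ}
    {f : Tpow T p ⊗[ℂ] Tpow T q →ₗ[ℂ] Tpow T n} (hf : Tpow.Concat f)
    {f' : Tpow T p ⊗[ℂ] Tpow T (q + 1) →ₗ[ℂ] Tpow T (n + 1)}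
    (hff : ∀ v t u, f' (v ⊗ₜ Tpow.snoc T q (t ⊗ₜ u)) = Tpow.snoc T n (t ⊗ₜ f (v ⊗ₜ u)))
    {y : M ⊗[ℂ] (L.cotensorPower (p + 1) ⊗[ℂ] L.cotensorPower q)}
    (hy : N.IsCochain (L.powCoact (p + 1)) (L.powCoact q) y)
    {w : M ⊗[ℂ] (L.cotensorPower (q + 1) ⊗[ℂ] L.cotensorPower p)}
    (hw : ((L.cotensorPower (q + 1)).subtype.rTensor _).lTensor M w = (L.shiftFactor p q).lTensor M
      (TimesHopf.rot (L.cotensorPower (p + 1)) N.actExt (L.powCoact q) y)) :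
    rotate L H.mulExt N.actExt n ((((Tpow.cons T n).toLinearMap ∘ₗ f.lTensor T ∘ₗ
        (TensorProduct.assoc ℂ T (Tpow T p) (Tpow T q)).toLinearMap ∘ₗ
        (Tpow.cons T p).symm.toLinearMap.rTensor (Tpow T q)) ∘ₗ
        TensorProduct.map (L.cotensorPower (p + 1)).subtype
          (L.cotensorPower q).subtype).lTensor M y) =
      (f' ∘ₗ TensorProduct.map (L.cotensorPower p).subtype
        (L.cotensorPower (q + 1)).subtype).lTensor M
        (TimesHopf.rot (L.cotensorPower (q + 1)) N.actExt (L.powCoact p) w) := by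
  rw [L.concat_succ f, hy.rotate_cons_assoc (L.powCoact_isLeftCoaction _)
    (L.powCoact_isLeftCoaction _) (L.powCoact_isLeftCoaction _) (L.uncons_isBoxMap p)
    (L.isColinearOn_concat hf)]
  have h2 : TimesHopf.rot (Tpow T (q + 1)) N.actExt (L.powCoact p)
      (((L.cotensorPower (q + 1)).subtype.rTensor _).lTensor M w) =
      ((L.cotensorPower (q + 1)).subtype.lTensor _).lTensor M
        (TimesHopf.rot (L.cotensorPower (q + 1)) N.actExt (L.powCoact p) w) :=
    rot_map N.actExt (L.cotensorPower (q + 1)).subtype (g := LinearMap.id) (fun b => by simp) w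
  have h4 : f' ∘ₗ TensorProduct.map (L.cotensorPower p).subtype
      (L.cotensorPower (q + 1)).subtype = (f' ∘ₗ (L.cotensorPower p).subtype.rTensor _) ∘ₗ
      (L.cotensorPower (q + 1)).subtype.lTensor _ := by
    rw [LinearMap.comp_assoc, LinearMap.rTensor_comp_lTensor]
  rw [h4, LinearMap.lTensor_comp_apply M (f' ∘ₗ _), ← h2, hw, LeftComoduleCoalgebra.shiftFactor,
    LinearMap.lTensor_comp_apply M (LinearMap.rTensor _ _)]
  generalize ((TensorProduct.assoc ℂ (L.cotensorPower q) (L.cotensorPower 0)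
    (L.cotensorPower p)).symm.toLinearMap ∘ₗ (L.uncons p).lTensor (L.cotensorPower q)).lTensor M
    (TimesHopf.rot (L.cotensorPower (p + 1)) N.actExt (L.powCoact q) y) = z
  have h3 : TimesHopf.rot (Tpow T (q + 1)) N.actExt (L.powCoact p)
      (((Tpow.snoc T q ∘ₗ (TensorProduct.comm ℂ (Tpow T q) T).toLinearMap ∘ₗ
        TensorProduct.map (L.cotensorPower q).subtype L.inclOne).rTensor
        (L.cotensorPower p)).lTensor M z) =
      ((Tpow.snoc T q ∘ₗ (TensorProduct.comm ℂ (Tpow T q) T).toLinearMap ∘ₗ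
        TensorProduct.map (L.cotensorPower q).subtype L.inclOne).lTensor
        (L.cotensorPower p)).lTensor M (TimesHopf.rot _ N.actExt (L.powCoact p) z) :=
    rot_map N.actExt _ (g := LinearMap.id) (fun b => by simp) z
  rw [h3, ← LinearMap.lTensor_comp_apply]
  congr 2
  ext a b c
  simp [hff]

/-- Induction on the length of the first block. By `rotate_concat` the first of the p + 2 steps
leads from tv | u to `rot` w, with blocks v | u₀t. By induction the other p + 1 steps apply `rot`
once more, and `rot_rot` returns w. But w is the block rotation of the original cochain with t moved
across the boundary of the blocks, which concatenation does not see. -/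
theorem LeftRightSAYD.IsCochain.rotate_pow {p q n : ℕ}
    {f : Tpow T p ⊗[ℂ] Tpow T q →ₗ[ℂ] Tpow T (n + 1)} (hf : Tpow.Concat f)
    {g : Tpow T q ⊗[ℂ] Tpow T p →ₗ[ℂ] Tpow T (n + 1)} (hg : Tpow.Concat g)
    {y : M ⊗[ℂ] (L.cotensorPower p ⊗[ℂ] L.cotensorPower q)}
    (hy : N.IsCochain (L.powCoact p) (L.powCoact q) y) :
    (rotate L H.mulExt N.actExt n ^ (p + 1)) ((f ∘ₗ TensorProduct.map (L.cotensorPower p).subtype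
      (L.cotensorPower q).subtype).lTensor M y) =
    (g ∘ₗ TensorProduct.map (L.cotensorPower q).subtype (L.cotensorPower p).subtype).lTensor M
      (TimesHopf.rot (L.cotensorPower p) N.actExt (L.powCoact q) y) := by
  induction p generalizing q with
  | zero =>
    cases hf
    rw [zero_add, pow_one]
    have h2 : g ∘ₗ TensorProduct.map (L.cotensorPower n).subtype (L.cotensorPower 0).subtype =
        Tpow.snoc T n ∘ₗ (TensorProduct.comm ℂ (Tpow T n) T).toLinearMap ∘ₗ
          TensorProduct.map (L.cotensorPower n).subtype L.inclOne := by
      ext a b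
      exact hg.eq_snoc a (L.inclOne b)
    rw [L.concat_zero, h2]
    exact rotate_cons L H.mulExt N.actExt (Q := ⊤) (fun b _ => L.diagCoact_coe b)
      (fun _ _ => Submodule.mem_top)
  | succ p ih =>
    have hp := L.powCoact_isLeftCoaction p
    have hq' := L.powCoact_isLeftCoaction (q + 1)
    cases hf with
    | succ f hf =>
    obtain ⟨f', hf', hff⟩ := hf.exists_snoc
    obtain ⟨g', hg', hgg⟩ := hg.exists_shift
    obtain ⟨w, hw, hw'⟩ := (hy.rot (L.powCoact_isLeftCoaction _)
      (L.powCoact_isLeftCoaction q)).exists_shiftFactor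
    rw [pow_succ, Module.End.mul_apply, hy.rotate_concat hf hff hw', ih hf' hg' (hw.rot hq' hp),
      hw.rot_rot hq' hp]
    have h5 : g' ∘ₗ TensorProduct.map (L.cotensorPower (q + 1)).subtype
        (L.cotensorPower p).subtype = (g' ∘ₗ (L.cotensorPower p).subtype.lTensor _) ∘ₗ
          (L.cotensorPower (q + 1)).subtype.rTensor _ := by
      rw [LinearMap.comp_assoc, LinearMap.lTensor_comp_rTensor]
    rw [h5, LinearMap.lTensor_comp_apply, hw', ← LinearMap.lTensor_comp_apply]
    congr 2
    ext b a
    have h6 : (a : Tpow T (p + 1)) = Tpow.cons T p (TensorProduct.map L.inclOne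
        (L.cotensorPower p).subtype (L.uncons p a)) := by
      rw [L.map_uncons, LinearEquiv.apply_symm_apply]
    simp only [AlgebraTensorModule.curry_apply, curry_apply,
        LinearMap.coe_restrictScalars, LinearMap.comp_apply, LinearEquiv.coe_coe,
        TensorProduct.map_tmul, LinearMap.lTensor_tmul, Submodule.subtype_apply,
        LeftComoduleCoalgebra.shiftFactor, h6]
    exact TensorProduct.induction_on (L.uncons p a) (by simp) (fun x y => by simp [hgg])
        (fun x y hx hy => by simp only [map_add, tmul_add, hx, hy])

end Cyclicity

/-! ### Cochains as elements of M □_K (A □_C B); independence of the extensions. -/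

section Cochains

variable {C K T M : Type*} [AddCommGroup C] [Module ℂ C] [Coalgebra ℂ C]
  [AddCommGroup K] [Module ℂ K] [Coalgebra ℂ K]
  [AddCommGroup T] [Module ℂ T] [Coalgebra ℂ T] [AddCommGroup M] [Module ℂ M]
  {H : LeftHopfCoalgebra C K} {L : LeftComoduleCoalgebra H T} {N : LeftRightSAYD H M}

theorem LeftComoduleCoalgebra.IsColinearOn.lTensor_mem_cochains {X : Type*} [AddCommGroup X]
    [Module ℂ X] {Q : Submodule ℂ X} {ρ : X →ₗ[ℂ] K ⊗[ℂ] X} {n : ℕ} {F : X →ₗ[ℂ] Tpow T n}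
    (hF : L.IsColinearOn Q ρ F) {x : M ⊗[ℂ] X} (hQ : ∀ φ : M →ₗ[ℂ] ℂ, lslice φ x ∈ Q)
    (hx : TensorProduct.assoc ℂ M K X (N.coact.rTensor X x) = ρ.lTensor M x) :
    F.lTensor M x ∈ cochains L N n := by
  refine ⟨(mem_range_lTensor_iff _ _).2 fun φ => ?_, ?_⟩
  · rw [lslice_lTensor]
    exact hF.mem _ (hQ φ)
  · change TensorProduct.assoc ℂ M K _ (N.coact.rTensor _ (F.lTensor M x)) =
      (L.diagCoact H.mulExt n).lTensor M (F.lTensor M x)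
    rw [assoc_rTensor_lTensor, hx, ← LinearMap.lTensor_comp_apply, ← LinearMap.lTensor_comp_apply]
    exact (lTensor_eqOn (f := L.diagCoact H.mulExt n ∘ₗ F) (g := F.lTensor K ∘ₗ ρ)
      hF.colinear hQ).symm

/-- Through this identification the statements on two blocks apply to every cochain of positive
degree, with first block T^{□1}. -/
theorem exists_of_mem_cochains_succ {n : ℕ} {x : M ⊗[ℂ] Tpow T (n + 1)}
    (hx : x ∈ cochains L N (n + 1)) :
    ∃ y : M ⊗[ℂ] (L.cotensorPower 0 ⊗[ℂ] L.cotensorPower n),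
      N.IsCochain (L.powCoact 0) (L.powCoact n) y ∧ ((Tpow.cons T n).toLinearMap ∘ₗ
        TensorProduct.map L.inclOne (L.cotensorPower n).subtype).lTensor M y = x := by
  obtain ⟨⟨z, rfl⟩, hz⟩ := hx
  have hu := L.uncons_isBoxMap n
  refine ⟨(L.uncons n).lTensor M z, ⟨fun φ => ?_, ?_⟩, ?_⟩
  · rw [lslice_lTensor]
    exact hu.mem _
  · have hz' : TensorProduct.assoc ℂ M K _ (N.coact.rTensor _
        ((L.cotensorPower (n + 1)).subtype.lTensor M z)) =
        (L.diagCoact H.mulExt (n + 1)).lTensor M ((L.cotensorPower (n + 1)).subtype.lTensor M z) :=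
      hz
    have h1 : L.diagCoact H.mulExt (n + 1) ∘ₗ (L.cotensorPower (n + 1)).subtype =
        (L.cotensorPower (n + 1)).subtype.lTensor K ∘ₗ L.powCoact (n + 1) :=
      LinearMap.ext L.diagCoact_coe
    have h2 : H.prodCoact (L.powCoact 0) (L.powCoact n) ∘ₗ L.uncons n =
        (L.uncons n).lTensor K ∘ₗ L.powCoact (n + 1) := LinearMap.ext hu.colinear
    rw [assoc_rTensor_lTensor, ← LinearMap.lTensor_comp_apply, h1,
      LinearMap.lTensor_comp_apply] at hz'
    rw [assoc_rTensor_lTensor, ← LinearMap.lTensor_comp_apply, h2, LinearMap.lTensor_comp_apply,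
      lTensor_injective (lTensor_injective (Submodule.subtype_injective _) K) M hz']
  · rw [L.subtype_succ, ← LinearMap.lTensor_comp_apply, LinearMap.comp_assoc]

theorem LeftRightSAYD.IsCochain.lTensor_concat_mem {p q n : ℕ}
    {f : Tpow T p ⊗[ℂ] Tpow T q →ₗ[ℂ] Tpow T n} (hf : Tpow.Concat f)
    {y : M ⊗[ℂ] (L.cotensorPower p ⊗[ℂ] L.cotensorPower q)}
    (hy : N.IsCochain (L.powCoact p) (L.powCoact q) y) :
    (f ∘ₗ TensorProduct.map (L.cotensorPower p).subtype (L.cotensorPower q).subtype).lTensor M y ∈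
      cochains L N n :=
  (L.isColinearOn_concat hf).lTensor_mem_cochains hy.mem_box hy.coact_eq

theorem rotate_mem {n : ℕ} {x : M ⊗[ℂ] Tpow T (n + 1)} (hx : x ∈ cochains L N (n + 1)) :
    rotate L H.mulExt N.actExt n x ∈ cochains L N (n + 1) := by
  obtain ⟨y, hy, rfl⟩ := exists_of_mem_cochains_succ hx
  obtain ⟨g, hg⟩ := Tpow.Concat.exists_snoc_concat T n
  have h := hy.rotate_pow (.cons n) hg
  rw [zero_add, pow_one, L.concat_zero] at h
  rw [h]
  exact (hy.rot (L.powCoact_isLeftCoaction 0) (L.powCoact_isLeftCoaction n)).lTensor_concat_mem hg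

/-- One step is the block rotation with a first block of length 1, and the other n + 1 steps are the
block rotation with a first block of length n + 1. Their composite is `rot` twice. -/
theorem rotate_pow_eq {n : ℕ} {x : M ⊗[ℂ] Tpow T (n + 1)} (hx : x ∈ cochains L N (n + 1)) :
    (rotate L H.mulExt N.actExt n ^ (n + 2)) x = x := by
  obtain ⟨y, hy, rfl⟩ := exists_of_mem_cochains_succ hx
  obtain ⟨g, hg⟩ := Tpow.Concat.exists_snoc_concat T n
  have h0 := L.powCoact_isLeftCoaction 0
  have hn := L.powCoact_isLeftCoaction n
  have h := hy.rotate_pow (.cons n) hg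
  have h' := (hy.rot h0 hn).rotate_pow hg (.cons n)
  rw [zero_add, pow_one, L.concat_zero] at h
  rw [pow_succ, Module.End.mul_apply, h, h', hy.rot_rot h0 hn, L.concat_zero]

section Independence

variable {mul' : K ⊗[ℂ] K →ₗ[ℂ] K} {act' : K ⊗[ℂ] M →ₗ[ℂ] M}

/-- On `T^{□(n+1)}` the diagonal coaction does not depend on the extension of the product. -/
theorem LeftComoduleCoalgebra.diagCoact_eq (L : LeftComoduleCoalgebra H T)
    (hm : ∀ x : H.KK, mul' x = H.mul x) {n : ℕ}
    (x : L.cotensorPower n) : L.diagCoact mul' n x = L.diagCoact H.mulExt n x := by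
  induction n with
  | zero => rfl
  | succ n ih =>
    have h1 : ∀ m : K ⊗[ℂ] K →ₗ[ℂ] K, L.diagCoact m (n + 1) x =
        TensorProduct.map m (Tpow.cons T n).toLinearMap
          (bicoact L.coact (L.diagCoact m n) ((Tpow.cons T n).symm x)) := fun m => rfl
    have h2 : bicoact L.coact (L.diagCoact mul' n) ((Tpow.cons T n).symm x) =
        bicoact L.coact (L.diagCoact H.mulExt n) ((Tpow.cons T n).symm x) := by
      rw [← L.map_uncons]
      simp only [bicoact, LinearMap.comp_apply]
      congr 1
      exact TensorProduct.induction_on (L.uncons n x) (by simp) (fun a b => by simp [ih b])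
        (fun x y hx hy => by simp only [map_add, hx, hy])
    rw [h1, h1, h2, ← L.map_uncons, bicoact_map L.coact_inclOne L.diagCoact_coe]
    refine map_eqOn_left (P := H.KK) _ (fun e he => ?_) (fun φ => ?_)
    · rw [H.mulExt_eq he]
      exact hm ⟨e, he⟩
    · rw [rslice_lTensor]
      exact H.rslice_bicoact_mem (L.powCoact_isLeftCoaction 0) (L.powCoact_isLeftCoaction n)
        ((L.uncons_isBoxMap n).mem x) _

theorem cochainsWith_eq (hm : ∀ x : H.KK, mul' x = H.mul x) (n : ℕ) :
    cochainsWith L N mul' n = cochains L N n := by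
  ext x
  refine and_congr_right fun ⟨y, hy⟩ => ?_
  subst hy
  have h : L.diagCoact mul' n ∘ₗ (L.cotensorPower n).subtype =
      L.diagCoact H.mulExt n ∘ₗ (L.cotensorPower n).subtype :=
    LinearMap.ext (L.diagCoact_eq hm)
  change _ = LinearMap.lTensor _ _ _ ↔ _ = LinearMap.lTensor _ _ _
  rw [← LinearMap.lTensor_comp_apply, h, LinearMap.lTensor_comp_apply]

/-- The action is evaluated only at b₋₁ ⊗ m, whose slices lie in K □_C M by `preRot_balanced`, and
the product only where `diagCoact_eq` applies. -/
theorem rotate_eq (hm : ∀ x : H.KK, mul' x = H.mul x)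
    (ha : ∀ x : cotensor H.rightC N.coactC, act' x = N.act x) {n : ℕ} {x : M ⊗[ℂ] Tpow T (n + 1)}
    (hx : x ∈ cochains L N (n + 1)) :
    rotate L mul' act' n x = rotate L H.mulExt N.actExt n x := by
  obtain ⟨y, hy, rfl⟩ := exists_of_mem_cochains_succ hx
  have h0 := L.powCoact_isLeftCoaction 0
  have hn := L.powCoact_isLeftCoaction n
  rw [rotate_cons L mul' act' (Q := ⊤) (fun b _ => (L.diagCoact_eq hm b).trans (L.diagCoact_coe b))
    (fun _ _ => Submodule.mem_top), rotate_cons L H.mulExt N.actExt (Q := ⊤)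
    (fun b _ => L.diagCoact_coe b) (fun _ _ => Submodule.mem_top)]
  congr 1
  refine rTensor_eqOn (P := cotensor H.rightC N.coactC) (fun e he => ?_)
    (hy.rslice_preRot_mem h0 hn)
  rw [ha ⟨e, he⟩]
  exact (extend_apply _ N.act ⟨e, he⟩).symm

end Independence

end Cochains

/-! ### Colinearity of the counit contractions. -/

section Counits

variable {C K A B : Type*} [AddCommGroup C] [Module ℂ C] [Coalgebra ℂ C]
  [AddCommGroup K] [Module ℂ K] [Coalgebra ℂ K]
  [AddCommGroup A] [Module ℂ A] [AddCommGroup B] [Module ℂ B]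
  (H : LeftBicoalgebroid C K)
  {ρA : A →ₗ[ℂ] K ⊗[ℂ] A} {ρB : B →ₗ[ℂ] K ⊗[ℂ] B}

/-- Apply ε to the right colinearity of η. This allows β in place of α in a hypothesis of the form k
= η(α(k)). -/
theorem LeftBicoalgebroid.β_η (c : C) : H.β (H.η c) = c := by
  rw [← H.counit_rightC, H.η_rightC, ← LinearMap.rTensor_comp_apply]
  have h : Coalgebra.counit (R := ℂ) (A := K) ∘ₗ H.η = Coalgebra.counit := by
    ext c; exact H.counit_η c
  rw [h, Coalgebra.rTensor_counit_comul]
  simp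

/-- `ε(a₀)a₋₁b₋₁ ⊗ b₀ = ε(a)b₋₁ ⊗ b₀`. -/
theorem LeftBicoalgebroid.lslice_prodCoact {χ : A →ₗ[ℂ] ℂ} (hB : IsLeftCoaction ρB)
    (hχ : ∀ a, rslice χ (ρA a) = H.η (H.α (rslice χ (ρA a)))) {y : A ⊗[ℂ] B}
    (hy : y ∈ H.box ρA ρB) :
    (lslice χ).lTensor K (H.prodCoact ρA ρB y) = ρB (lslice χ y) := by
  -- γ(a) = β(a₋₁)χ(a₀), so that a₋₁χ(a₀) = η(γ(a)). Balancing replaces γ(a) ⊗ b by χ(a)α(b₋₁) ⊗ b₀,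
  -- after which the unit law η(α(k₁))k₂ = k applies to k = b₋₁.
  let γ : A →ₗ[ℂ] C := lslice χ ∘ₗ H.rC ρA
  have hγ : ∀ a, rslice χ (ρA a) = H.η (γ a) := fun a => by
    have h : γ a = H.β (rslice χ (ρA a)) := by
      simp only [γ, LinearMap.comp_apply, SourceTarget.rC, LinearEquiv.coe_coe]
      rw [lslice_lTensor, lslice_comm]
    rw [h, hχ a, H.β_η]
  have h1 : γ.rTensor B y = H.lC ρB (lslice χ y) := by
    have hy' : TensorProduct.assoc ℂ A C B ((H.rC ρA).rTensor B y) = (H.lC ρB).lTensor A y := hy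
    rw [← lslice_lTensor, ← hy', LinearMap.rTensor_comp_apply]
    generalize (H.rC ρA).rTensor B y = w
    refine TensorProduct.induction_on w (by simp) (fun u b => ?_)
      (fun x y hx hy => by simp only [map_add, hx, hy])
    exact TensorProduct.induction_on u (by simp) (fun x y => by simp [TensorProduct.smul_tmul'])
      (fun x y hx hy => by simp only [map_add, add_tmul, hx, hy])
  have h2 : (lslice χ).lTensor K (H.prodCoact ρA ρB y) = H.mulExt.rTensor B
      ((TensorProduct.assoc ℂ K K B).symm (H.η.rTensor _ (ρB.lTensor C (γ.rTensor B y)))) := by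
    clear hy h1
    refine TensorProduct.induction_on y (by simp) (fun a b => ?_)
      (fun x y hx hy => by simp only [map_add, hx, hy])
    simp only [LinearMap.rTensor_tmul, LinearMap.lTensor_tmul, ← hγ, prodCoact, bicoact,
      LinearMap.comp_apply, TensorProduct.map_tmul, LinearEquiv.coe_coe]
    refine TensorProduct.induction_on (ρA a) (by simp) (fun k a => ?_)
      (fun x y hx hy => by simp only [map_add, add_tmul, hx, hy])
    exact TensorProduct.induction_on (ρB b) (by simp)
      (fun x y => by simp [← TensorProduct.smul_tmul'])
      (fun x y hx hy => by simp only [map_add, tmul_add, hx, hy])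
  rw [h2, h1, H.lC_coassoc hB]
  have h3 : H.mulExt ∘ₗ H.η.rTensor K ∘ₗ H.leftC = LinearMap.id := by ext k; exact H.one_mul k
  calc _ = (H.mulExt ∘ₗ H.η.rTensor K ∘ₗ H.leftC).rTensor B (ρB (lslice χ y)) := by
        refine TensorProduct.induction_on (ρB (lslice χ y)) (by simp) (fun k b => ?_)
          (fun x y hx hy => by simp only [map_add, hx, hy])
        simp only [LinearMap.rTensor_tmul, LinearMap.comp_apply]
        exact TensorProduct.induction_on (H.leftC k) (by simp) (fun x y => by simp)
          (fun x y hx hy => by simp only [map_add, add_tmul, hx, hy])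
    _ = _ := by rw [h3, LinearMap.rTensor_id, LinearMap.id_apply]

/-- `a₋₁b₋₁ε(b₀) ⊗ a₀ = a₋₁ ⊗ a₀ε(b)`. -/
theorem LeftBicoalgebroid.rslice_prodCoact {ψ : B →ₗ[ℂ] ℂ} (hA : IsLeftCoaction ρA)
    (hψ : ∀ b, rslice ψ (ρB b) = H.η (H.α (rslice ψ (ρB b)))) {y : A ⊗[ℂ] B}
    (hy : y ∈ H.box ρA ρB) :
    (rslice ψ).lTensor K (H.prodCoact ρA ρB y) = ρA (rslice ψ y) := by
  let γ : B →ₗ[ℂ] C := rslice ψ ∘ₗ H.lC ρB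
  have hγ : ∀ b, rslice ψ (ρB b) = H.η (γ b) := fun b => by
    have h : γ b = H.α (rslice ψ (ρB b)) := by
      simp only [γ, LinearMap.comp_apply, SourceTarget.lC]
      rw [rslice_rTensor]
      rfl
    rw [h, ← hψ b]
  have h1 : γ.lTensor A y = H.rC ρA (rslice ψ y) := by
    have hy' : TensorProduct.assoc ℂ A C B ((H.rC ρA).rTensor B y) = (H.lC ρB).lTensor A y := hy
    rw [← rslice_rTensor, LinearMap.lTensor_comp_apply, ← hy']
    generalize (H.rC ρA).rTensor B y = w
    refine TensorProduct.induction_on w (by simp) (fun u b => ?_)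
      (fun x y hx hy => by simp only [map_add, hx, hy])
    exact TensorProduct.induction_on u (by simp) (fun x y => by simp)
      (fun x y hx hy => by simp only [map_add, add_tmul, hx, hy])
  have h2 : (rslice ψ).lTensor K (H.prodCoact ρA ρB y) = H.mulExt.rTensor A
      (TensorProduct.rightComm ℂ K A K (H.η.lTensor _ (ρA.rTensor C (γ.lTensor A y)))) := by
    clear hy h1
    refine TensorProduct.induction_on y (by simp) (fun a b => ?_)
      (fun x y hx hy => by simp only [map_add, hx, hy])
    simp only [LinearMap.rTensor_tmul, LinearMap.lTensor_tmul, ← hγ, prodCoact, bicoact,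
      LinearMap.comp_apply, TensorProduct.map_tmul, LinearEquiv.coe_coe]
    refine TensorProduct.induction_on (ρA a) (by simp) (fun k a => ?_)
      (fun x y hx hy => by simp only [map_add, add_tmul, hx, hy])
    exact TensorProduct.induction_on (ρB b) (by simp)
      (fun x y => by simp)
      (fun x y hx hy => by simp only [map_add, tmul_add, hx, hy])
  rw [h2, h1, H.rC_coassoc hA]
  have h3 : H.mulExt ∘ₗ H.η.lTensor K ∘ₗ H.rightC = LinearMap.id := by ext k; exact H.mul_one k
  calc _ = (H.mulExt ∘ₗ H.η.lTensor K ∘ₗ H.rightC).rTensor A (ρA (rslice ψ y)) := by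
        refine TensorProduct.induction_on (ρA (rslice ψ y)) (by simp) (fun k b => ?_)
          (fun x y hx hy => by simp only [map_add, hx, hy])
        simp only [LinearMap.rTensor_tmul, LinearMap.comp_apply]
        exact TensorProduct.induction_on (H.rightC k) (by simp) (fun x y => by simp)
          (fun x y hx hy => by simp only [map_add, add_tmul, hx, hy])
    _ = _ := by rw [h3, LinearMap.rTensor_id, LinearMap.id_apply]

end Counits

/-! ### Cofaces and codegeneracies are colinear on cotensor powers. -/

section StructureMaps

variable {C K T M : Type*} [AddCommGroup C] [Module ℂ C] [Coalgebra ℂ C]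
  [AddCommGroup K] [Module ℂ K] [Coalgebra ℂ K]
  [AddCommGroup T] [Module ℂ T] [Coalgebra ℂ T] [AddCommGroup M] [Module ℂ M]
  {H : LeftHopfCoalgebra C K} {L : LeftComoduleCoalgebra H T} {N : LeftRightSAYD H M}

namespace LeftComoduleCoalgebra

variable (L) in
/-- `F` restricts to a colinear map `T^{□(n+1)} → T^{□(m+1)}`. -/
abbrev IsColinear {n m : ℕ} (F : Tpow T n →ₗ[ℂ] Tpow T m) : Prop :=
  L.IsColinearOn (L.cotensorPower n) (L.diagCoact H.mulExt n) F

variable {n m : ℕ} {F : Tpow T n →ₗ[ℂ] Tpow T m}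

theorem IsColinear.lTensor_mem_cochains (hF : L.IsColinear F) {x : M ⊗[ℂ] Tpow T n}
    (hx : x ∈ cochains L N n) : F.lTensor M x ∈ cochains L N m :=
  IsColinearOn.lTensor_mem_cochains hF ((mem_range_lTensor_iff _ _).1 hx.1) hx.2

theorem IsColinear.comp_subtype (hF : L.IsColinear F) :
    L.IsColinearOn ⊤ (L.powCoact n) (F ∘ₗ (L.cotensorPower n).subtype) :=
  ⟨fun x _ => hF.mem _ x.2, fun x _ => by
    rw [LinearMap.lTensor_comp_apply, ← L.diagCoact_coe]
    exact hF.colinear _ x.2⟩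

theorem isColinear_succ {F : Tpow T (n + 1) →ₗ[ℂ] Tpow T m}
    (h1 : ∀ x ∈ L.cotensorPower (n + 1), F x ∈ L.cotensorPower m)
    (h2 : ∀ y ∈ H.box (L.powCoact 0) (L.powCoact n), L.diagCoact H.mulExt m (F (Tpow.cons T n
      (TensorProduct.map L.inclOne (L.cotensorPower n).subtype y))) = (F ∘ₗ
        (Tpow.cons T n).toLinearMap ∘ₗ TensorProduct.map L.inclOne
          (L.cotensorPower n).subtype).lTensor K (H.prodCoact (L.powCoact 0) (L.powCoact n) y)) :
    L.IsColinear F := by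
  refine ⟨h1, fun x hx => ?_⟩
  have hu := L.uncons_isBoxMap n
  have h3 := h2 _ (hu.mem ⟨x, hx⟩)
  rw [L.map_uncons, LinearEquiv.apply_symm_apply, hu.colinear, ← LinearMap.lTensor_comp_apply,
    LinearMap.comp_assoc, LinearMap.comp_assoc, ← L.subtype_succ, LinearMap.lTensor_comp_apply,
    ← L.diagCoact_coe] at h3
  exact h3

theorem IsColinear.lTensor (hF : L.IsColinear F) : L.IsColinear
    ((Tpow.cons T m).toLinearMap ∘ₗ F.lTensor T ∘ₗ (Tpow.cons T n).symm.toLinearMap) := by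
  have key := fun y hy => hF.comp_subtype.cons (z := y) hy (fun _ => Submodule.mem_top)
  have h1 : ∀ y, TensorProduct.map L.inclOne (F ∘ₗ (L.cotensorPower n).subtype) y =
      F.lTensor T (TensorProduct.map L.inclOne (L.cotensorPower n).subtype y) := fun y => by
    rw [← LinearMap.comp_apply, LinearMap.lTensor_comp_map]
  refine isColinear_succ (fun x hx => ?_) (fun y hy => ?_)
  · have h2 := (key _ ((L.uncons_isBoxMap n).mem ⟨x, hx⟩)).1
    rw [h1, L.map_uncons] at h2
    exact h2
  · have h2 := (key y hy).2
    rw [h1] at h2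
    simp only [LinearMap.comp_apply, LinearEquiv.coe_coe, LinearEquiv.symm_apply_apply]
    rw [h2]
    congr 2
    ext a b
    simp

/-- The two conditions are the axioms `cobalanced` and `comul_coact` of a comodule coalgebra. -/
theorem isColinear_comulAt_zero (i : Fin 1) : L.IsColinear (Tpow.comulAt T 0 i) := by
  have h1 : ∀ x, L.diagCoact H.mulExt 0 (Tpow.one T x) = (Tpow.one T).toLinearMap.lTensor K
    (L.coact x) := fun x => rfl
  constructor
  · intro x _
    refine L.cons_mem ?_ fun φ => Submodule.mem_top
    exact map_mem_cotensor (f := LinearMap.id) (g := (Tpow.one T).toLinearMap) (r := L.rightC)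
      (l := L.leftC) (fun a => by simp) (fun b => rfl) (L.cobalanced ((Tpow.one T).symm x))
  · intro x _
    obtain ⟨t, rfl⟩ := (Tpow.one T).surjective x
    have h2 := H.prodCoact_map (f := LinearMap.id) (ρA := L.coact) (ρA' := L.coact)
      (fun a => by simp) h1 (Coalgebra.comul (R := ℂ) t)
    have h3 : H.prodCoact L.coact L.coact (Coalgebra.comul (R := ℂ) t) =
      Coalgebra.comul.lTensor K (L.coact t) := (L.comul_coact t).symm
    have h4 : Tpow.comulAt T 0 i (Tpow.one T t) = Tpow.cons T 0 (TensorProduct.map LinearMap.id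
      (Tpow.one T).toLinearMap (Coalgebra.comul (R := ℂ) t)) := rfl
    rw [h4, diagCoact_succ, LinearEquiv.symm_apply_apply, h2, h3, h1,
      ← LinearMap.lTensor_comp_apply, ← LinearMap.lTensor_comp_apply,
      ← LinearMap.lTensor_comp_apply]
    rfl

/-- Δ restricts to a colinear map D from T^{□1} to T^{□2}. The coface is D ⊗ id followed by
concatenation of T^{□2} with the tail, and both are colinear. -/
theorem isColinear_comulAt_succ_zero (n : ℕ) : L.IsColinear (Tpow.comulAt T (n + 1) 0) := by
  have hΔ := L.isColinear_comulAt_zero 0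
  let D : L.cotensorPower 0 →ₗ[ℂ] L.cotensorPower 1 :=
    (Tpow.comulAt T 0 0).restrict hΔ.mem
  have hsub : (L.cotensorPower 1).subtype ∘ₗ D =
    Tpow.comulAt T 0 0 ∘ₗ (L.cotensorPower 0).subtype := rfl
  have hD : ∀ a, L.powCoact 1 (D a) = D.lTensor K (L.powCoact 0 a) := fun a => by
    apply lTensor_injective (Submodule.subtype_injective (L.cotensorPower 1)) K
    rw [← L.diagCoact_coe, ← LinearMap.lTensor_comp_apply, hsub, LinearMap.lTensor_comp_apply,
      ← L.diagCoact_coe]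
    exact hΔ.colinear _ a.2
  have hf := L.isColinearOn_concat (.succ _ (.cons n))
  have hbox : ∀ y ∈ H.box (L.powCoact 0) (L.powCoact n),
      TensorProduct.map D LinearMap.id y ∈ H.box (L.powCoact 1) (L.powCoact n) := fun y hy =>
    map_mem_cotensor (H.rC_map hD) (fun b => by simp) hy
  have hpr : ∀ y, H.prodCoact (L.powCoact 1) (L.powCoact n) (TensorProduct.map D LinearMap.id y) =
      (TensorProduct.map D LinearMap.id).lTensor K (H.prodCoact (L.powCoact 0) (L.powCoact n) y) :=
    fun y => H.prodCoact_map hD (fun b => by simp) y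
  have heq : Tpow.comulAt T (n + 1) 0 ∘ₗ (Tpow.cons T n).toLinearMap ∘ₗ TensorProduct.map L.inclOne
      (L.cotensorPower n).subtype = (((Tpow.cons T (n + 1)).toLinearMap ∘ₗ
      ((Tpow.cons T n).toLinearMap ∘ₗ (Tpow.one T).symm.toLinearMap.rTensor (Tpow T n)).lTensor T ∘ₗ
        (TensorProduct.assoc ℂ T (Tpow T 0) (Tpow T n)).toLinearMap ∘ₗ
        (Tpow.cons T 0).symm.toLinearMap.rTensor (Tpow T n)) ∘ₗ
        TensorProduct.map (L.cotensorPower 1).subtype (L.cotensorPower n).subtype) ∘ₗ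
      TensorProduct.map D LinearMap.id := by
    rw [LinearMap.comp_assoc, ← TensorProduct.map_comp, hsub]
    ext a b
    simp only [AlgebraTensorModule.curry_apply, curry_apply, LinearMap.coe_restrictScalars,
      LinearMap.comp_apply, LinearEquiv.coe_coe, TensorProduct.map_tmul, LinearMap.rTensor_tmul,
      Tpow.comulAt, Fin.cases_zero, LinearEquiv.symm_apply_apply, LinearMap.id_apply, inclOne,
      Submodule.subtype_apply]
    exact TensorProduct.induction_on (Coalgebra.comul (R := ℂ) ((Tpow.one T).symm (a : Tpow T 0)))
      (by simp) (fun x y => by simp) (fun x y hx hy => by simp only [map_add, add_tmul, hx, hy])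
  refine isColinear_succ (fun x hx => ?_) (fun y hy => ?_)
  · have h1 := hf.mem _ (hbox _ ((L.uncons_isBoxMap n).mem ⟨x, hx⟩))
    rw [← LinearMap.comp_apply, ← heq, LinearMap.comp_apply, LinearMap.comp_apply, L.map_uncons,
      LinearEquiv.coe_coe, LinearEquiv.apply_symm_apply] at h1
    exact h1
  · have h1 := hf.colinear _ (hbox y hy)
    rw [hpr, ← LinearMap.lTensor_comp_apply, ← heq] at h1
    exact (congrArg _ (LinearMap.congr_fun heq y)).trans h1

theorem isColinear_comulAt : ∀ (n : ℕ) (i : Fin (n + 1)), L.IsColinear (Tpow.comulAt T n i)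
  | 0, i => isColinear_comulAt_zero i
  | n + 1, i => by
    refine Fin.cases (isColinear_comulAt_succ_zero n) (fun j => ?_) i
    exact (isColinear_comulAt n j).lTensor

theorem counit_powCoact_zero (a : L.cotensorPower 0) :
    rslice (Coalgebra.counit ∘ₗ L.inclOne) (L.powCoact 0 a) =
      H.η (H.α (rslice (Coalgebra.counit ∘ₗ L.inclOne) (L.powCoact 0 a))) := by
  rw [← rslice_lTensor, ← L.coact_inclOne]
  exact L.counit_coact _

theorem isColinear_counit_head (n : ℕ) :
    L.IsColinear ((TensorProduct.lid ℂ (Tpow T n)).toLinearMap ∘ₗ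
    (Coalgebra.counit (R := ℂ) (A := T)).rTensor (Tpow T n) ∘ₗ
    (Tpow.cons T n).symm.toLinearMap) := by
  have h1 : ∀ y, lslice (Coalgebra.counit (R := ℂ) (A := T)) (TensorProduct.map L.inclOne
      (L.cotensorPower n).subtype y) =
      (L.cotensorPower n).subtype (lslice (Coalgebra.counit ∘ₗ L.inclOne) y) := fun y =>
    TensorProduct.induction_on y (by simp) (fun x y => by simp)
      (fun x y hx hy => by simp only [map_add, hx, hy])
  refine isColinear_succ (fun x hx => ?_) (fun y hy => ?_)
  · have h2 := h1 (L.uncons n ⟨x, hx⟩)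
    rw [L.map_uncons] at h2
    exact h2 ▸ (lslice (Coalgebra.counit ∘ₗ L.inclOne) (L.uncons n ⟨x, hx⟩)).2
  · have h2 := H.lslice_prodCoact (L.powCoact_isLeftCoaction n) L.counit_powCoact_zero hy
    have h3 : ((TensorProduct.lid ℂ (Tpow T n)).toLinearMap ∘ₗ
        (Coalgebra.counit (R := ℂ) (A := T)).rTensor (Tpow T n) ∘ₗ
        (Tpow.cons T n).symm.toLinearMap) ∘ₗ (Tpow.cons T n).toLinearMap ∘ₗ
        TensorProduct.map L.inclOne (L.cotensorPower n).subtype =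
        (L.cotensorPower n).subtype ∘ₗ lslice (Coalgebra.counit ∘ₗ L.inclOne) := by
      ext a b
      simp
    rw [h3, LinearMap.lTensor_comp_apply, h2, ← L.diagCoact_coe]
    congr 1
    exact LinearMap.congr_fun h3 y

/-- The contracted factor has no factor on its right, so the unit law on the other side is used,
through `rslice_prodCoact`. Membership is automatic because T^{□1} is all of T. -/
theorem isColinear_counitAt_zero (i : Fin 1) : L.IsColinear (Tpow.counitAt T 0 i) := by
  refine isColinear_succ (fun x hx => Submodule.mem_top) (fun y hy => ?_)
  have h2 := H.rslice_prodCoact (L.powCoact_isLeftCoaction 0) L.counit_powCoact_zero hy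
  have h3 : Tpow.counitAt T 0 i ∘ₗ (Tpow.cons T 0).toLinearMap ∘ₗ
      TensorProduct.map L.inclOne (L.cotensorPower 0).subtype =
      (L.cotensorPower 0).subtype ∘ₗ rslice (Coalgebra.counit ∘ₗ L.inclOne) := by
    ext a b
    simp [Tpow.counitAt, inclOne]
  rw [h3, LinearMap.lTensor_comp_apply, h2, ← L.diagCoact_coe]
  congr 1
  exact LinearMap.congr_fun h3 y

theorem isColinear_counitAt : ∀ (n : ℕ) (i : Fin (n + 1)), L.IsColinear (Tpow.counitAt T n i)
  | 0, i => isColinear_counitAt_zero i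
  | n + 1, i => by
    refine Fin.cases (isColinear_counit_head n).lTensor (fun j => ?_) i
    exact (isColinear_counitAt n j).lTensor

end LeftComoduleCoalgebra
end StructureMaps

/-! ### The cosimplicial identities on tensor powers of T. -/

namespace Tpow

variable {T : Type*} [AddCommGroup T] [Module ℂ T]

/-- `t₀ ⊗ u ↦ t₀ ⊗ F(u)`. -/
def consMap {n m : ℕ} (F : Tpow T n →ₗ[ℂ] Tpow T m) : Tpow T (n + 1) →ₗ[ℂ] Tpow T (m + 1) :=
  (cons T m).toLinearMap ∘ₗ F.lTensor T ∘ₗ (cons T n).symm.toLinearMap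

@[simp]
theorem consMap_cons {n m : ℕ} (F : Tpow T n →ₗ[ℂ] Tpow T m) (t : T) (u : Tpow T n) :
    consMap F (cons T n (t ⊗ₜ u)) = cons T m (t ⊗ₜ F u) := by simp [consMap]

theorem hom_ext {n : ℕ} {E : Type*} [AddCommGroup E] [Module ℂ E] {f g : Tpow T (n + 1) →ₗ[ℂ] E}
    (h : ∀ t u, f (cons T n (t ⊗ₜ u)) = g (cons T n (t ⊗ₜ u))) : f = g :=
  LinearMap.ext fun x => induction_cons x (by simp) h
    (fun x y hx hy => by rw [map_add, map_add, hx, hy])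

theorem hom_ext_one {E : Type*} [AddCommGroup E] [Module ℂ E] {f g : Tpow T 0 →ₗ[ℂ] E}
    (h : ∀ t, f (one T t) = g (one T t)) : f = g :=
  LinearMap.ext h

theorem consMap_comp {n m k : ℕ} (F : Tpow T m →ₗ[ℂ] Tpow T k) (G : Tpow T n →ₗ[ℂ] Tpow T m) :
    consMap (F ∘ₗ G) = consMap F ∘ₗ consMap G :=
  hom_ext fun t u => by simp

theorem consMap_id (n : ℕ) : consMap (LinearMap.id : Tpow T n →ₗ[ℂ] Tpow T n) = LinearMap.id :=
  hom_ext fun t u => by simp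

theorem snoc_consMap {n m : ℕ} {F : Tpow T n →ₗ[ℂ] Tpow T m}
    {G : Tpow T (n + 1) →ₗ[ℂ] Tpow T (m + 1)} (h : ∀ t u, snoc T m (t ⊗ₜ F u) = G (snoc T n (t ⊗ₜ u)))
    (t : T) (u : Tpow T (n + 1)) :
    snoc T (m + 1) (t ⊗ₜ consMap F u) = consMap G (snoc T (n + 1) (t ⊗ₜ u)) :=
  induction_cons u (by simp) (fun s u => by simp [snoc_succ, h])
    (fun x y hx hy => by simp only [map_add, tmul_add, hx, hy])

variable [Coalgebra ℂ T]

/-- `t₀ ⊗ t₁ ⊗ ⋯ ⊗ tₙ₊₁ ↦ ε(t₀) t₁ ⊗ ⋯ ⊗ tₙ₊₁`. -/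
def counitHead (n : ℕ) : Tpow T (n + 1) →ₗ[ℂ] Tpow T n :=
  (TensorProduct.lid ℂ (Tpow T n)).toLinearMap ∘ₗ
    (Coalgebra.counit (R := ℂ) (A := T)).rTensor (Tpow T n) ∘ₗ (cons T n).symm.toLinearMap

@[simp]
theorem counitHead_cons (n : ℕ) (t : T) (u : Tpow T n) :
    counitHead n (cons T n (t ⊗ₜ u)) = Coalgebra.counit (R := ℂ) t • u := by
  simp [counitHead]

theorem counitHead_comp_consMap {n m : ℕ} (F : Tpow T n →ₗ[ℂ] Tpow T m) :
    counitHead m ∘ₗ consMap F = F ∘ₗ counitHead n :=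
  hom_ext fun t u => by simp

theorem counitAt_succ_zero (n : ℕ) : counitAt T (n + 1) 0 = consMap (counitHead n) := rfl

theorem counitAt_succ_succ (n : ℕ) (i : Fin (n + 1)) :
    counitAt T (n + 1) i.succ = consMap (counitAt T n i) := rfl

/-- A codegeneracy leaves the first factor alone, which is all that its commutation with a map near
that factor requires. When the target is T itself there is no such form, whence the separate base
cases below. -/
theorem exists_counitAt_succ_eq_consMap {n : ℕ} (i : Fin (n + 2)) :
    ∃ G : Tpow T (n + 1) →ₗ[ℂ] Tpow T n, counitAt T (n + 1) i = consMap G :=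
  Fin.cases ⟨_, rfl⟩ (fun _ => ⟨_, rfl⟩) i

theorem counitAt_zero_cons (i : Fin 1) (t s : T) : counitAt T 0 i (cons T 0 (t ⊗ₜ one T s)) =
    Coalgebra.counit (R := ℂ) s • one T t := by
  simp [counitAt]

theorem comulAt_zero_one (i : Fin 1) (t : T) : comulAt T 0 i (one T t) =
    cons T 0 ((one T).toLinearMap.lTensor T (Coalgebra.comul t)) := rfl

theorem comulAt_succ_zero_cons (n : ℕ) (t : T) (u : Tpow T n) :
    comulAt T (n + 1) 0 (cons T n (t ⊗ₜ u)) = cons T (n + 1) ((cons T n).toLinearMap.lTensor T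
      (TensorProduct.assoc ℂ T T (Tpow T n) (Coalgebra.comul t ⊗ₜ u))) := by
  simp [comulAt]

theorem comulAt_zero_comp_consMap {n m : ℕ} (F : Tpow T n →ₗ[ℂ] Tpow T m) :
    comulAt T (m + 1) 0 ∘ₗ consMap F = consMap (consMap F) ∘ₗ comulAt T (n + 1) 0 :=
  hom_ext fun t u => by
    simp only [LinearMap.comp_apply, consMap_cons, comulAt_succ_zero_cons]
    exact TensorProduct.induction_on (Coalgebra.comul (R := ℂ) t) (by simp) (fun x y => by simp)
      (fun x y hx hy => by simp only [map_add, add_tmul, hx, hy])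

theorem comulAt_one_comp_comulAt_zero (n : ℕ) : comulAt T (n + 1) 1 ∘ₗ comulAt T n 0 =
    comulAt T (n + 1) 0 ∘ₗ comulAt T n 0 := by
  have h1 : (comulAt T (n + 1) 1 : Tpow T (n + 1) →ₗ[ℂ] _) = consMap (comulAt T n 0) := rfl
  rw [h1]
  cases n with
  | zero =>
    refine hom_ext_one fun t => ?_
    have h2 : ∀ x : T ⊗[ℂ] T, consMap (comulAt T 0 0) (cons T 0 ((one T).toLinearMap.lTensor T x)) =
        cons T 1 ((cons T 0).toLinearMap.lTensor T (((one T).toLinearMap.lTensor T).lTensor T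
          ((Coalgebra.comul (R := ℂ) (A := T)).lTensor T x))) := fun x =>
      TensorProduct.induction_on x (by simp) (fun a b => by simp [comulAt_zero_one])
        (fun x y hx hy => by simp only [map_add, hx, hy])
    have h3 : ∀ x : T ⊗[ℂ] T, comulAt T 1 0 (cons T 0 ((one T).toLinearMap.lTensor T x)) =
        cons T 1 ((cons T 0).toLinearMap.lTensor T (((one T).toLinearMap.lTensor T).lTensor T
          (TensorProduct.assoc ℂ T T T
            ((Coalgebra.comul (R := ℂ) (A := T)).rTensor T x)))) := fun x =>
      TensorProduct.induction_on x (by simp) (fun a b => by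
          simp only [LinearMap.lTensor_tmul, comulAt_succ_zero_cons, LinearMap.rTensor_tmul]
          exact TensorProduct.induction_on (Coalgebra.comul (R := ℂ) a) (by simp)
            (fun x y => by simp) (fun x y hx hy => by simp only [map_add, add_tmul, hx, hy]))
        (fun x y hx hy => by simp only [map_add, hx, hy])
    rw [LinearMap.comp_apply, LinearMap.comp_apply, comulAt_zero_one, h2, h3, Coalgebra.coassoc_apply]
  | succ n =>
    refine hom_ext fun t u => ?_
    have h2 : ∀ x : T ⊗[ℂ] T, consMap (comulAt T (n + 1) 0) (cons T (n + 1)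
          ((cons T n).toLinearMap.lTensor T (TensorProduct.assoc ℂ T T (Tpow T n) (x ⊗ₜ u)))) =
        cons T (n + 2) ((cons T (n + 1)).toLinearMap.lTensor T
          (((cons T n).toLinearMap.lTensor T).lTensor T
          ((TensorProduct.assoc ℂ T T (Tpow T n)).toLinearMap.lTensor T
          (TensorProduct.assoc ℂ T (T ⊗[ℂ] T) (Tpow T n)
          ((Coalgebra.comul (R := ℂ) (A := T)).lTensor T x ⊗ₜ u))))) := fun x =>
      TensorProduct.induction_on x (by simp) (fun a b => by simp [comulAt_succ_zero_cons])
        (fun x y hx hy => by simp only [map_add, add_tmul, hx, hy])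
    have h3 : ∀ x : T ⊗[ℂ] T, comulAt T (n + 2) 0 (cons T (n + 1)
          ((cons T n).toLinearMap.lTensor T (TensorProduct.assoc ℂ T T (Tpow T n) (x ⊗ₜ u)))) =
        cons T (n + 2) ((cons T (n + 1)).toLinearMap.lTensor T
          (((cons T n).toLinearMap.lTensor T).lTensor T
          ((TensorProduct.assoc ℂ T T (Tpow T n)).toLinearMap.lTensor T
          (TensorProduct.assoc ℂ T (T ⊗[ℂ] T) (Tpow T n)
          (TensorProduct.assoc ℂ T T T
            ((Coalgebra.comul (R := ℂ) (A := T)).rTensor T x) ⊗ₜ u))))) := fun x =>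
      TensorProduct.induction_on x (by simp) (fun a b => by
          simp only [TensorProduct.assoc_tmul, LinearMap.lTensor_tmul, LinearMap.rTensor_tmul,
            LinearEquiv.coe_coe, comulAt_succ_zero_cons]
          exact TensorProduct.induction_on (Coalgebra.comul (R := ℂ) a) (by simp)
            (fun x y => by simp) (fun x y hx hy => by simp only [map_add, add_tmul, hx, hy]))
        (fun x y hx hy => by simp only [map_add, add_tmul, hx, hy])
    rw [LinearMap.comp_apply, LinearMap.comp_apply, comulAt_succ_zero_cons, h2, h3,
      Coalgebra.coassoc_apply]

/-- Factors that neither map touches are stripped from the front with `consMap`. When i = 0 the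
identity is coassociativity for j = 0 and the commutation of maps on disjoint factors otherwise. The
identities below follow the same scheme, with counitality in place of coassociativity. -/
theorem comulAt_comp_comulAt {n : ℕ} {i j : Fin (n + 1)} (h : i ≤ j) :
    comulAt T (n + 1) j.succ ∘ₗ comulAt T n i = comulAt T (n + 1) i.castSucc ∘ₗ comulAt T n j := by
  induction n with
  | zero =>
    obtain rfl := Subsingleton.elim (α := Fin 1) i 0
    obtain rfl := Subsingleton.elim (α := Fin 1) j 0
    exact comulAt_one_comp_comulAt_zero 0
  | succ n ih =>
    refine Fin.cases (fun h => ?_) (fun i h => ?_) i h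
    · refine Fin.cases ?_ (fun j => ?_) j
      · exact comulAt_one_comp_comulAt_zero (n + 1)
      · exact (comulAt_zero_comp_consMap (comulAt T n j)).symm
    · refine Fin.cases (fun h => absurd h (by simp)) (fun j h => ?_) j h
      have := congrArg consMap (ih (Fin.succ_le_succ_iff.1 h))
      rw [consMap_comp, consMap_comp] at this
      exact this

theorem counitAt_comp_counitAt {n : ℕ} {i j : Fin (n + 1)} (h : i ≤ j) :
    counitAt T n j ∘ₗ counitAt T (n + 1) i.castSucc =
      counitAt T n i ∘ₗ counitAt T (n + 1) j.succ := by
  induction n with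
  | zero =>
    obtain rfl := Subsingleton.elim (α := Fin 1) i 0
    obtain rfl := Subsingleton.elim (α := Fin 1) j 0
    change counitAt T 0 0 ∘ₗ consMap (counitHead 0) = counitAt T 0 0 ∘ₗ consMap (counitAt T 0 0)
    refine hom_ext fun t u => induction_cons u (by simp) (fun s u => ?_)
      (fun x y hx hy => by simp only [map_add, tmul_add, hx, hy])
    obtain ⟨u, rfl⟩ := (one T).surjective u
    simp only [LinearMap.comp_apply, consMap_cons, counitHead_cons, counitAt_zero_cons,
      TensorProduct.tmul_smul, map_smul]
    exact smul_comm _ _ _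
  | succ n ih =>
    have h0 : ∀ G : Tpow T (n + 1) →ₗ[ℂ] Tpow T n, consMap G ∘ₗ consMap (counitHead (n + 1)) =
        consMap (counitHead n) ∘ₗ consMap (consMap G) := fun G => by
      rw [← consMap_comp, ← consMap_comp, counitHead_comp_consMap]
    refine Fin.cases (fun h => ?_) (fun i h => ?_) i h
    · obtain ⟨G, hG⟩ := exists_counitAt_succ_eq_consMap (T := T) j
      rw [counitAt_succ_succ, hG]
      exact h0 G
    · refine Fin.cases (fun h => absurd h (by simp)) (fun j h => ?_) j h
      have := congrArg consMap (ih (Fin.succ_le_succ_iff.1 h))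
      rw [consMap_comp, consMap_comp] at this
      exact this

theorem counitAt_comp_comulAt_of_le {n : ℕ} {i j : Fin (n + 1)} (h : i ≤ j) :
    counitAt T (n + 1) j.succ ∘ₗ comulAt T (n + 1) i.castSucc =
      comulAt T n i ∘ₗ counitAt T n j := by
  induction n with
  | zero =>
    obtain rfl := Subsingleton.elim (α := Fin 1) i 0
    obtain rfl := Subsingleton.elim (α := Fin 1) j 0
    change consMap (counitAt T 0 0) ∘ₗ comulAt T 1 0 = comulAt T 0 0 ∘ₗ counitAt T 0 0
    refine hom_ext fun t u => ?_
    obtain ⟨u, rfl⟩ := (one T).surjective u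
    rw [LinearMap.comp_apply, LinearMap.comp_apply, counitAt_zero_cons, comulAt_succ_zero_cons,
      map_smul, comulAt_zero_one]
    exact TensorProduct.induction_on (Coalgebra.comul (R := ℂ) t) (by simp)
      (fun x y => by simp [counitAt_zero_cons])
      (fun x y hx hy => by simp only [map_add, add_tmul, smul_add, hx, hy])
  | succ n ih =>
    refine Fin.cases (fun h => ?_) (fun i h => ?_) i h
    · obtain ⟨G, hG⟩ := exists_counitAt_succ_eq_consMap (T := T) j
      rw [counitAt_succ_succ, hG]
      exact (comulAt_zero_comp_consMap G).symm
    · refine Fin.cases (fun h => absurd h (by simp)) (fun j h => ?_) j h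
      have := congrArg consMap (ih (Fin.succ_le_succ_iff.1 h))
      rw [consMap_comp, consMap_comp] at this
      exact this

theorem counitAt_comp_comulAt_self {n : ℕ} (i : Fin (n + 1)) :
    counitAt T n i ∘ₗ comulAt T n i = LinearMap.id := by
  induction n with
  | zero =>
    refine hom_ext_one fun t => ?_
    have h : ∀ x : T ⊗[ℂ] T, counitAt T 0 i (cons T 0 ((one T).toLinearMap.lTensor T x)) =
        one T (TensorProduct.rid ℂ T ((Coalgebra.counit (R := ℂ)).lTensor T x)) := fun x =>
      TensorProduct.induction_on x (by simp) (fun a b => by simp [counitAt_zero_cons])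
        (fun x y hx hy => by simp only [map_add, hx, hy])
    rw [LinearMap.comp_apply, comulAt_zero_one, h, Coalgebra.lTensor_counit_comul]
    simp
  | succ n ih =>
    refine Fin.cases ?_ (fun i => ?_) i
    · refine hom_ext fun t u => ?_
      have h : ∀ x : T ⊗[ℂ] T, consMap (counitHead (n := n)) (cons T (n + 1)
          ((cons T n).toLinearMap.lTensor T (TensorProduct.assoc ℂ T T (Tpow T n) (x ⊗ₜ u)))) =
          cons T n (TensorProduct.rid ℂ T ((Coalgebra.counit (R := ℂ)).lTensor T x) ⊗ₜ u) := fun x =>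
        TensorProduct.induction_on x (by simp) (fun a b => by simp [TensorProduct.smul_tmul'])
          (fun x y hx hy => by simp only [map_add, add_tmul, hx, hy])
      rw [LinearMap.comp_apply, comulAt_succ_zero_cons, counitAt_succ_zero, h,
        Coalgebra.lTensor_counit_comul]
      simp
    · have := congrArg consMap (ih i)
      rw [consMap_comp, consMap_id] at this
      exact this

/-- The left counit law; one factor further to the right it becomes the identity sᵢdᵢ₊₁ = id. -/
theorem counitHead_comp_comulAt_zero (n : ℕ) :
    counitHead n ∘ₗ comulAt T n 0 = LinearMap.id := by
  cases n with
  | zero =>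
    refine hom_ext_one fun t => ?_
    have h : ∀ x : T ⊗[ℂ] T, counitHead 0 (cons T 0 ((one T).toLinearMap.lTensor T x)) =
        one T (TensorProduct.lid ℂ T ((Coalgebra.counit (R := ℂ)).rTensor T x)) := fun x =>
      TensorProduct.induction_on x (by simp) (fun a b => by simp)
        (fun x y hx hy => by simp only [map_add, hx, hy])
    rw [LinearMap.comp_apply, comulAt_zero_one, h, Coalgebra.rTensor_counit_comul]
    simp
  | succ n =>
    refine hom_ext fun t u => ?_
    have h : ∀ x : T ⊗[ℂ] T, counitHead (n + 1) (cons T (n + 1)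
        ((cons T n).toLinearMap.lTensor T (TensorProduct.assoc ℂ T T (Tpow T n) (x ⊗ₜ u)))) =
        cons T n (TensorProduct.lid ℂ T ((Coalgebra.counit (R := ℂ)).rTensor T x) ⊗ₜ u) := fun x =>
      TensorProduct.induction_on x (by simp) (fun a b => by simp [← TensorProduct.smul_tmul'])
        (fun x y hx hy => by simp only [map_add, add_tmul, hx, hy])
    rw [LinearMap.comp_apply, comulAt_succ_zero_cons, h, Coalgebra.rTensor_counit_comul]
    simp

theorem counitAt_comp_comulAt_succ {n : ℕ} (i : Fin (n + 1)) :
    counitAt T (n + 1) i.castSucc ∘ₗ comulAt T (n + 1) i.succ = LinearMap.id := by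
  have h0 : ∀ n, counitAt T (n + 1) 0 ∘ₗ comulAt T (n + 1) 1 = LinearMap.id := fun n => by
    have := congrArg consMap (counitHead_comp_comulAt_zero (T := T) n)
    rw [consMap_comp, consMap_id] at this
    exact this
  induction n with
  | zero =>
    obtain rfl := Subsingleton.elim (α := Fin 1) i 0
    exact h0 0
  | succ n ih =>
    refine Fin.cases (h0 (n + 1)) (fun i => ?_) i
    have := congrArg consMap (ih i)
    rw [consMap_comp, consMap_id] at this
    exact this

theorem counitAt_comp_comulAt_of_lt {n : ℕ} {i j : Fin (n + 1)} (h : j < i) :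
    counitAt T (n + 1) j.castSucc ∘ₗ comulAt T (n + 1) i.succ =
      comulAt T n i ∘ₗ counitAt T n j := by
  induction n with
  | zero => exact absurd h (by simp [Subsingleton.elim (α := Fin 1) i j])
  | succ n ih =>
    refine Fin.cases (fun h => absurd h (by simp)) (fun i h => ?_) i h
    refine Fin.cases (fun h => ?_) (fun j h => ?_) j h
    · have := congrArg consMap (counitHead_comp_consMap (comulAt T n i))
      rw [consMap_comp, consMap_comp] at this
      exact this
    · have := congrArg consMap (ih (Fin.succ_lt_succ_iff.1 h))
      rw [consMap_comp, consMap_comp] at this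
      exact this

theorem snoc_comulAt {n : ℕ} (i : Fin (n + 1)) (t : T) (u : Tpow T n) :
    snoc T (n + 1) (t ⊗ₜ comulAt T n i u) = comulAt T (n + 1) i.castSucc (snoc T n (t ⊗ₜ u)) := by
  induction n generalizing t with
  | zero =>
    obtain rfl := Subsingleton.elim (α := Fin 1) i 0
    obtain ⟨u, rfl⟩ := (one T).surjective u
    rw [snoc_zero, LinearEquiv.symm_apply_apply, Fin.castSucc_zero, comulAt_succ_zero_cons,
      comulAt_zero_one]
    exact TensorProduct.induction_on (Coalgebra.comul (R := ℂ) u) (by simp)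
      (fun x y => by simp [snoc_succ, snoc_zero])
      (fun x y hx hy => by simp only [map_add, add_tmul, tmul_add, hx, hy])
  | succ n ih =>
    refine Fin.cases ?_ (fun i => snoc_consMap (fun t u => ih i t u) t u) i
    refine induction_cons u (by simp) (fun s u => ?_)
      (fun x y hx hy => by simp only [map_add, tmul_add, hx, hy])
    rw [snoc_succ, Fin.castSucc_zero, comulAt_succ_zero_cons, comulAt_succ_zero_cons]
    exact TensorProduct.induction_on (Coalgebra.comul (R := ℂ) s) (by simp)
      (fun x y => by simp [snoc_succ])
      (fun x y hx hy => by simp only [map_add, add_tmul, tmul_add, hx, hy])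

theorem snoc_counitHead {n : ℕ} (t : T) (u : Tpow T (n + 1)) :
    snoc T n (t ⊗ₜ counitHead n u) = counitHead (n + 1) (snoc T (n + 1) (t ⊗ₜ u)) :=
  induction_cons u (by simp) (fun s u => by simp [snoc_succ])
    (fun x y hx hy => by simp only [map_add, tmul_add, hx, hy])

theorem snoc_counitAt {n : ℕ} (i : Fin (n + 1)) (t : T) (u : Tpow T (n + 1)) :
    snoc T n (t ⊗ₜ counitAt T n i u) =
      counitAt T (n + 1) i.castSucc (snoc T (n + 1) (t ⊗ₜ u)) := by
  induction n generalizing t with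
  | zero =>
    obtain rfl := Subsingleton.elim (α := Fin 1) i 0
    refine induction_cons u (by simp) (fun s u => ?_)
      (fun x y hx hy => by simp only [map_add, tmul_add, hx, hy])
    obtain ⟨u, rfl⟩ := (one T).surjective u
    rw [counitAt_zero_cons, snoc_succ, snoc_zero, Fin.castSucc_zero, counitAt_succ_zero]
    simp [snoc_zero, ← TensorProduct.smul_tmul']
  | succ n ih =>
    exact Fin.cases (snoc_consMap snoc_counitHead t u)
      (fun i => snoc_consMap (fun t u => ih i t u) t u) i

end Tpow

/-! ### The formal part: cocyclic identities from a core, and the complex of cyclic cochains. -/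

section Formal

variable (V : ℕ → Type*) [∀ n, AddCommGroup (V n)] [∀ n, Module ℂ (V n)]

/-- The part of a cocyclic structure from which the rest follows: all cofaces but the last, the
codegeneracies, and the cyclic operators. -/
structure CocyclicCore where
  d : ∀ n, Fin (n + 1) → (V n →ₗ[ℂ] V (n + 1))
  s : ∀ n, Fin (n + 1) → (V (n + 1) →ₗ[ℂ] V n)
  t : ∀ n, V n →ₗ[ℂ] V n
  d_d : ∀ n (i j : Fin (n + 1)), i ≤ j → ∀ x,
    d (n + 1) j.succ (d n i x) = d (n + 1) i.castSucc (d n j x)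
  s_s : ∀ n (i j : Fin (n + 1)), i ≤ j → ∀ x,
    s n j (s (n + 1) i.castSucc x) = s n i (s (n + 1) j.succ x)
  s_d_of_le : ∀ n (i j : Fin (n + 1)), i ≤ j → ∀ x,
    s (n + 1) j.succ (d (n + 1) i.castSucc x) = d n i (s n j x)
  s_d_self : ∀ n (i : Fin (n + 1)) x, s n i (d n i x) = x
  s_d_succ : ∀ n (i : Fin (n + 1)) x, s (n + 1) i.castSucc (d (n + 1) i.succ x) = x
  s_d_of_lt : ∀ n (i j : Fin (n + 1)), j < i → ∀ x,
    s (n + 1) j.castSucc (d (n + 1) i.succ x) = d n i (s n j x)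
  t_d : ∀ n (i : Fin (n + 1)) x, t (n + 2) (d (n + 1) i.succ x) = d (n + 1) i.castSucc (t (n + 1) x)
  t_s : ∀ n (i : Fin (n + 1)) x, t (n + 1) (s (n + 1) i.succ x) = s (n + 1) i.castSucc (t (n + 2) x)
  t_pow : ∀ n x, (t n ^ (n + 1)) x = x

variable {V}

namespace CocyclicCore

variable (D : CocyclicCore V)

theorem pow_t_d {n : ℕ} (i : Fin (n + 1)) (x : V n) :
    (D.t (n + 1) ^ (i : ℕ)) (D.d n i x) = D.d n 0 ((D.t n ^ (i : ℕ)) x) := by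
  obtain ⟨k, hk⟩ := i
  induction k generalizing x with
  | zero => rfl
  | succ k ih =>
    cases n with
    | zero => omega
    | succ n =>
      have h := D.t_d n ⟨k, by omega⟩ x
      simp only [pow_succ, Module.End.mul_apply]
      exact (congrArg _ h).trans (ih _ (by omega))

theorem pow_t_s {n : ℕ} (i : Fin (n + 1)) (x : V (n + 1)) :
    (D.t n ^ (i : ℕ)) (D.s n i x) = D.s n 0 ((D.t (n + 1) ^ (i : ℕ)) x) := by
  obtain ⟨k, hk⟩ := i
  induction k generalizing x with
  | zero => rfl
  | succ k ih =>
    cases n with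
    | zero => omega
    | succ n =>
      have h := D.t_s n ⟨k, by omega⟩ x
      simp only [pow_succ, Module.End.mul_apply]
      exact (congrArg _ h).trans (ih _ (by omega))

/-- With index n and argument tx, `pow_t_d` reads tⁿdₙtx = d₀tⁿ⁺¹x = d₀x. Apply t² and use tⁿ⁺² = id
in degree n + 1. -/
theorem t_t_d_zero (n : ℕ) (x : V n) :
    D.t (n + 1) (D.t (n + 1) (D.d n 0 x)) = D.d n (Fin.last n) (D.t n x) := by
  have h := D.pow_t_d (Fin.last n) (D.t n x)
  rw [Fin.val_last, ← Module.End.mul_apply (D.t n ^ n), ← pow_succ, D.t_pow] at h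
  have h' := D.t_pow (n + 1) (D.d n (Fin.last n) (D.t n x))
  rw [pow_succ', pow_succ'] at h'
  rw [← h]
  exact h'

/-- With index n and argument t²x, `pow_t_s` reads tⁿsₙt²x = s₀tⁿ⁺²x = s₀x. Apply t and use tⁿ⁺¹ =
id in degree n. -/
theorem t_s_zero (n : ℕ) (x : V (n + 1)) :
    D.t n (D.s n 0 x) = D.s n (Fin.last n) (D.t (n + 1) (D.t (n + 1) x)) := by
  have h := D.pow_t_s (Fin.last n) (D.t (n + 1) (D.t (n + 1) x))
  rw [Fin.val_last, ← Module.End.mul_apply (D.t (n + 1) ^ n), ← pow_succ,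
    ← Module.End.mul_apply (D.t (n + 1) ^ (n + 1)), ← pow_succ, D.t_pow] at h
  rw [← h, ← Module.End.mul_apply (D.t n), ← pow_succ', D.t_pow]

/-- In positive degree write x = ty. Then td₀x = t²d₁y, and `t_s_zero` gives ts₀d₁y = ty = x. In
degree 0 the map d₁ is not part of the core. There one applies d₀, which turns the claim into the
degree 1 case at d₀x, and removes d₀ again by s₀d₀ = id. -/
theorem s_last_t_d_zero (n : ℕ) (x : V n) :
    D.s n (Fin.last n) (D.t (n + 1) (D.d n 0 x)) = x := by
  have h1 : ∀ n (x : V (n + 1)), D.s (n + 1) (Fin.last _) (D.t (n + 2) (D.d (n + 1) 0 x)) = x :=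
    fun n x => by
    obtain ⟨y, rfl⟩ : ∃ y, D.t (n + 1) y = x :=
      ⟨(D.t (n + 1) ^ (n + 1)) x, by
        rw [← Module.End.mul_apply (D.t (n + 1)), ← pow_succ', D.t_pow]⟩
    have h2 := D.t_d n 0 y
    rw [Fin.castSucc_zero] at h2
    rw [← h2, ← t_s_zero]
    exact congrArg _ (D.s_d_succ n 0 y)
  cases n with
  | succ n => exact h1 n x
  | zero =>
    have h2 : D.d 0 0 (D.s 0 0 (D.t 1 (D.d 0 0 x))) = D.d 0 0 x := by
      have h3 := D.s_d_of_le 0 0 0 le_rfl (D.t 1 (D.d 0 0 x))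
      rw [← h3, ← D.t_d 0 0, D.d_d 0 0 0 le_rfl]
      exact h1 0 _
    have h4 := congrArg (D.s 0 0) h2
    rwa [D.s_d_self, D.s_d_self] at h4

/-- All cofaces; the last one is `t d₀`. -/
def δ (n : ℕ) (i : Fin (n + 2)) : V n →ₗ[ℂ] V (n + 1) :=
  Fin.lastCases (motive := fun _ => V n →ₗ[ℂ] V (n + 1)) (D.t (n + 1) ∘ₗ D.d n 0) (D.d n) i

theorem δ_castSucc (n : ℕ) (i : Fin (n + 1)) : D.δ n i.castSucc = D.d n i :=
  Fin.lastCases_castSucc ..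

theorem δ_last (n : ℕ) : D.δ n (Fin.last (n + 1)) = D.t (n + 1) ∘ₗ D.d n 0 :=
  Fin.lastCases_last ..

theorem δ_zero (n : ℕ) : D.δ n 0 = D.d n 0 := D.δ_castSucc n 0

theorem δ_succ_castSucc (n : ℕ) (i : Fin (n + 1)) :
    D.δ (n + 1) i.castSucc.succ = D.d (n + 1) i.succ := D.δ_castSucc (n + 1) i.succ

/-- The cocyclic module determined by its core. -/
def toCocyclicModule : CocyclicModule V where
  δ := D.δ
  σ := D.s
  τ := D.t
  δ_δ n i j hij := by
    ext x
    simp only [LinearMap.comp_apply]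
    rw [D.δ_castSucc (n + 1) i]
    induction j using Fin.lastCases with
    | last =>
      rw [Fin.succ_last, D.δ_last, D.δ_last]
      simp only [LinearMap.comp_apply]
      have h := D.t_d n
      induction i using Fin.lastCases with
      | last =>
        -- When both indices are last, the left side is td₀td₀x = t²d₁d₀x = t²d₀d₀x, and the right
        -- side becomes this by `t_t_d_zero`.
        rw [D.δ_last, ← t_t_d_zero]
        have h1 := D.t_d n 0 (D.d n 0 x)
        rw [Fin.castSucc_zero] at h1
        rw [LinearMap.comp_apply, ← h1, D.d_d n 0 0 le_rfl]
        rfl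
      | cast i =>
        rw [D.δ_castSucc, ← D.t_d, D.d_d n 0 i (Fin.zero_le _)]
        rfl
    | cast j =>
      induction i using Fin.lastCases with
      | last => exact absurd hij (by rw [Fin.le_def, Fin.val_last, Fin.val_castSucc]; omega)
      | cast i =>
        rw [D.δ_succ_castSucc, D.δ_castSucc, D.δ_castSucc]
        exact D.d_d n i j hij x
  σ_σ n i j hij := LinearMap.ext (D.s_s n i j hij)
  σ_δ_of_le n i j hij := by
    ext x
    induction i using Fin.lastCases with
    | last => exact absurd hij (by rw [Fin.le_def, Fin.val_last, Fin.val_castSucc]; omega)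
    | cast i =>
      rw [D.δ_castSucc, D.δ_castSucc]
      exact D.s_d_of_le n i j hij x
  σ_δ_self n i := by
    rw [D.δ_castSucc]
    exact LinearMap.ext (D.s_d_self n i)
  σ_δ_succ n i := by
    ext x
    induction i using Fin.lastCases with
    | last =>
      rw [Fin.succ_last, D.δ_last]
      exact D.s_last_t_d_zero n x
    | cast i =>
      cases n with
      | zero => exact i.elim0
      | succ n =>
        rw [D.δ_succ_castSucc]
        exact D.s_d_succ n i x
  σ_δ_of_gt n i j hij := by
    ext x
    induction i using Fin.lastCases with
    | last =>
      rw [Fin.succ_last, D.δ_last, D.δ_last]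
      simp only [LinearMap.comp_apply]
      have h := D.s_d_of_le n 0 j (Fin.zero_le _) x
      rw [← D.t_s, ← h]
      rfl
    | cast i =>
      rw [D.δ_succ_castSucc, D.δ_castSucc]
      exact D.s_d_of_lt n i j hij x
  τ_δ_succ n i := by
    ext x
    rw [D.δ_castSucc]
    induction i using Fin.lastCases with
    | last =>
      rw [Fin.succ_last, D.δ_last]
      exact D.t_t_d_zero n x
    | cast i =>
      cases n with
      | zero => exact i.elim0
      | succ n =>
        rw [D.δ_succ_castSucc]
        exact D.t_d n i x
  τ_δ_zero n := by rw [D.δ_zero, D.δ_last]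
  τ_σ_succ n i := by
    cases n with
    | zero => exact i.elim0
    | succ n => exact LinearMap.ext (D.t_s n i)
  τ_σ_zero n := LinearMap.ext (D.t_s_zero n)
  τ_pow n := LinearMap.ext (D.t_pow n)

end CocyclicCore

namespace CocyclicModule

variable (D : CocyclicModule V)

theorem b_apply (n : ℕ) (x : V n) : D.b n x = ∑ i : Fin (n + 2), (-1 : ℂ) ^ (i : ℕ) • D.δ n i x := by
  simp [b]

/-- With the outer index first, the terms (j + 1, i) and (i, j), i ≤ j, agree by `δ_δ` and carry
opposite signs; this pairing exhausts the double sum. -/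
theorem b_b (n : ℕ) (x : V n) : D.b (n + 1) (D.b n x) = 0 := by
  simp only [b_apply, map_sum, map_smul, Finset.smul_sum, smul_smul]
  rw [Finset.sum_comm, ← Finset.sum_product', Finset.univ_product_univ]
  let P := Fin (n + 3) × Fin (n + 2)
  let S : Finset P := {p | (p.2 : ℕ) < p.1}
  rw [← Finset.sum_add_sum_compl S, ← eq_neg_iff_add_eq_zero, ← Finset.sum_neg_distrib]
  refine Finset.sum_bij' (fun p hp => (p.2.castSucc, p.1.pred fun h => ?_))
    (fun p hp => (p.2.succ, p.1.castLT ?_)) ?_ ?_ ?_ ?_ ?_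
  · simp [S, h] at hp
  · simp only [S, Finset.compl_filter, Finset.mem_filter] at hp
    omega
  · simp only [S, Finset.mem_filter, Finset.mem_univ, true_and, Finset.mem_compl, Fin.val_castSucc,
      Fin.val_pred]
    omega
  · simp only [S, Finset.mem_filter, Finset.mem_univ, true_and, Finset.mem_compl, Fin.val_succ,
      Fin.val_castLT]
    omega
  · simp
  · simp
  · rintro ⟨j, i⟩ hp
    obtain ⟨j, rfl⟩ : ∃ j' : Fin (n + 2), j = j'.succ :=
      ⟨j.pred fun h => by simp [S, h] at hp, by simp⟩
    have hij : i ≤ j := by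
      simp only [S, Finset.mem_filter, Fin.val_succ] at hp
      exact Fin.le_def.2 (by omega)
    have h := LinearMap.congr_fun (D.δ_δ n i j hij) x
    simp only [LinearMap.comp_apply] at h
    simp only [h, Fin.val_succ, Fin.pred_succ, Fin.val_castSucc, pow_succ, ← neg_smul]
    congr 1
    ring

/-- τ turns δᵢ₊₁x into δᵢτx = (-1)ⁿδᵢx and δ₀x into the last coface. So it shifts the alternating
sum cyclically, and each term, including the one that wraps around, acquires the sign (-1)ⁿ⁺¹. -/
theorem b_mem_cyclicCochains {n : ℕ} {x : V n} (hx : x ∈ D.cyclicCochains n) :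
    D.b n x ∈ D.cyclicCochains (n + 1) := by
  have hx' : D.τ n x = (-1 : ℂ) ^ n • x := hx
  change D.τ (n + 1) (D.b n x) = (-1 : ℂ) ^ (n + 1) • D.b n x
  have h0 := LinearMap.congr_fun (D.τ_δ_zero n) x
  have h1 := fun i => LinearMap.congr_fun (D.τ_δ_succ n i) x
  simp only [LinearMap.comp_apply, hx', map_smul] at h0 h1
  rw [b_apply, map_sum, Fin.sum_univ_succ, Fin.sum_univ_castSucc (n := n + 1)]
  simp only [map_smul, h0, h1, smul_add, Finset.smul_sum, smul_smul, Fin.val_zero, pow_zero,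
    one_smul, Fin.val_succ, Fin.val_castSucc, Fin.val_last]
  rw [add_comm (D.δ n (Fin.last (n + 1)) x)]
  congr 1
  · refine Finset.sum_congr rfl fun i _ => ?_
    congr 1
    ring
  · rw [← mul_pow, neg_one_mul, neg_neg, one_pow, one_smul]

theorem cyclicCoboundaries_le (n : ℕ) : D.cyclicCoboundaries n ≤ D.cyclicCocycles n := by
  cases n with
  | zero => exact bot_le
  | succ n =>
    rintro _ ⟨x, hx, rfl⟩
    exact ⟨D.b_mem_cyclicCochains hx, D.b_b n x⟩

end CocyclicModule

end Formal

/-! ### The Hopf cyclic cochains form a core. -/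

section Cochains

variable {C K T M : Type*} [AddCommGroup C] [Module ℂ C] [Coalgebra ℂ C]
  [AddCommGroup K] [Module ℂ K] [Coalgebra ℂ K]
  [AddCommGroup T] [Module ℂ T] [Coalgebra ℂ T] [AddCommGroup M] [Module ℂ M]
  {H : LeftHopfCoalgebra C K} {L : LeftComoduleCoalgebra H T} {N : LeftRightSAYD H M}

/-- Naturality of the rotation in its second block. The operator F acts behind the first factor;
once that factor has moved to the end, F acts one place earlier, as recorded by G. This yields td_i
= d_{i-1}t and ts_i = s_{i-1}t for i ≥ 1. -/
theorem rotate_consMap {n m : ℕ} {F : Tpow T n →ₗ[ℂ] Tpow T m}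
    {G : Tpow T (n + 1) →ₗ[ℂ] Tpow T (m + 1)} (hF : L.IsColinear F)
    (hG : ∀ t u, Tpow.snoc T m (t ⊗ₜ F u) = G (Tpow.snoc T n (t ⊗ₜ u)))
    {x : M ⊗[ℂ] Tpow T (n + 1)} (hx : x ∈ cochains L N (n + 1)) :
    rotate L H.mulExt N.actExt m ((Tpow.consMap F).lTensor M x) =
      G.lTensor M (rotate L H.mulExt N.actExt n x) := by
  obtain ⟨y, hy, rfl⟩ := exists_of_mem_cochains_succ hx
  have h1 := rotate_cons L H.mulExt N.actExt (F := F ∘ₗ (L.cotensorPower n).subtype) (Q := ⊤)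
    (x := y) hF.comp_subtype.colinear (fun _ _ => Submodule.mem_top)
  have h2 : Tpow.consMap F ∘ₗ (Tpow.cons T n).toLinearMap ∘ₗ
      TensorProduct.map L.inclOne (L.cotensorPower n).subtype = (Tpow.cons T m).toLinearMap ∘ₗ
      TensorProduct.map L.inclOne (F ∘ₗ (L.cotensorPower n).subtype) := by
    ext a b
    simp
  rw [← LinearMap.lTensor_comp_apply, h2, h1, rotate_cons L H.mulExt N.actExt (Q := ⊤)
    (fun b _ => L.diagCoact_coe b) (fun _ _ => Submodule.mem_top), ← LinearMap.lTensor_comp_apply]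
  congr 2
  ext a b
  simp [hG]

theorem cyclicOp_mem : ∀ {n : ℕ} {x : M ⊗[ℂ] Tpow T n}, x ∈ cochains L N n →
    cyclicOp L H.mulExt N.actExt n x ∈ cochains L N n
  | 0, _, hx => hx
  | _ + 1, _, hx => rotate_mem hx

theorem coe_restrict_pow {R E : Type*} [Semiring R] [AddCommMonoid E] [Module R E]
    {f : E →ₗ[R] E} {p : Submodule R E} (hf : ∀ x ∈ p, f x ∈ p) (k : ℕ) (x : p) :
    ((f.restrict hf ^ k) x : E) = (f ^ k) x := by
  rw [Module.End.pow_restrict k]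
  rfl

variable (L N) in
/-- The core of the cocyclic module of Hopf cyclic cochains. -/
def cochainsCore : CocyclicCore (fun n => cochains L N n) where
  d n i := ((Tpow.comulAt T n i).lTensor M).restrict
    fun _ hx => (L.isColinear_comulAt n i).lTensor_mem_cochains hx
  s n i := ((Tpow.counitAt T n i).lTensor M).restrict
    fun _ hx => (L.isColinear_counitAt n i).lTensor_mem_cochains hx
  t n := (cyclicOp L H.mulExt N.actExt n).restrict fun _ hx => cyclicOp_mem hx
  d_d n i j hij x := Subtype.ext <| by
    simp only [LinearMap.coe_restrict_apply, ← LinearMap.lTensor_comp_apply,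
      Tpow.comulAt_comp_comulAt hij]
  s_s n i j hij x := Subtype.ext <| by
    simp only [LinearMap.coe_restrict_apply, ← LinearMap.lTensor_comp_apply,
      Tpow.counitAt_comp_counitAt hij]
  s_d_of_le n i j hij x := Subtype.ext <| by
    simp only [LinearMap.coe_restrict_apply, ← LinearMap.lTensor_comp_apply,
      Tpow.counitAt_comp_comulAt_of_le hij]
  s_d_self n i x := Subtype.ext <| by
    simp only [LinearMap.coe_restrict_apply, ← LinearMap.lTensor_comp_apply,
      Tpow.counitAt_comp_comulAt_self, LinearMap.lTensor_id, LinearMap.id_apply]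
  s_d_succ n i x := Subtype.ext <| by
    simp only [LinearMap.coe_restrict_apply, ← LinearMap.lTensor_comp_apply,
      Tpow.counitAt_comp_comulAt_succ, LinearMap.lTensor_id, LinearMap.id_apply]
  s_d_of_lt n i j hij x := Subtype.ext <| by
    simp only [LinearMap.coe_restrict_apply, ← LinearMap.lTensor_comp_apply,
      Tpow.counitAt_comp_comulAt_of_lt hij]
  t_d n i x := Subtype.ext (rotate_consMap (L.isColinear_comulAt n i) (Tpow.snoc_comulAt i) x.2)
  t_s n i x := Subtype.ext (rotate_consMap (L.isColinear_counitAt n i) (Tpow.snoc_counitAt i) x.2)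
  t_pow n x := Subtype.ext <| by
    rw [coe_restrict_pow]
    cases n with
    | zero => rfl
    | succ n => exact rotate_pow_eq x.2

theorem cyclicOp_eq {mul' : K ⊗[ℂ] K →ₗ[ℂ] K} {act' : K ⊗[ℂ] M →ₗ[ℂ] M}
    (hm : ∀ x : H.KK, mul' x = H.mul x)
    (ha : ∀ x : cotensor H.rightC N.coactC, act' x = N.act x) :
    ∀ {n : ℕ} {x : M ⊗[ℂ] Tpow T n}, x ∈ cochains L N n →
      cyclicOp L mul' act' n x = cyclicOp L H.mulExt N.actExt n x
  | 0, _, _ => rfl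
  | _ + 1, _, hx => rotate_eq hm ha hx

end Cochains

end TimesHopf

end

theorem mainTheorem6 {S K T M : Type*}
    [AddCommGroup S] [Module ℂ S] [Coalgebra ℂ S]
    [AddCommGroup K] [Module ℂ K] [Coalgebra ℂ K]
    [AddCommGroup T] [Module ℂ T] [Coalgebra ℂ T]
    [AddCommGroup M] [Module ℂ M]
    (H : TimesHopf.LeftHopfCoalgebra S K)
    (L : TimesHopf.LeftComoduleCoalgebra H T)
    (N : TimesHopf.LeftRightSAYD H M) :
    ∃ D : TimesHopf.CocyclicModule (fun n => TimesHopf.cochains L N n),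
      -- the cofaces but the last, and the codegeneracies
      (∀ n (i : Fin (n + 1)) (x : TimesHopf.cochains L N n),
        (D.δ n i.castSucc x : M ⊗[ℂ] TimesHopf.Tpow T (n + 1))
          = (TimesHopf.Tpow.comulAt T n i).lTensor M x) ∧
      (∀ n (i : Fin (n + 1)) (x : TimesHopf.cochains L N (n + 1)),
        (D.σ n i x : M ⊗[ℂ] TimesHopf.Tpow T n)
          = (TimesHopf.Tpow.counitAt T n i).lTensor M x) ∧
      -- the last coface and the cyclic operator, by formulas in which the multiplication of `K` and
      -- its action on `M` may be extended from the cotensor products in any way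
      (∀ (mul' : K ⊗[ℂ] K →ₗ[ℂ] K) (act' : K ⊗[ℂ] M →ₗ[ℂ] M),
        (∀ x : H.KK, mul' x = H.mul x) →
        (∀ x : TimesHopf.cotensor H.rightC N.coactC, act' x = N.act x) →
        (∀ n, TimesHopf.cochainsWith L N mul' n = TimesHopf.cochains L N n) ∧
        (∀ n (x : TimesHopf.cochains L N n),
          (D.δ n (Fin.last (n + 1)) x : M ⊗[ℂ] TimesHopf.Tpow T (n + 1))
            = TimesHopf.lastCoface L mul' act' n x) ∧
        (∀ n (x : TimesHopf.cochains L N n),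
          (D.τ n x : M ⊗[ℂ] TimesHopf.Tpow T n) = TimesHopf.cyclicOp L mul' act' n x)) ∧
      -- the cyclic cohomology of the cocyclic module is defined
      (∀ n, D.cyclicCoboundaries n ≤ D.cyclicCocycles n) := by
  let D := TimesHopf.cochainsCore L N
  refine ⟨D.toCocyclicModule, fun n i x => ?_, fun n i x => rfl, fun mul' act' hm ha =>
    ⟨TimesHopf.cochainsWith_eq hm, fun n x => ?_, fun n x => ?_⟩,
    D.toCocyclicModule.cyclicCoboundaries_le⟩
  · change (D.δ n i.castSucc x : M ⊗[ℂ] TimesHopf.Tpow T (n + 1)) = _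
    rw [D.δ_castSucc]
    rfl
  · change (D.δ n (Fin.last (n + 1)) x : M ⊗[ℂ] TimesHopf.Tpow T (n + 1)) = _
    rw [D.δ_last]
    -- The last coface is τδ₀, so independence of the extensions is needed at the cochain δ₀x, which
    -- has positive degree even for n = 0.
    exact (TimesHopf.rotate_eq hm ha (D.d n 0 x).2).symm
  · exact (TimesHopf.cyclicOp_eq hm ha x.2).symm
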